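/- Fix the following conventions. A tree on $[n]$ is an undirected tree with vertex set $[n]$. A probability distribution $Q$ on $\mathbb{R}^n$ with a density is *$T$-structured*, for a tree $T$ on $[n]$, if for some rooted orientation of $T$ every coordinate $X_i$ with $i$ not the root is, under $Q$, conditionally independent of the coordinates of its non-descendants given the coordinate of its parent; $Q$ is *tree-structured* if it is $T$-structured for some tree $T$. A tree $T$ is *$\varepsilon$-approximate* for $P$ if there is a $T$-structured distribution $Q_T$ with $$\mathsf{D_{KL}}(P\|Q_T)\le \varepsilon+\inf_{Q'\ \text{tree-structured}}\mathsf{D_{KL}}(P\|Q').$$ Given points $x_0,\dots,x_{m-1}\in\mathbb{R}^n$, the *Chow–Liu algorithm* (for arbitrary mean) forms the differences $w_t=x_{2t}-x_{2t+1}$, $0\le t<\lfloor m/2\rfloor$, computes for all $i<j$ the empirical correlations and mutual informations $$\widehat\rho_{ij}=\frac{\sum_t w_{t,i}w_{t,j}}{\sqrt{\left(\sum_t w_{t,i}^2\right)\left(\sum_t w_{t,j}^2\right)}},\qquad \widehat I_{ij}=-\tfrac12\log\left(1-\widehat\rho_{ij}^{\,2}\right)$$ (with the conventions $a/0=0$ and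 $\log 0=0$ on degenerate data), and outputs a maximum spanning tree of the complete graph on $[n]$ with edge weights $\widehat I_{ij}$. **Theorem (realizable case).** There are absolute constants $C,K>0$ such that the following holds. (i) The Chow–Liu algorithm can be implemented by a single program for a real random access machine (exact real arithmetic including $\sqrt{\cdot}$ and $\log$, comparisons and memory accesses, each at unit cost) which, on every input of $m\ge1$ points in $\mathbb{R}^n$, $n\ge1$, outputs a Chow–Liu tree after at most $K\,mn^2$ steps. (ii) Let $n,m\ge 1$, $\varepsilon,\delta\in(0,1)$, and let $P=N(\mu,\Sigma)$ be a tree-structured Gaussian distribution on $\mathbb{R}^n$ with arbitrary mean $\mu$ and positive definite covariance matrix $\Sigma$. If $$m\ \ge\ C\,\frac{n}{\varepsilon}\log\frac{n}{\delta},$$ then on $m$ i.i.d. samples from $P$, with probability at least $1-\delta$, the tree output by this program, and indeed every Chow–Liu tree of the samples (however ties between maximum spanning trees are broken), is an $\varepsilon$-approximate tree for $P$. In particular $m=O\!\left(\frac n\varepsilon\log\frac n\delta\right)$ samples and $O(mn^2)$ time suffice. -/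

import Mathlib

open MeasureTheory ProbabilityTheory InformationTheory
open scoped ENNReal

/-! ## A real random access machine with a step count

The memory consists of countably many one-dimensional arrays of natural numbers and countably many
two-dimensional arrays of real numbers.  One step is charged for every memory access, constant,
arithmetic operation, comparison and assignment, and for every iteration of a loop. Natural numbers
(used as indices) may be added, subtracted and compared. Real numbers are handled exactly by the
field operations, `√`, `log` and comparisons (with `a / 0 = 0` and `log 0 = 0`).  All loops are counting loops, hence every program of
this language halts; a program is a finite syntax tree that does not depend on the input size. -/

namespace RealRAM

/-- Memory contents. -/
structure State where
  /-- `nat a i` is the entry `i` of the natural number array `a`. -/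
  nat : ℕ → ℕ → ℕ
  /-- `real a i j` is the entry `(i, j)` of the real array `a`. -/
  real : ℕ → ℕ → ℕ → ℝ

/-- Overwrite the entry `i` of the natural number array `a` by `v`. -/
def State.setNat (s : State) (a i v : ℕ) : State where
  nat := fun a' i' => if a' = a ∧ i' = i then v else s.nat a' i'
  real := s.real

/-- Overwrite the entry `(i, j)` of the real array `a` by `v`. -/
def State.setReal (s : State) (a i j : ℕ) (v : ℝ) : State where
  nat := s.nat
  real := open Classical in
    fun a' i' j' => if a' = a ∧ i' = i ∧ j' = j then v else s.real a' i' j'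

/-- Natural number expressions. -/
inductive NatExpr where
  | const (k : ℕ)
  | read (a : ℕ) (i : NatExpr)
  | add (e f : NatExpr)
  | sub (e f : NatExpr)

/-- Value of a natural number expression (subtraction is truncated at zero). -/
def NatExpr.eval (s : State) : NatExpr → ℕ
  | const k => k
  | read a i => s.nat a (i.eval s)
  | add e f => e.eval s + f.eval s
  | sub e f => e.eval s - f.eval s

/-- Number of steps spent in evaluating a natural number expression. -/
def NatExpr.cost : NatExpr → ℕ
  | const _ => 1
  | read _ i => i.cost + 1
  | add e f => e.cost + f.cost + 1
  | sub e f => e.cost + f.cost + 1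

/-- Real number expressions; only rational constants are available. -/
inductive RealExpr where
  | const (q : ℚ)
  | read (a : ℕ) (i j : NatExpr)
  | add (e f : RealExpr)
  | sub (e f : RealExpr)
  | mul (e f : RealExpr)
  | div (e f : RealExpr)
  | sqrt (e : RealExpr)
  | log (e : RealExpr)

/-- Value of a real number expression. -/
noncomputable def RealExpr.eval (s : State) : RealExpr → ℝ
  | const q => (q : ℝ)
  | read a i j => s.real a (i.eval s) (j.eval s)
  | add e f => e.eval s + f.eval s
  | sub e f => e.eval s - f.eval s
  | mul e f => e.eval s * f.eval s
  | div e f => e.eval s / f.eval s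
  | sqrt e => Real.sqrt (e.eval s)
  | log e => Real.log (e.eval s)

/-- Number of steps spent in evaluating a real number expression. -/
def RealExpr.cost : RealExpr → ℕ
  | const _ => 1
  | read _ i j => i.cost + j.cost + 1
  | add e f => e.cost + f.cost + 1
  | sub e f => e.cost + f.cost + 1
  | mul e f => e.cost + f.cost + 1
  | div e f => e.cost + f.cost + 1
  | sqrt e => e.cost + 1
  | log e => e.cost + 1

/-- Programs. -/
inductive Program where
  | skip
  /-- assign the value of `e` to the entry `i` of the natural number array `a` -/
  | assignNat (a : ℕ) (i e : NatExpr)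
  /-- assign the value of `e` to the entry `(i, j)` of the real array `a` -/
  | assignReal (a : ℕ) (i j : NatExpr) (e : RealExpr)
  | seq (p q : Program)
  /-- if `e ≤ f` then `p` else `q` -/
  | ifNatLe (e f : NatExpr) (p q : Program)
  /-- if `e ≤ f` then `p` else `q` -/
  | ifRealLe (e f : RealExpr) (p q : Program)
  /-- evaluate `e` once, then execute `p` with the entry `0` of the natural number array `a` set
  successively to `0, 1, …, e - 1` -/
  | loop (a : ℕ) (e : NatExpr) (p : Program)

open Classical in
/-- The state reached by a program, and the number of steps that it takes. -/
noncomputable def Program.run : Program → State → State × ℕ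
  | skip, s => (s, 1)
  | assignNat a i e, s => (s.setNat a (i.eval s) (e.eval s), i.cost + e.cost + 1)
  | assignReal a i j e, s =>
      (s.setReal a (i.eval s) (j.eval s) (e.eval s), i.cost + j.cost + e.cost + 1)
  | seq p q, s => ((q.run (p.run s).1).1, (p.run s).2 + (q.run (p.run s).1).2)
  | ifNatLe e f p q, s =>
      let r := if e.eval s ≤ f.eval s then p.run s else q.run s
      (r.1, e.cost + f.cost + 1 + r.2)
  | ifRealLe e f p q, s =>
      let r := if e.eval s ≤ f.eval s then p.run s else q.run s
      (r.1, e.cost + f.cost + 1 + r.2)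
  | loop a e p, s =>
      Nat.rec (s, e.cost + 1)
        (fun k (c : State × ℕ) =>
          ((p.run (c.1.setNat a 0 k)).1, c.2 + 1 + (p.run (c.1.setNat a 0 k)).2))
        (e.eval s)

/-- The initial memory for a data set of `m` points in `ℝⁿ`: the natural number array `0` starts
with `n, m`, the real array `0` holds the data, and everything else is zero. -/
noncomputable def initial {m n : ℕ} (x : Fin m → EuclideanSpace ℝ (Fin n)) : State where
  nat := fun a i => if a = 0 ∧ i = 0 then n else if a = 0 ∧ i = 1 then m else 0
  real := fun a t i =>
    if h : a = 0 ∧ t < m ∧ i < n then x ⟨t, h.2.1⟩ ⟨i, h.2.2⟩ else 0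

/-- The graph on `{0, …, n - 1}` output by a program: its edges are `{u k, v k}` for `k < n - 1`,
where `u` and `v` are the final contents of the natural number arrays `1` and `2`. -/
noncomputable def Program.outputGraph {m n : ℕ} (p : Program)
    (x : Fin m → EuclideanSpace ℝ (Fin n)) : SimpleGraph (Fin n) :=
  SimpleGraph.fromRel fun i j => ∃ k < n - 1,
    (p.run (initial x)).1.nat 1 k = i ∧ (p.run (initial x)).1.nat 2 k = j

/-- The running time of a program on a data set. -/
noncomputable def Program.time {m n : ℕ} (p : Program)
    (x : Fin m → EuclideanSpace ℝ (Fin n)) : ℕ :=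
  (p.run (initial x)).2

end RealRAM

/-! ## Tree-structured distributions and approximate trees -/

/-- The non-descendants of `i` in the tree `T` rooted at `r`: the vertices `j` such that `i` does
not lie on the path from `r` to `j`. -/
def nonDescendants {n : ℕ} (T : SimpleGraph (Fin n)) (r i : Fin n) : Set (Fin n) :=
  {j | T.dist r j ≠ T.dist r i + T.dist i j}

/-- `P` is a `T`-structured distribution on `ℝⁿ`: `T` is a tree, `P` has a density, and, for a
rooted orientation of `T`, every coordinate is conditionally independent of its non-descendants
given its parent. (There is no condition on the root, which has no non-descendants.) -/
def IsStructured {n : ℕ} (T : SimpleGraph (Fin n)) (P : Measure (EuclideanSpace ℝ (Fin n)))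
    [IsProbabilityMeasure P] : Prop :=
  T.IsTree ∧ P ≪ volume ∧
    ∃ r : Fin n, ∀ p i : Fin n, T.Adj p i → T.dist r i = T.dist r p + 1 →
      CondIndepFun
        (MeasurableSpace.comap (fun x : EuclideanSpace ℝ (Fin n) => x p) inferInstance)
        (Measurable.comap_le (by fun_prop))
        (fun x : EuclideanSpace ℝ (Fin n) => x i)
        (fun (x : EuclideanSpace ℝ (Fin n)) (j : nonDescendants T r i) => x j) P

/-- `P` is tree-structured if it is `T`-structured for some tree `T`. -/
def IsTreeStructured {n : ℕ} (P : Measure (EuclideanSpace ℝ (Fin n)))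
    [IsProbabilityMeasure P] : Prop :=
  ∃ T : SimpleGraph (Fin n), IsStructured T P

/-- `T` is an `ε`-approximate tree for `P`: some `T`-structured distribution `Q` satisfies
`KL(P‖Q) ≤ ε + inf KL(P‖Q')`, the infimum being over all tree-structured distributions `Q'`. -/
def IsApproximateTree {n : ℕ} (ε : ℝ) (P : Measure (EuclideanSpace ℝ (Fin n)))
    (T : SimpleGraph (Fin n)) : Prop :=
  ∃ Q : ProbabilityMeasure (EuclideanSpace ℝ (Fin n)),
    IsStructured T (Q : Measure (EuclideanSpace ℝ (Fin n))) ∧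
    klDiv P Q ≤ ENNReal.ofReal ε +
      ⨅ (Q' : ProbabilityMeasure (EuclideanSpace ℝ (Fin n)))
        (_ : IsTreeStructured (Q' : Measure (EuclideanSpace ℝ (Fin n)))),
        klDiv P Q'

/-! ## The Chow–Liu tree of a data set -/

/-- The differences `x 0 - x 1, x 2 - x 3, …` of consecutive data points. -/
noncomputable def pairDifferences {m n : ℕ} (x : Fin m → EuclideanSpace ℝ (Fin n)) :
    Fin (m / 2) → EuclideanSpace ℝ (Fin n) :=
  fun t => x ⟨2 * t, by omega⟩ - x ⟨2 * t + 1, by omega⟩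

/-- The empirical correlation coefficient of the coordinates `i` and `j` of (centred) data. -/
noncomputable def empiricalCorrelation {k n : ℕ} (w : Fin k → EuclideanSpace ℝ (Fin n))
    (i j : Fin n) : ℝ :=
  (∑ t, w t i * w t j) / Real.sqrt ((∑ t, w t i * w t i) * (∑ t, w t j * w t j))

/-- The empirical mutual information of the coordinates `i` and `j` of (centred) data. The
conventions `a / 0 = 0` and `log 0 = 0` only matter for degenerate data. -/
noncomputable def empiricalMutualInfo {k n : ℕ} (w : Fin k → EuclideanSpace ℝ (Fin n))
    (i j : Fin n) : ℝ :=
  -(1 / 2) * Real.log (1 - empiricalCorrelation w i j ^ 2)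

open Classical in
/-- The total weight of a graph, the edge `{i, j}`, `i < j`, having weight `w i j`. -/
noncomputable def graphWeight {n : ℕ} (w : Fin n → Fin n → ℝ) (T : SimpleGraph (Fin n)) : ℝ :=
  ∑ e : Fin n × Fin n with e.1 < e.2 ∧ T.Adj e.1 e.2, w e.1 e.2

/-- `T` is a maximum spanning tree of the complete graph with edge weights `w`. -/
def IsMaxSpanningTree {n : ℕ} (w : Fin n → Fin n → ℝ) (T : SimpleGraph (Fin n)) : Prop :=
  T.IsTree ∧ ∀ T' : SimpleGraph (Fin n), T'.IsTree → graphWeight w T' ≤ graphWeight w T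

/-- `T` is a possible result of the Chow–Liu algorithm on the data `x`: a maximum spanning tree with
respect to the empirical mutual informations of the differences of consecutive data points. -/
def IsChowLiuTree {m n : ℕ} (x : Fin m → EuclideanSpace ℝ (Fin n)) (T : SimpleGraph (Fin n)) :
    Prop :=
  IsMaxSpanningTree (empiricalMutualInfo (pairDifferences x)) T

/-! # Chow–Liu trees of tree-structured Gaussian distributions

For a covariance matrix `S` write `W(T)` for the sum of the Gaussian mutual informations
`gaussianMutualInfo S i j` over the edges of a tree `T`.

*Reduction to weights.* Regressing each coordinate on its parent along `T`, and then making the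
residuals independent, produces a `T`-structured Gaussian `N(μ, treeCovariance T r S)`. If
`P = N(μ, S)` is itself structured along a tree `R`, its relative entropy to that distribution is
`W(R) - W(T)` (`klDiv_treeCovariance`). Relative entropies being nonnegative, `T` is
`ε`-approximate as soon as `W(R) ≤ W(T) + ε` (`isApproximateTree_of_graphWeight_le`). That the
conditional independences of a Gaussian amount to the local Markov property
`S i p * S p j = S p p * S i j` of its covariance matrix is `localMarkov_of_condIndepFun` in one
direction and `isStructured_multivariateGaussian` in the other.

*Comparison of trees.* Let `T` be a Chow–Liu tree. Hall's theorem matches the edges `uv` of `R`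
with edges `xy` of `T` such that `uv` separates `x` from `y` in `R` and `xy` is empirically at least
as heavy as `uv` (`IsMaxSpanningTree.exists_matching`). Then `x - u - v - y`, up to exchanging `u`
and `v`, is a Markov chain, so that truly `uv` is at least as heavy as `xy`. The loss
`W(R) - W(T)` is therefore at most `n` times the largest possible difference of true weights
between matched edges (`IsMaxSpanningTree.graphWeight_le`).

*One Markov chain.* It remains to see that an empirical inversion along a Markov chain `a - b - c`
forces the true gap `I(a, b) - I(a, c)` to be small. By the chain rule the gap equals
`I(a, b | c) - I(a, c | b)`, for the true as well as for the empirical distribution, and the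
subtrahend vanishes for the true one. If the orthonormalised coordinates have an empirical Gram
matrix which is `τ`-close to the identity, the empirical subtrahend is of order `τ²`, while the
empirical minuend is at least a constant fraction of the true one up to `τ²` (`log_gap_le`,
`gaussianMutualInfo_gap_le`). The error is quadratic in `τ`: this is why `τ² ≈ ε / n`, and hence
`n / ε` samples up to the logarithm, suffice. Closeness of the Gram matrices is a statement about
`O(n³)` empirical variances, and follows from a Chernoff bound for the chi-squared distribution
(`measure_abs_empiricalForm_sub_one_le`) and a union bound (`measure_not_isAccurate_le`).

*The program.* The program computes the Gram matrix of the differences and grows the tree by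
Prim's algorithm. The invariant of its rounds is that the edges chosen so far extend to a maximum
spanning tree (`PrimInvariant`); correctness is `RealRAM.isChowLiuTree_outputGraph`. The number of
iterations of every loop depends on `n` and `m` only, whence `RealRAM.time_chowLiuProgram_le`.
-/

/-! ### Exchanges in spanning trees -/

namespace SimpleGraph

variable {V : Type*}

/-- After the removal of an edge `pq` of a connected graph every vertex is still joined to `p` or
to `q`. -/
lemma Connected.reachable_deleteEdges_or {T : SimpleGraph V} (hT : T.Connected) (p q x : V) :
    (T.deleteEdges {s(p, q)}).Reachable x p ∨ (T.deleteEdges {s(p, q)}).Reachable x q := by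
  obtain ⟨w⟩ := hT.preconnected x p
  induction w with
  | nil => exact Or.inl (Reachable.refl _)
  | @cons a b c hab w ih =>
    by_cases h : s(a, b) = s(c, q)
    · rcases Sym2.eq_iff.1 h with ⟨rfl, rfl⟩ | ⟨rfl, rfl⟩
      · exact Or.inl (Reachable.refl _)
      · exact Or.inr (Reachable.refl _)
    · have hab' : (T.deleteEdges {s(c, q)}).Adj a b := by simp [hab, h]
      exact ih.imp hab'.reachable.trans hab'.reachable.trans

/-- Exchange property: if the removal of the edge `pq` of a tree separates `u` from `v`, then
replacing `pq` by `uv` gives a tree. -/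
lemma IsTree.exchange {T : SimpleGraph V} (hT : T.IsTree) {p q u v : V}
    (huv : ¬(T.deleteEdges {s(p, q)}).Reachable u v) :
    (T.deleteEdges {s(p, q)} ⊔ edge u v).IsTree := by
  set H := T.deleteEdges {s(p, q)} with hH
  have hle : H ≤ H ⊔ edge u v := le_sup_left
  have hne : u ≠ v := by rintro rfl; exact huv (Reachable.refl _)
  have huv' : (H ⊔ edge u v).Reachable u v := by
    apply Adj.reachable
    simp [edge_adj, hne]
  have hpq : (H ⊔ edge u v).Reachable p q := by
    rcases hT.connected.reachable_deleteEdges_or p q u with hu | hu <;>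
    rcases hT.connected.reachable_deleteEdges_or p q v with hv | hv
    · exact absurd (hu.trans hv.symm) huv
    · exact ((hu.mono hle).symm.trans huv').trans (hv.mono hle)
    · exact ((hv.mono hle).symm.trans huv'.symm).trans (hu.mono hle)
    · exact absurd (hu.trans hv.symm) huv
  have hp : ∀ x, (H ⊔ edge u v).Reachable x p := fun x =>
    (hT.connected.reachable_deleteEdges_or p q x).elim (fun h => h.mono hle)
      fun h => (h.mono hle).trans hpq.symm
  have : Nonempty V := ⟨p⟩
  exact ⟨⟨fun x y => (hp x).trans (hp y).symm⟩,
    (hT.isAcyclic.anti (deleteEdges_le _)).sup_edge_of_not_reachable huv⟩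

lemma Reachable.of_adj_reachable {G H : SimpleGraph V}
    (h : ∀ a b, G.Adj a b → H.Reachable a b) {x y : V} (hxy : G.Reachable x y) :
    H.Reachable x y := by
  obtain ⟨w⟩ := hxy
  induction w with
  | nil => exact Reachable.refl _
  | cons hab _ ih => exact (h _ _ hab).trans ih

/-- Two vertices of a tree are joined by edges each of which separates them. -/
lemma IsTree.reachable_separating {T : SimpleGraph V} (hT : T.IsTree) (x y : V) :
    (fromEdgeSet {e ∈ T.edgeSet | ¬(T.deleteEdges {e}).Reachable x y}).Reachable x y := by
  classical
  obtain ⟨p, hp⟩ := hT.connected.exists_isPath x y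
  refine ⟨p.transfer _ fun e he => ?_⟩
  have heT := p.edges_subset_edgeSet he
  refine (edgeSet_fromEdgeSet _).symm ▸ ⟨⟨heT, ?_⟩, T.not_isDiag_of_mem_edgeSet heT⟩
  intro hr
  obtain ⟨q, hq⟩ := hr.exists_isPath
  have h2 : (⟨p, hp⟩ : T.Path x y) = ⟨q.mapLe (deleteEdges_le _), hq.mapLe _⟩ :=
    (hT.isAcyclic.subsingleton_path x y).elim _ _
  have h3 : p = q.mapLe (deleteEdges_le _) := congrArg Subtype.val h2
  rw [h3] at he
  have : e ∈ q.edges := by simpa using he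
  simpa using q.edges_subset_edgeSet this

end SimpleGraph

/-! ### Maximum spanning trees -/

open SimpleGraph

variable {n : ℕ}

open Classical in
/-- For symmetric weights the weight of a graph is a sum over its unordered edges. -/
lemma graphWeight_eq_sum (ω : Sym2 (Fin n) → ℝ) (T : SimpleGraph (Fin n)) :
    graphWeight (fun i j => ω s(i, j)) T = ∑ e ∈ T.edgeFinset, ω e := by
  unfold graphWeight
  refine Finset.sum_bij (fun e _ => s(e.1, e.2)) ?_ ?_ ?_ ?_
  · rintro ⟨i, j⟩ h
    simpa using (Finset.mem_filter.1 h).2.2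
  · rintro ⟨i, j⟩ h ⟨i', j'⟩ h' he
    have h1 := (Finset.mem_filter.1 h).2.1
    have h2 := (Finset.mem_filter.1 h').2.1
    rcases Sym2.eq_iff.1 he with ⟨h3, h4⟩ | ⟨h3, h4⟩
    · exact Prod.ext h3 h4
    · simp only at h1 h2 h3 h4
      subst h3 h4
      exact absurd h1 h2.not_gt
  · intro e
    induction e with | _ i j
    intro h
    have hij : T.Adj i j := by simpa using h
    rcases lt_or_gt_of_ne hij.ne with h1 | h1
    · exact ⟨(i, j), by simp [h1, hij], rfl⟩
    · exact ⟨(j, i), by simp [h1, hij.symm], Sym2.eq_swap⟩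
  · rintro ⟨i, j⟩ _
    rfl

lemma graphWeight_exchange (ω : Sym2 (Fin n) → ℝ) {T : SimpleGraph (Fin n)}
    {p q u v : Fin n} (hpq : T.Adj p q) (huv : ¬(T.deleteEdges {s(p, q)}).Reachable u v) :
    graphWeight (fun i j => ω s(i, j)) (T.deleteEdges {s(p, q)} ⊔ edge u v) =
      graphWeight (fun i j => ω s(i, j)) T - ω s(p, q) + ω s(u, v) := by
  classical
  have hne : u ≠ v := by rintro rfl; exact huv (Reachable.refl _)
  rw [graphWeight_eq_sum, graphWeight_eq_sum]
  refine (Finset.sum_congr (s₂ := insert s(u, v) (T.edgeFinset.erase s(p, q)))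
    (Finset.ext fun e => ?_) fun _ _ => rfl).trans ?_
  · simp only [mem_edgeFinset, edgeSet_sup, edgeSet_edge_of_ne hne, edgeSet_deleteEdges,
      Finset.mem_insert, Finset.mem_erase, Set.mem_union, Set.mem_sdiff, Set.mem_singleton_iff]
    tauto
  rw [Finset.sum_insert, Finset.sum_erase_eq_sub (by simpa using hpq)]
  · ring
  · intro h
    refine huv (Adj.reachable ?_)
    simp only [Finset.mem_erase, mem_edgeFinset, mem_edgeSet] at h
    simp [h.1, h.2]

/-- Cycle property of maximum spanning trees: an edge of the tree that separates `u` from `v` is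
at least as heavy as `uv`. -/
lemma IsMaxSpanningTree.le_of_not_reachable {ω : Sym2 (Fin n) → ℝ} {T : SimpleGraph (Fin n)}
    (hT : IsMaxSpanningTree (fun i j => ω s(i, j)) T) {f : Sym2 (Fin n)} (hf : f ∈ T.edgeSet)
    {u v : Fin n} (huv : ¬(T.deleteEdges {f}).Reachable u v) : ω s(u, v) ≤ ω f := by
  induction f with | _ p q
  have h := hT.2 _ (hT.1.exchange huv)
  rw [graphWeight_exchange ω hf huv] at h
  linarith

/-- The edges of a maximum spanning tree `T` can be matched with the edges of any spanning tree
`R` such that the partner of an edge `xy` of `T` lies on the path of `R` from `x` to `y` and is not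
heavier than `xy`.

This is Hall's theorem. For a set `F` of edges of `T` let `N` be the set of admissible partners of
its members. The graph `H` with the edges `N ∪ (T \ F)` is connected, whence `|F| ≤ |N|`: the path
of `R` between the ends of `f ∈ F` uses partners of `f` and edges heavier than `f`, and the ends of
the latter are joined by edges of `T` heavier than `f`, so that induction on the weight applies. -/
lemma IsMaxSpanningTree.exists_matching {ω : Sym2 (Fin n) → ℝ} {T R : SimpleGraph (Fin n)}
    (hT : IsMaxSpanningTree (fun i j => ω s(i, j)) T) (hR : R.IsTree) :
    ∃ σ : T.edgeSet → Sym2 (Fin n), Function.Injective σ ∧ ∀ f : T.edgeSet,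
      σ f ∈ R.edgeSet ∧ ω (σ f) ≤ ω f ∧
      ∀ x y, (f : Sym2 (Fin n)) = s(x, y) → ¬(R.deleteEdges {σ f}).Reachable x y := by
  classical
  let P : Sym2 (Fin n) → Sym2 (Fin n) → Prop := fun f e =>
    ω e ≤ ω f ∧ ∀ x y, f = s(x, y) → ¬(R.deleteEdges {e}).Reachable x y
  have hP : ∀ x y e, (P s(x, y) e ↔ ω e ≤ ω s(x, y) ∧ ¬(R.deleteEdges {e}).Reachable x y) := by
    intro x y e
    refine and_congr_right fun _ => ⟨fun h => h x y rfl, fun h x' y' h' => ?_⟩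
    rcases Sym2.eq_iff.1 h' with ⟨rfl, rfl⟩ | ⟨rfl, rfl⟩
    · exact h
    · exact fun h'' => h h''.symm
  let t : T.edgeSet → Finset (Sym2 (Fin n)) := fun f => R.edgeFinset.filter (P f)
  suffices h : ∀ F : Finset T.edgeSet, F.card ≤ (F.biUnion t).card by
    obtain ⟨σ, hσ, hσt⟩ := (Finset.all_card_le_biUnion_card_iff_exists_injective t).1 h
    refine ⟨σ, hσ, fun f => ?_⟩
    have := Finset.mem_filter.1 (hσt f)
    exact ⟨by simpa using this.1, this.2.1, this.2.2⟩
  intro F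
  set N := F.biUnion t with hN
  let F' : Finset (Sym2 (Fin n)) := F.image Subtype.val
  have hF'T : F' ⊆ T.edgeFinset := by
    intro e he
    obtain ⟨f, -, rfl⟩ := Finset.mem_image.1 he
    simp
  let S : Finset (Sym2 (Fin n)) := N ∪ (T.edgeFinset \ F')
  let H : SimpleGraph (Fin n) := fromEdgeSet (S : Set (Sym2 (Fin n)))
  have hadj : ∀ x y, x ≠ y → s(x, y) ∈ S → H.Reachable x y := fun x y hxy h =>
    Adj.reachable ((fromEdgeSet_adj _).2 ⟨h, hxy⟩)
  have key : ∀ f : Sym2 (Fin n), ∀ x y, f = s(x, y) → f ∈ T.edgeSet → H.Reachable x y := by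
    have : IsTrans (Sym2 (Fin n)) fun f g => ω g < ω f := ⟨fun _ _ _ h h' => h'.trans h⟩
    have : Std.Irrefl fun f g : Sym2 (Fin n) => ω g < ω f := ⟨fun _ => lt_irrefl _⟩
    intro f
    induction f using (Finite.wellFounded_of_trans_of_irrefl
      fun f g : Sym2 (Fin n) => ω g < ω f).induction with | _ f ih
    rintro x y rfl hfT
    have hxy : T.Adj x y := hfT
    by_cases hfF : s(x, y) ∈ F'
    swap
    · exact hadj x y hxy.ne (Finset.mem_union_right _ (by simp [hfF, hxy]))
    -- walk along the path of `R` from `x` to `y`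
    have hstep : ∀ a b, (fromEdgeSet {e ∈ R.edgeSet |
        ¬(R.deleteEdges {e}).Reachable x y}).Adj a b → H.Reachable a b := by
      intro a b hab
      obtain ⟨⟨habR, hsep⟩, hne⟩ := (fromEdgeSet_adj _).1 hab
      by_cases hω : ω s(a, b) ≤ ω s(x, y)
      · refine hadj a b hne (Finset.mem_union_left _ (Finset.mem_biUnion.2 ?_))
        obtain ⟨f, hf, hfe⟩ := Finset.mem_image.1 hfF
        refine ⟨f, hf, Finset.mem_filter.2 ⟨by simpa using habR, ?_⟩⟩
        rw [hfe]
        exact (hP _ _ _).2 ⟨hω, hsep⟩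
      · push Not at hω
        -- an edge heavier than `xy` is bridged by still heavier edges of `T`
        refine Reachable.of_adj_reachable (fun c d hcd => ?_) (hT.1.reachable_separating a b)
        obtain ⟨⟨hcdT, hsep'⟩, -⟩ := (fromEdgeSet_adj _).1 hcd
        exact ih s(c, d) (hω.trans_le (hT.le_of_not_reachable hcdT hsep')) c d rfl hcdT
    exact Reachable.of_adj_reachable hstep (hR.reachable_separating x y)
  have hconn : H.Connected := by
    have := hT.1.connected.nonempty
    exact ⟨fun x y => Reachable.of_adj_reachable (fun a b hab => key _ _ _ rfl hab)
      (hT.1.connected.preconnected x y)⟩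
  have hcard := hconn.card_vert_le_card_edgeSet_add_one
  have hle : Nat.card H.edgeSet ≤ S.card := by
    rw [Nat.card_coe_set_eq, ← Set.ncard_coe_finset S]
    refine Set.ncard_le_ncard ?_ S.finite_toSet
    rw [edgeSet_fromEdgeSet]
    exact Set.sdiff_subset
  have hS : S.card ≤ N.card + (T.edgeFinset.card - F'.card) :=
    (Finset.card_union_le _ _).trans (by rw [Finset.card_sdiff_of_subset hF'T])
  have hTc := hT.1.card_edgeFinset
  have hF'c : F'.card = F.card := Finset.card_image_of_injective _ Subtype.val_injective
  have := Finset.card_le_card hF'T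
  rw [Nat.card_eq_fintype_card] at hcard
  omega

/-- If every admissible pair of edges loses at most `c` in the weights `I`, then the maximum
spanning tree `T` for `ω` loses at most `n c` against `R`. -/
lemma IsMaxSpanningTree.graphWeight_le {ω I : Sym2 (Fin n) → ℝ} {T R : SimpleGraph (Fin n)}
    (hT : IsMaxSpanningTree (fun i j => ω s(i, j)) T) (hR : R.IsTree) {c : ℝ} (hc : 0 ≤ c)
    (h : ∀ x y u v, R.Adj u v → x ≠ y → ¬(R.deleteEdges {s(u, v)}).Reachable x y →
      ω s(u, v) ≤ ω s(x, y) → I s(u, v) - I s(x, y) ≤ c) :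
    graphWeight (fun i j => I s(i, j)) R ≤ graphWeight (fun i j => I s(i, j)) T + n * c := by
  classical
  obtain ⟨σ, hσ, hσR⟩ := hT.exists_matching hR
  rw [graphWeight_eq_sum, graphWeight_eq_sum]
  have hTc := hT.1.card_edgeFinset
  have hRc := hR.card_edgeFinset
  have himg : Finset.univ.image σ = R.edgeFinset := by
    refine Finset.eq_of_subset_of_card_le ?_ ?_
    · intro e he
      obtain ⟨f, -, rfl⟩ := Finset.mem_image.1 he
      simpa using (hσR f).1
    · rw [Finset.card_image_of_injective _ hσ, Finset.card_univ, ← edgeFinset_card]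
      omega
  have h1 : ∑ e ∈ R.edgeFinset, I e = ∑ f : T.edgeSet, I (σ f) := by
    rw [← himg, Finset.sum_image fun a _ b _ hab => hσ hab]
  have h2 : ∑ e ∈ T.edgeFinset, I e = ∑ f : T.edgeSet, I f := by
    rw [← Finset.sum_coe_sort]
    exact Fintype.sum_equiv (Equiv.subtypeEquivRight (by simp)) _ _ fun _ => rfl
  have h3 : ∀ f : T.edgeSet, I (σ f) ≤ I f + c := by
    rintro ⟨f, hf⟩
    obtain ⟨ha, hb, hd⟩ := hσR ⟨f, hf⟩
    generalize σ ⟨f, hf⟩ = e at ha hb hd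
    induction f with | _ x y
    induction e with | _ u v
    have := h x y u v ha (Adj.ne hf) (hd x y rfl) hb
    simp only
    linarith
  rw [h1, h2]
  calc ∑ f : T.edgeSet, I (σ f) ≤ ∑ f : T.edgeSet, (I f + c) := Finset.sum_le_sum fun f _ => h3 f
    _ = ∑ f : T.edgeSet, I f + Fintype.card T.edgeSet * c := by
      simp [Finset.sum_add_distrib]
    _ ≤ _ := by
      have : (Fintype.card T.edgeSet : ℝ) ≤ n := by
        rw [← edgeFinset_card]
        simp only [Fintype.card_fin] at hTc
        exact_mod_cast (by omega)
      gcongr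

/-! ### Rooted trees -/

namespace SimpleGraph

lemma Connected.exists_adj_dist_add_one {V : Type*} {T : SimpleGraph V} (hT : T.Connected)
    {r i : V} (h : i ≠ r) : ∃ p, T.Adj p i ∧ T.dist r i = T.dist r p + 1 := by
  obtain ⟨w, hw⟩ := hT.exists_walk_length_eq_dist i r
  cases w with
  | nil => exact absurd rfl h
  | @cons _ p _ hip w =>
    refine ⟨p, hip.symm, ?_⟩
    have h1 := dist_le w
    have h2 : T.dist i r ≤ T.dist i p + T.dist p r := hT.dist_triangle
    rw [dist_eq_one_iff_adj.2 hip] at h2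
    rw [Walk.length_cons] at hw
    rw [T.dist_comm (u := r) (v := i), T.dist_comm (u := r) (v := p)]
    omega

open Classical in
/-- The parent of the vertex `i` in the tree `T` rooted at `r`; the root is its own parent. -/
noncomputable def parent {V : Type*} (T : SimpleGraph V) (r i : V) : V :=
  if h : ∃ p, T.Adj p i ∧ T.dist r i = T.dist r p + 1 then h.choose else i

lemma Connected.parent_spec {V : Type*} {T : SimpleGraph V} (hT : T.Connected) {r i : V}
    (h : i ≠ r) : T.Adj (T.parent r i) i ∧ T.dist r i = T.dist r (T.parent r i) + 1 := by
  have h' := hT.exists_adj_dist_add_one h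
  rw [parent, dif_pos h']
  exact h'.choose_spec

lemma parent_root {V : Type*} (T : SimpleGraph V) (r : V) : T.parent r r = r := by
  rw [parent, dif_neg]
  rintro ⟨p, -, h⟩
  simp at h

end SimpleGraph

section nonDescendants

variable {T : SimpleGraph (Fin n)} {r : Fin n}

lemma notMem_nonDescendants {i j : Fin n} :
    j ∉ nonDescendants T r i ↔ T.dist r j = T.dist r i + T.dist i j := by
  simp [nonDescendants]

lemma not_mem_nonDescendants_root (j : Fin n) : j ∉ nonDescendants T r r := by
  simp [nonDescendants]

lemma mem_nonDescendants_of_dist_lt {i j : Fin n} (h : T.dist r j < T.dist r i) :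
    j ∈ nonDescendants T r i := by
  simp only [nonDescendants, Set.mem_ofPred_eq]
  omega

lemma ne_of_mem_nonDescendants {i j : Fin n} (h : j ∈ nonDescendants T r i) : j ≠ i := by
  rintro rfl
  simp [nonDescendants] at h

lemma mem_nonDescendants_of_subtree (hT : T.Connected) {i x z : Fin n}
    (hx : x ∈ nonDescendants T r i) (hz : z ∉ nonDescendants T r i) :
    x ∈ nonDescendants T r z := by
  by_contra h
  rw [notMem_nonDescendants] at h hz
  refine hx ?_
  have h1 : T.dist i x ≤ T.dist i z + T.dist z x := hT.dist_triangle
  have h2 : T.dist r x ≤ T.dist r i + T.dist i x := hT.dist_triangle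
  omega

lemma parent_mem_nonDescendants (hT : T.Connected) {i j : Fin n}
    (hj : j ∈ nonDescendants T r i) (hjr : j ≠ r) : T.parent r j ∈ nonDescendants T r i := by
  by_contra h
  obtain ⟨h1, h2⟩ := hT.parent_spec hjr
  rw [notMem_nonDescendants] at h
  refine hj ?_
  have h3 : T.dist i j ≤ T.dist i (T.parent r j) + T.dist (T.parent r j) j := hT.dist_triangle
  have h4 : T.dist r j ≤ T.dist r i + T.dist i j := hT.dist_triangle
  rw [dist_eq_one_iff_adj.2 h1] at h3
  omega

lemma exists_parent_in_subtree (hT : T.Connected) {i z : Fin n}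
    (hz : z ∉ nonDescendants T r i) (hzi : z ≠ i) :
    ∃ q, T.Adj q z ∧ T.dist r z = T.dist r q + 1 ∧ q ∉ nonDescendants T r i := by
  obtain ⟨q, hqz, hq⟩ := hT.exists_adj_dist_add_one hzi
  rw [notMem_nonDescendants] at hz
  have h1 : T.dist r q ≤ T.dist r i + T.dist i q := hT.dist_triangle
  have h2 : T.dist r z ≤ T.dist r q + T.dist q z := hT.dist_triangle
  rw [dist_eq_one_iff_adj.2 hqz] at h2
  refine ⟨q, hqz, by omega, notMem_nonDescendants.2 (by omega)⟩

/-- If the edge from `i` to its parent `p` separates `x` from `y`, then exactly one of `x` and `y`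
is a descendant of `i`. -/
lemma nonDescendants_of_not_reachable (hT : T.Connected) {p i x y : Fin n}
    (hpi : T.dist r i = T.dist r p + 1)
    (hxy : ¬(T.deleteEdges {s(p, i)}).Reachable x y) :
    (x ∈ nonDescendants T r i ∧ y ∉ nonDescendants T r i) ∨
      (y ∈ nonDescendants T r i ∧ x ∉ nonDescendants T r i) := by
  set H := T.deleteEdges {s(p, i)} with hH
  have hp : p ∈ nonDescendants T r i := mem_nonDescendants_of_dist_lt (by omega)
  have hi : i ∉ nonDescendants T r i := by simp [nonDescendants]
  -- all non-descendants remain joined to the root, all descendants remain joined to `i`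
  have h1 : ∀ k, ∀ z, T.dist r z = k → z ∈ nonDescendants T r i → H.Reachable z r := by
    intro k
    induction k with
    | zero =>
      intro z hz _
      rw [(hT.dist_eq_zero_iff).1 hz]
    | succ k ih =>
      intro z hz hzi
      have hzr : z ≠ r := by rintro rfl; simp at hz
      obtain ⟨h1, h2⟩ := hT.parent_spec hzr
      have h3 := parent_mem_nonDescendants hT hzi hzr
      have h4 : H.Adj z (T.parent r z) := by
        have h5 : s(z, T.parent r z) ≠ s(p, i) := by
          intro h
          rcases Sym2.eq_iff.1 h with ⟨-, h⟩ | ⟨h, -⟩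
          · exact hi (h ▸ h3)
          · exact hi (h ▸ hzi)
        simp [hH, h1.symm, h5]
      exact h4.reachable.trans (ih _ (by omega) h3)
  have h2 : ∀ k, ∀ z, T.dist r z = k → z ∉ nonDescendants T r i → H.Reachable z i := by
    intro k
    induction k with
    | zero =>
      intro z hz hzi
      rw [notMem_nonDescendants] at hzi
      omega
    | succ k ih =>
      intro z hz hzi
      by_cases hne : z = i
      · rw [hne]
      obtain ⟨q, hqz, hq, hqi⟩ := exists_parent_in_subtree hT hzi hne
      have h4 : H.Adj z q := by
        have h5 : s(z, q) ≠ s(p, i) := by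
          intro h
          rcases Sym2.eq_iff.1 h with ⟨h, -⟩ | ⟨-, h⟩
          · exact hzi (h ▸ hp)
          · exact hqi (h ▸ hp)
        simp [hH, hqz.symm, h5]
      exact h4.reachable.trans (ih _ (by omega) hqi)
  by_cases hx : x ∈ nonDescendants T r i <;> by_cases hy : y ∈ nonDescendants T r i
  · exact absurd ((h1 _ x rfl hx).trans (h1 _ y rfl hy).symm) hxy
  · exact Or.inl ⟨hx, hy⟩
  · exact Or.inr ⟨hy, hx⟩
  · exact absurd ((h2 _ x rfl hx).trans (h2 _ y rfl hy).symm) hxy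

lemma SimpleGraph.IsTree.parent_eq {T : SimpleGraph (Fin n)} (hT : T.IsTree) {r p i : Fin n}
    (hpi : T.Adj p i) (hd : T.dist r i = T.dist r p + 1) : T.parent r i = p := by
  have hir : i ≠ r := by rintro rfl; simp at hd
  obtain ⟨h1, h2⟩ := hT.connected.parent_spec hir
  by_contra hne
  have hb : ¬(T.deleteEdges {s(p, i)}).Reachable p i :=
    isBridge_iff.1 (isAcyclic_iff_forall_adj_isBridge.1 hT.isAcyclic hpi)
  -- both neighbours of `i` remain joined to the root
  have h3 : (T.deleteEdges {s(p, i)}).Reachable p (T.parent r i) := by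
    by_contra h
    have hp : p ∈ nonDescendants T r i := mem_nonDescendants_of_dist_lt (by omega)
    have hq : T.parent r i ∈ nonDescendants T r i := mem_nonDescendants_of_dist_lt (by omega)
    rcases nonDescendants_of_not_reachable hT.connected hd h with h | h
    · exact h.2 hq
    · exact h.2 hp
  have h4 : (T.deleteEdges {s(p, i)}).Adj (T.parent r i) i := by
    simp [h1, hne, h1.ne]
  exact hb (h3.trans h4.reachable)

end nonDescendants

/-! ### Covariance matrices of tree-structured distributions -/

open Matrix

/-- The local Markov property of a covariance matrix with respect to a rooted tree: the partial
covariances of a vertex and its non-descendants given the parent vanish. -/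
def LocalMarkov (T : SimpleGraph (Fin n)) (r : Fin n) (S : Matrix (Fin n) (Fin n) ℝ) : Prop :=
  ∀ p i, T.Adj p i → T.dist r i = T.dist r p + 1 → ∀ j ∈ nonDescendants T r i,
    S i j * S p p = S i p * S p j

/-- The partial covariance of the coordinates `a` and `c` given `b` vanishes. -/
def MarkovTriple (S : Matrix (Fin n) (Fin n) ℝ) (a b c : Fin n) : Prop :=
  S a c * S b b = S a b * S b c

lemma MarkovTriple.symm {S : Matrix (Fin n) (Fin n) ℝ} (hS : ∀ i j, S i j = S j i)
    {a b c : Fin n} (h : MarkovTriple S a b c) : MarkovTriple S c b a := by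
  unfold MarkovTriple at *
  rw [hS c a, h, hS a b, hS b c, mul_comm]

section LocalMarkov

variable {T : SimpleGraph (Fin n)} {r : Fin n} {S : Matrix (Fin n) (Fin n) ℝ}

/-- Both ends of an edge separate the two sides of the edge. -/
lemma LocalMarkov.markovTriple (h : LocalMarkov T r S) (hT : T.Connected)
    (hS : ∀ i j, S i j = S j i) (hpos : ∀ i, 0 < S i i) {p i x z j : Fin n} (hpi : T.Adj p i)
    (hd : T.dist r i = T.dist r p + 1) (hj : j = p ∨ j = i) (hx : x ∈ nonDescendants T r i)
    (hz : z ∉ nonDescendants T r i) : MarkovTriple S x j z := by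
  unfold MarkovTriple
  obtain ⟨k, hk⟩ : ∃ k, T.dist r z = k := ⟨_, rfl⟩
  induction k generalizing z with
  | zero =>
    rw [notMem_nonDescendants] at hz
    omega
  | succ k ih =>
    by_cases hzi : z = i
    · subst hzi
      rcases hj with rfl | rfl
      · rw [hS x z, h _ _ hpi hd x hx, hS z j, hS j x]
        ring
      · ring
    · obtain ⟨q, hqz, hq, hqi⟩ := exists_parent_in_subtree hT hz hzi
      have hxz := mem_nonDescendants_of_subtree hT hx hz
      have hjz : j ∈ nonDescendants T r z := by
        rcases hj with rfl | rfl
        · refine mem_nonDescendants_of_subtree hT (mem_nonDescendants_of_dist_lt (by omega)) hz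
        · rw [notMem_nonDescendants] at hz
          have := (hT.pos_dist_of_ne (Ne.symm hzi))
          exact mem_nonDescendants_of_dist_lt (by omega)
      have e1 := h q z hqz hq x hxz
      have e2 := h q z hqz hq j hjz
      have e3 := ih hqi (by omega)
      have hq0 := (hpos q).ne'
      apply mul_right_cancel₀ hq0
      rw [hS x z, hS j z]
      rw [hS x q, hS j q] at e3
      linear_combination (S j j) * e1 - (S x j) * e2 + (S z q) * e3

/-- If the edge `uv` of the tree lies between `x` and `y`, then `x - u - v - y` is a Markov chain
in one of the two possible directions. -/
lemma LocalMarkov.markovTriple_of_separates (h : LocalMarkov T r S) (hT : T.IsTree)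
    (hS : ∀ i j, S i j = S j i) (hpos : ∀ i, 0 < S i i) {u v x y : Fin n} (huv : T.Adj u v)
    (hxy : ¬(T.deleteEdges {s(u, v)}).Reachable x y) :
    (MarkovTriple S v u x ∧ MarkovTriple S x v y) ∨
      (MarkovTriple S v u y ∧ MarkovTriple S y v x) := by
  have key : ∀ {p i a b : Fin n}, T.Adj p i → T.dist r i = T.dist r p + 1 →
      a ∈ nonDescendants T r i → b ∉ nonDescendants T r i →
      MarkovTriple S a p i ∧ MarkovTriple S a i b ∧ MarkovTriple S a p b ∧
        MarkovTriple S p i b := by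
    intro p i a b hpi hd ha hb
    have hi : i ∉ nonDescendants T r i := by simp [nonDescendants]
    have hp : p ∈ nonDescendants T r i := mem_nonDescendants_of_dist_lt (by omega)
    exact ⟨h.markovTriple hT.connected hS hpos hpi hd (Or.inl rfl) ha hi,
      h.markovTriple hT.connected hS hpos hpi hd (Or.inr rfl) ha hb,
      h.markovTriple hT.connected hS hpos hpi hd (Or.inl rfl) ha hb,
      h.markovTriple hT.connected hS hpos hpi hd (Or.inr rfl) hp hb⟩
  rcases hT.dist_eq_dist_add_one_of_adj r huv with hd | hd
  · rw [Sym2.eq_swap] at hxy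
    rcases nonDescendants_of_not_reachable hT.connected hd hxy with ⟨ha, hb⟩ | ⟨ha, hb⟩ <;>
    obtain ⟨-, -, h3, h4⟩ := key huv.symm hd ha hb
    · exact Or.inr ⟨h4, h3.symm hS⟩
    · exact Or.inl ⟨h4, h3.symm hS⟩
  · rcases nonDescendants_of_not_reachable hT.connected hd hxy with ⟨ha, hb⟩ | ⟨ha, hb⟩ <;>
    obtain ⟨h1, h2, -, -⟩ := key huv hd ha hb
    · exact Or.inl ⟨h1.symm hS, h2⟩
    · exact Or.inr ⟨h1.symm hS, h2⟩

end LocalMarkov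

/-- The coefficient of the linear regression of the coordinate `i` on its parent; it is zero for
the root. -/
noncomputable def regressionCoeff (T : SimpleGraph (Fin n)) (r : Fin n)
    (S : Matrix (Fin n) (Fin n) ℝ) (i : Fin n) : ℝ :=
  if i = r then 0 else S i (T.parent r i) / S (T.parent r i) (T.parent r i)

/-- The variance of the residual of the regression of the coordinate `i` on its parent. -/
noncomputable def residualVar (T : SimpleGraph (Fin n)) (r : Fin n)
    (S : Matrix (Fin n) (Fin n) ℝ) (i : Fin n) : ℝ :=
  S i i - regressionCoeff T r S i * S i (T.parent r i)

/-- The matrix that maps a vector to the residuals of the regressions of its coordinates on their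
parents. -/
noncomputable def residualMatrix (T : SimpleGraph (Fin n)) (r : Fin n)
    (S : Matrix (Fin n) (Fin n) ℝ) : Matrix (Fin n) (Fin n) ℝ :=
  1 - Matrix.of fun i j => if j = T.parent r i then regressionCoeff T r S i else 0

section residual

variable (T : SimpleGraph (Fin n)) (r : Fin n) (S : Matrix (Fin n) (Fin n) ℝ)

lemma sum_residualMatrix_mul (i : Fin n) (f : Fin n → ℝ) :
    ∑ k, residualMatrix T r S i k * f k = f i - regressionCoeff T r S i * f (T.parent r i) := by
  simp [residualMatrix, Matrix.one_apply, sub_mul, Finset.sum_sub_distrib]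

lemma residualMatrix_mul_apply (A : Matrix (Fin n) (Fin n) ℝ) (i j : Fin n) :
    (residualMatrix T r S * A) i j =
      A i j - regressionCoeff T r S i * A (T.parent r i) j := by
  rw [Matrix.mul_apply, sum_residualMatrix_mul]

lemma mul_residualMatrix_transpose_apply (A : Matrix (Fin n) (Fin n) ℝ) (i j : Fin n) :
    (A * (residualMatrix T r S)ᵀ) i j =
      A i j - regressionCoeff T r S j * A i (T.parent r j) := by
  rw [Matrix.mul_apply, ← sum_residualMatrix_mul T r S j (fun k => A i k)]
  exact Finset.sum_congr rfl fun k _ => by rw [Matrix.transpose_apply, mul_comm]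

variable {T r S}

lemma det_residualMatrix (hT : T.Connected) : (residualMatrix T r S).det = 1 := by
  have hb : (residualMatrix T r S).BlockTriangular
      (fun i => OrderDual.toDual (T.dist r i)) := by
    intro i j hij
    have hij' : T.dist r i < T.dist r j := hij
    have h1 : i ≠ j := by rintro rfl; exact lt_irrefl _ hij'
    have h2 : ¬ j = T.parent r i := by
      rintro rfl
      by_cases hi : i = r
      · rw [hi, T.parent_root] at hij'
        exact lt_irrefl _ hij'
      · have := (hT.parent_spec hi).2
        omega
    simp [residualMatrix, h1, h2]
  rw [hb.det]
  refine Finset.prod_eq_one fun a _ => ?_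
  have : (residualMatrix T r S).toSquareBlock (fun i => OrderDual.toDual (T.dist r i)) a = 1 := by
    ext ⟨i, hi⟩ ⟨j, hj⟩
    have hd : T.dist r i = T.dist r j := OrderDual.toDual.injective (hi.trans hj.symm)
    have h2 : (if j = T.parent r i then regressionCoeff T r S i else 0) = 0 := by
      split_ifs with h
      · by_cases hir : i = r
        · simp [regressionCoeff, hir]
        · have := (hT.parent_spec hir).2
          rw [← h] at this
          omega
      · rfl
    simp [Matrix.toSquareBlock_def, residualMatrix, Matrix.one_apply, h2]
  rw [this, Matrix.det_one]

lemma residual_diag (hS : ∀ i j, S i j = S j i) (hpos : ∀ i, 0 < S i i)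
    (i : Fin n) :
    (residualMatrix T r S * S * (residualMatrix T r S)ᵀ) i i = residualVar T r S i := by
  rw [mul_residualMatrix_transpose_apply, residualMatrix_mul_apply, residualMatrix_mul_apply,
    residualVar]
  have hp := (hpos (T.parent r i)).ne'
  by_cases hi : i = r
  · simp [regressionCoeff, hi]
  · have hb : regressionCoeff T r S i * S (T.parent r i) (T.parent r i) = S i (T.parent r i) := by
      rw [regressionCoeff, if_neg hi, div_mul_cancel₀ _ hp]
    linear_combination (regressionCoeff T r S i) * hb -
      (regressionCoeff T r S i) * hS (T.parent r i) i

lemma LocalMarkov.residual_eq_diagonal (h : LocalMarkov T r S) (hT : T.Connected)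
    (hS : ∀ i j, S i j = S j i) (hpos : ∀ i, 0 < S i i) :
    residualMatrix T r S * S * (residualMatrix T r S)ᵀ = diagonal (residualVar T r S) := by
  set M := residualMatrix T r S
  have hsymm : ∀ i j, (M * S * Mᵀ) i j = (M * S * Mᵀ) j i := by
    intro i j
    have : (M * S * Mᵀ)ᵀ = M * S * Mᵀ := by
      have hSt : Sᵀ = S := by ext i j; exact hS j i
      rw [Matrix.transpose_mul, Matrix.transpose_mul, Matrix.transpose_transpose, hSt,
        Matrix.mul_assoc]
    rw [← this, Matrix.transpose_apply, this]
  -- the residual of `i` is uncorrelated with the non-descendants of `i`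
  have h1 : ∀ i, ∀ j ∈ nonDescendants T r i, (M * S) i j = 0 := by
    intro i j hj
    have hir : i ≠ r := by rintro rfl; exact not_mem_nonDescendants_root j hj
    obtain ⟨ha, hd⟩ := hT.parent_spec hir
    have h2 := h _ _ ha hd j hj
    have hp := (hpos (T.parent r i)).ne'
    rw [residualMatrix_mul_apply, regressionCoeff, if_neg hir]
    field_simp
    linarith
  have h2 : ∀ i, ∀ j ∈ nonDescendants T r i, (M * S * Mᵀ) i j = 0 := by
    intro i j hj
    rw [mul_residualMatrix_transpose_apply, h1 i j hj]
    by_cases hjr : j = r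
    · simp [regressionCoeff, hjr]
    · rw [h1 i _ (parent_mem_nonDescendants hT hj hjr)]
      simp
  ext i j
  by_cases hij : i = j
  · rw [hij, Matrix.diagonal_apply_eq, residual_diag hS hpos]
  rw [Matrix.diagonal_apply_ne _ hij]
  by_cases hj : j ∈ nonDescendants T r i
  · exact h2 i j hj
  · have hi : i ∈ nonDescendants T r j := by
      rw [notMem_nonDescendants] at hj
      have := hT.pos_dist_of_ne hij
      exact mem_nonDescendants_of_dist_lt (by omega)
    rw [hsymm]
    exact h2 j i hi

/-- The inverse of the residual matrix has a nonzero entry at `(j, i)` only if `j` descends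
from `i`. -/
lemma residualMatrix_inv_apply (hT : T.Connected) {i j : Fin n} (hj : j ∈ nonDescendants T r i) :
    (residualMatrix T r S)⁻¹ j i = 0 := by
  have hdet : IsUnit (residualMatrix T r S).det := by rw [det_residualMatrix hT]; exact isUnit_one
  have hmul := Matrix.mul_nonsing_inv _ hdet
  obtain ⟨k, hk⟩ : ∃ k, T.dist r j = k := ⟨_, rfl⟩
  have hstep : (residualMatrix T r S)⁻¹ j i =
      regressionCoeff T r S j * (residualMatrix T r S)⁻¹ (T.parent r j) i := by
    have := congrFun (congrFun hmul j) i
    rw [residualMatrix_mul_apply, Matrix.one_apply_ne (ne_of_mem_nonDescendants hj)] at this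
    linarith
  induction k generalizing j with
  | zero =>
    have hjr : j = r := ((hT.dist_eq_zero_iff).1 hk).symm
    rw [hstep, regressionCoeff, if_pos hjr, zero_mul]
  | succ k ih =>
    by_cases hjr : j = r
    · rw [hstep, regressionCoeff, if_pos hjr, zero_mul]
    have hp := parent_mem_nonDescendants hT hj hjr
    have hd := (hT.parent_spec hjr).2
    rw [hstep, ih hp (by omega), mul_zero]
    have := congrFun (congrFun hmul (T.parent r j)) i
    rw [residualMatrix_mul_apply, Matrix.one_apply_ne (ne_of_mem_nonDescendants hp)] at this
    linarith

end residual

/-! ### Tree weights and residual variances -/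

/-- In a rooted tree the edges correspond to the vertices other than the root. -/
lemma graphWeight_eq_sum_parent (ω : Sym2 (Fin n) → ℝ) {T : SimpleGraph (Fin n)} (hT : T.IsTree)
    (r : Fin n) : graphWeight (fun i j => ω s(i, j)) T =
      ∑ i ∈ Finset.univ.erase r, ω s(T.parent r i, i) := by
  classical
  rw [graphWeight_eq_sum]
  have hinj : Set.InjOn (fun i => s(T.parent r i, i)) (Finset.univ.erase r : Finset (Fin n)) := by
    intro i hi j hj hij
    have hi' : i ≠ r := by simpa using hi
    have hj' : j ≠ r := by simpa using hj
    rcases Sym2.eq_iff.1 hij with ⟨-, h⟩ | ⟨h1, h2⟩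
    · exact h
    · have h3 := (hT.connected.parent_spec hi').2
      have h4 := (hT.connected.parent_spec hj').2
      rw [h1] at h3
      rw [← h2] at h4
      omega
  have himg : (Finset.univ.erase r).image (fun i => s(T.parent r i, i)) = T.edgeFinset := by
    refine Finset.eq_of_subset_of_card_le ?_ ?_
    · intro e he
      obtain ⟨i, hi, rfl⟩ := Finset.mem_image.1 he
      have hi' : i ≠ r := by simpa using hi
      simpa using (hT.connected.parent_spec hi').1
    · have := hT.card_edgeFinset
      rw [Finset.card_image_of_injOn hinj, Finset.card_erase_of_mem (Finset.mem_univ _),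
        Finset.card_univ]
      omega
  rw [← himg, Finset.sum_image hinj]

/-- The mutual information of two coordinates of a Gaussian vector with covariance matrix `S`. -/
noncomputable def gaussianMutualInfo (S : Matrix (Fin n) (Fin n) ℝ) (i j : Fin n) : ℝ :=
  -(1 / 2) * Real.log (1 - S i j ^ 2 / (S i i * S j j))

lemma gaussianMutualInfo_comm {S : Matrix (Fin n) (Fin n) ℝ} (hS : ∀ i j, S i j = S j i)
    (i j : Fin n) : gaussianMutualInfo S i j = gaussianMutualInfo S j i := by
  rw [gaussianMutualInfo, gaussianMutualInfo, hS i j, mul_comm (S i i)]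

section

variable {T : SimpleGraph (Fin n)} {r : Fin n} {S : Matrix (Fin n) (Fin n) ℝ}

lemma residualVar_eq {i : Fin n} (hi : i ≠ r) (hpos : ∀ i, 0 < S i i) :
    residualVar T r S i = S i i *
      (1 - S i (T.parent r i) ^ 2 / (S i i * S (T.parent r i) (T.parent r i))) := by
  have h1 := (hpos (T.parent r i)).ne'
  have h2 := (hpos i).ne'
  rw [residualVar, regressionCoeff, if_neg hi]
  field_simp

lemma one_sub_sq_pos (hpos : ∀ i, 0 < S i i) {i j : Fin n} (h : S i j ^ 2 < S i i * S j j) :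
    0 < 1 - S i j ^ 2 / (S i i * S j j) := by
  have := mul_pos (hpos i) (hpos j)
  rw [sub_pos, div_lt_one this]
  exact h

lemma residualVar_pos (hT : T.Connected) (hpos : ∀ i, 0 < S i i)
    (hlt : ∀ i j, i ≠ j → S i j ^ 2 < S i i * S j j) (i : Fin n) : 0 < residualVar T r S i := by
  by_cases hi : i = r
  · rw [residualVar, regressionCoeff, if_pos hi, zero_mul, sub_zero]
    exact hpos i
  · rw [residualVar_eq hi hpos]
    exact mul_pos (hpos i) (one_sub_sq_pos hpos (hlt _ _ (hT.parent_spec hi).1.ne'))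

/-- The logarithm of the determinant of the covariance matrix of a tree-structured Gaussian
distribution is determined by the variances and the total mutual information of the tree. -/
lemma sum_log_residualVar (hT : T.IsTree) (r : Fin n) (hS : ∀ i j, S i j = S j i)
    (hpos : ∀ i, 0 < S i i) (hlt : ∀ i j, i ≠ j → S i j ^ 2 < S i i * S j j) :
    ∑ i, Real.log (residualVar T r S i) =
      ∑ i, Real.log (S i i) - 2 * graphWeight (gaussianMutualInfo S) T := by
  have hw : graphWeight (gaussianMutualInfo S) T =
      ∑ i ∈ Finset.univ.erase r, gaussianMutualInfo S (T.parent r i) i :=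
    graphWeight_eq_sum_parent (Sym2.lift ⟨gaussianMutualInfo S, gaussianMutualInfo_comm hS⟩) hT r
  rw [← Finset.sum_erase_add _ _ (Finset.mem_univ r),
    ← Finset.sum_erase_add _ (fun i => Real.log (S i i)) (Finset.mem_univ r)]
  rw [hw, Finset.mul_sum]
  have h0 : residualVar T r S r = S r r := by
    rw [residualVar, regressionCoeff, if_pos rfl, zero_mul, sub_zero]
  rw [h0, add_sub_right_comm, ← Finset.sum_sub_distrib]
  congr 1
  refine Finset.sum_congr rfl fun i hi => ?_
  have hi' : i ≠ r := by simpa using hi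
  have hne := (hT.connected.parent_spec hi').1.ne'
  rw [residualVar_eq hi' hpos, Real.log_mul (hpos i).ne' (one_sub_sq_pos hpos (hlt _ _ hne)).ne',
    gaussianMutualInfo_comm hS, gaussianMutualInfo]
  ring

end

/-! ### Comparison of empirical and true information gaps -/

/-- The empirical variance of the unit vector `a z₁ + b z₂`, given those of the basis vectors. -/
lemma abs_quadratic_sub_one_le {τ a b g h k : ℝ} (hab : a ^ 2 + b ^ 2 = 1) (hg : |g - 1| ≤ τ)
    (hh : |h| ≤ τ) (hk : |k - 1| ≤ τ) :
    |a ^ 2 * g + 2 * a * b * h + b ^ 2 * k - 1| ≤ 2 * τ := by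
  have h1 : |2 * a * b| ≤ 1 := by
    refine abs_le.2 ⟨?_, ?_⟩
    · linarith [sq_nonneg (a + b)]
    · linarith [sq_nonneg (a - b)]
  have h2 : |2 * a * b * h| ≤ 1 * τ := by
    rw [abs_mul]; exact mul_le_mul h1 hh (abs_nonneg _) zero_le_one
  obtain ⟨h3, h4⟩ := abs_le.1 h2
  obtain ⟨g1, g2⟩ := abs_le.1 hg
  obtain ⟨k1, k2⟩ := abs_le.1 hk
  have e1 := mul_le_mul_of_nonneg_left g1 (sq_nonneg a)
  have e2 := mul_le_mul_of_nonneg_left g2 (sq_nonneg a)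
  have e3 := mul_le_mul_of_nonneg_left k1 (sq_nonneg b)
  have e4 := mul_le_mul_of_nonneg_left k2 (sq_nonneg b)
  have e5 : a ^ 2 * τ + b ^ 2 * τ = τ := by rw [← add_mul, hab, one_mul]
  refine abs_le.2 ⟨?_, ?_⟩ <;> nlinarith only [h3, h4, e1, e2, e3, e4, e5, hab]

/-- An off-diagonal cofactor of a symmetric `3 × 3` matrix that is `τ`-close to the identity. -/
lemma abs_minor_le {τ x y u v : ℝ} (hτ : τ ≤ 1 / 20) (hx : |x - 1| ≤ τ) (hy : |y| ≤ τ)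
    (hu : |u| ≤ τ) (hv : |v| ≤ τ) : |x * y - u * v| ≤ 6 / 5 * τ := by
  have hτ0 : 0 ≤ τ := (abs_nonneg _).trans hy
  have h1 : |(x - 1) * y| ≤ τ * τ := by
    rw [abs_mul]; exact mul_le_mul hx hy (abs_nonneg _) hτ0
  have h2 : |u * v| ≤ τ * τ := by
    rw [abs_mul]; exact mul_le_mul hu hv (abs_nonneg _) hτ0
  obtain ⟨h3, h4⟩ := abs_le.1 h1
  obtain ⟨h5, h6⟩ := abs_le.1 h2
  obtain ⟨h7, h8⟩ := abs_le.1 hy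
  have h9 : τ * τ ≤ 1 / 20 * τ := mul_le_mul_of_nonneg_right hτ hτ0
  refine abs_le.2 ⟨?_, ?_⟩ <;> linarith

/-- A principal minor of order two of a matrix that is `τ`-close to the identity. -/
lemma minor_bounds {τ x y z : ℝ} (hτ : τ ≤ 1 / 20) (hx : |x - 1| ≤ τ) (hy : |y - 1| ≤ τ)
    (hz : |z| ≤ τ) : 4 / 5 ≤ x * y - z ^ 2 ∧ x * y - z ^ 2 ≤ 6 / 5 := by
  obtain ⟨x1, x2⟩ := abs_le.1 hx
  obtain ⟨y1, y2⟩ := abs_le.1 hy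
  have hz2 : z ^ 2 ≤ 1 / 400 := by
    rw [← sq_abs]
    calc |z| ^ 2 ≤ (1 / 20) ^ 2 := pow_le_pow_left₀ (abs_nonneg _) (hz.trans hτ) 2
      _ = 1 / 400 := by norm_num
  have e1 : 19 / 20 * (19 / 20) ≤ x * y :=
    mul_le_mul (by linarith) (by linarith) (by norm_num) (by linarith)
  have e2 : x * y ≤ 21 / 20 * (21 / 20) :=
    mul_le_mul (by linarith) (by linarith) (by linarith) (by norm_num)
  constructor
  · linarith
  · linarith [sq_nonneg z]

/-- The determinant of a symmetric `3 × 3` matrix that is `τ`-close to the identity. -/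
lemma gramDet_bounds {τ g11 g22 g33 g12 g13 g23 : ℝ} (hτ : τ ≤ 1 / 20)
    (h11 : |g11 - 1| ≤ τ) (h22 : |g22 - 1| ≤ τ) (h33 : |g33 - 1| ≤ τ)
    (h12 : |g12| ≤ τ) (h13 : |g13| ≤ τ) (h23 : |g23| ≤ τ) {Δ : ℝ}
    (hΔ : Δ = g11 * g22 * g33 + 2 * g12 * g13 * g23 - g11 * g23 ^ 2 - g22 * g13 ^ 2
      - g33 * g12 ^ 2) : 7 / 10 ≤ Δ ∧ Δ ≤ 13 / 10 := by
  have hτ0 : 0 ≤ τ := (abs_nonneg _).trans h12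
  obtain ⟨P1, P2⟩ := minor_bounds hτ h11 h33 h13
  obtain ⟨l22, u22⟩ := abs_le.1 h22
  have hQ := abs_minor_le hτ h33 h12 h23 h13
  have hR := abs_minor_le hτ h11 h23 h12 h13
  have e1 : |g12 * (g33 * g12 - g23 * g13)| ≤ 1 / 20 * (6 / 5 * (1 / 20)) := by
    rw [abs_mul]
    exact mul_le_mul (h12.trans hτ) (hQ.trans (by linarith)) (abs_nonneg _) (by norm_num)
  have e2 : |g23 * (g11 * g23 - g12 * g13)| ≤ 1 / 20 * (6 / 5 * (1 / 20)) := by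
    rw [abs_mul]
    exact mul_le_mul (h23.trans hτ) (hR.trans (by linarith)) (abs_nonneg _) (by norm_num)
  obtain ⟨e3, e4⟩ := abs_le.1 e1
  obtain ⟨e5, e6⟩ := abs_le.1 e2
  have hΔ' : Δ = g22 * (g11 * g33 - g13 ^ 2) - g12 * (g33 * g12 - g23 * g13)
      - g23 * (g11 * g23 - g12 * g13) := by
    rw [hΔ]; ring
  have e7 : 19 / 20 * (4 / 5) ≤ g22 * (g11 * g33 - g13 ^ 2) :=
    mul_le_mul (by linarith) P1 (by norm_num) (by linarith)
  have e8 : g22 * (g11 * g33 - g13 ^ 2) ≤ 21 / 20 * (6 / 5) :=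
    mul_le_mul (by linarith) P2 (by linarith) (by norm_num)
  rw [hΔ']
  constructor <;> linarith

/-- The difference of two empirical mutual informations as a difference of conditional ones, in
the Gram matrix of `B = z₁`, `A = a z₁ + a' z₂`, `C = c z₁ + c' z₃`. The two fractions on the
right are the odds `ρ² / (1 - ρ²)` of the partial correlations of `A`, `B` given `C` and of
`A`, `C` given `B`. The identity rests on Sylvester's determinant identity. -/
lemma log_sub_log_gram {a a' c c' g11 g22 g33 g12 g13 g23 : ℝ} (ha' : 0 < a') (hc' : 0 < c')
    {GAA GCC GAB GBC GAC : ℝ}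
    (eAA : GAA = a ^ 2 * g11 + 2 * a * a' * g12 + a' ^ 2 * g22)
    (eCC : GCC = c ^ 2 * g11 + 2 * c * c' * g13 + c' ^ 2 * g33)
    (eAB : GAB = a * g11 + a' * g12) (eBC : GBC = c * g11 + c' * g13)
    (eAC : GAC = a * c * g11 + a * c' * g13 + a' * c * g12 + a' * c' * g23)
    (hg : 0 < g11) (hA : 0 < GAA) (hC : 0 < GCC) (hP : 0 < g11 * g33 - g13 ^ 2)
    (h12 : 0 < g11 * g22 - g12 ^ 2) {Δ : ℝ}
    (hΔ : Δ = g11 * g22 * g33 + 2 * g12 * g13 * g23 - g11 * g23 ^ 2 - g22 * g13 ^ 2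
      - g33 * g12 ^ 2) (hΔ0 : 0 < Δ) :
    Real.log (1 - GAC ^ 2 / (GAA * GCC)) - Real.log (1 - GAB ^ 2 / (GAA * g11)) =
      Real.log (1 + (a * c' / a' * (g11 * g33 - g13 ^ 2) +
        (c * (g12 * g13 - g23 * g11) + c' * (g12 * g33 - g23 * g13))) ^ 2 / (Δ * GCC)) -
      Real.log (1 + (g11 * g23 - g12 * g13) ^ 2 / (Δ * g11)) := by
  set P := g11 * g33 - g13 ^ 2 with hP'
  set e := c * (g12 * g13 - g23 * g11) + c' * (g12 * g33 - g23 * g13) with he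
  set t := (a * c' / a' * P + e) ^ 2 / (Δ * GCC) with ht
  set s := (g11 * g23 - g12 * g13) ^ 2 / (Δ * g11) with hs
  have ht0 : 0 ≤ t := by positivity
  have hs0 : 0 ≤ s := by positivity
  have hDAB : 1 - GAB ^ 2 / (GAA * g11) = a' ^ 2 * (g11 * g22 - g12 ^ 2) / (GAA * g11) := by
    rw [eq_div_iff (by positivity), sub_mul, div_mul_cancel₀ _ (by positivity), eAB, eAA]
    ring
  have hS : (GAA * GCC - GAC ^ 2) * (c' ^ 2 * P) =
      GCC * (a' ^ 2 * c' ^ 2 * Δ) + (c' * (a * c' * P + a' * e)) ^ 2 := by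
    have e1 : c' ^ 2 * P = g11 * GCC - GBC ^ 2 := by rw [eCC, eBC, hP']; ring
    have e2 : c' * (a * c' * P + a' * e) = GAB * GCC - GAC * GBC := by
      rw [eAB, eCC, eAC, eBC, he, hP']; ring
    have e3 : a' ^ 2 * c' ^ 2 * Δ = GAA * g11 * GCC + 2 * GAB * GBC * GAC - GAA * GBC ^ 2
        - g11 * GAC ^ 2 - GCC * GAB ^ 2 := by
      rw [eAA, eAB, eCC, eAC, eBC, hΔ]; ring
    rw [e1, e2, e3]
    ring
  have hS' : (GAA * GCC - GAC ^ 2) * P = GCC * (a' ^ 2 * Δ) + (a * c' * P + a' * e) ^ 2 := by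
    apply mul_left_cancel₀ (pow_ne_zero 2 hc'.ne')
    linear_combination hS
  have ht' : a' ^ 2 * Δ * GCC * t = (a * c' * P + a' * e) ^ 2 := by
    rw [ht]
    field_simp
  have hDAC : 1 - GAC ^ 2 / (GAA * GCC) = a' ^ 2 * Δ * (1 + t) / (GAA * P) := by
    rw [one_sub_div (by positivity), div_eq_div_iff (by positivity) (by positivity)]
    linear_combination GAA * hS' - GAA * ht'
  have hs1 : (1 + s) * (Δ * g11) = P * (g11 * g22 - g12 ^ 2) := by
    rw [hs, add_mul, div_mul_cancel₀ _ (by positivity), hΔ, hP']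
    ring
  have h1s : 0 < 1 + s := by linarith
  have h1t : 0 < 1 + t := by linarith
  rw [hDAB, hDAC, ← Real.log_div (by positivity) (by positivity), ← Real.log_div h1t.ne' h1s.ne']
  congr 1
  generalize g11 * g22 - g12 ^ 2 = D at *
  clear_value P t s
  rw [div_div_div_eq, div_eq_div_iff (by positivity) h1s.ne']
  linear_combination a' ^ 2 * GAA * (1 + t) * hs1

/-- The true odds `q²` of a partial correlation, compared with the empirical odds `t` and the
spurious odds `s`. Bernoulli's inequality `1 + q² ≤ (1 + q² / 8) ^ 8` turns the loss of a constant
factor in the odds into the factor `8` in front of the logarithms. -/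
lemma log_odds_le {q t s τ : ℝ} (ht : 0 ≤ t) (hs : 0 ≤ s) (hqt : q ^ 2 / 8 ≤ t + 10 * τ ^ 2)
    (hsτ : s ≤ 4 * τ ^ 2) :
    Real.log (1 + q ^ 2) ≤ 8 * (Real.log (1 + t) - Real.log (1 + s)) + 112 * τ ^ 2 := by
  have hbern : Real.log (1 + q ^ 2) ≤ 8 * Real.log (1 + q ^ 2 / 8) := by
    rw [show 8 * Real.log (1 + q ^ 2 / 8) = Real.log ((1 + q ^ 2 / 8) ^ 8) by
      rw [Real.log_pow]; norm_num]
    refine Real.log_le_log (by positivity) ?_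
    have := one_add_mul_le_pow (show -2 ≤ q ^ 2 / 8 by linarith [sq_nonneg q]) 8
    norm_num at this
    linarith
  have hlog1 : Real.log (1 + q ^ 2 / 8) ≤ Real.log (1 + t) + 10 * τ ^ 2 := by
    have h1 : 1 + q ^ 2 / 8 ≤ (1 + t) * (1 + 10 * τ ^ 2) := by
      linarith [mul_nonneg ht (sq_nonneg τ)]
    have h2 : 0 < 1 + 10 * τ ^ 2 := by positivity
    calc Real.log (1 + q ^ 2 / 8) ≤ Real.log ((1 + t) * (1 + 10 * τ ^ 2)) :=
          Real.log_le_log (by positivity) h1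
      _ = Real.log (1 + t) + Real.log (1 + 10 * τ ^ 2) :=
          Real.log_mul (by positivity) h2.ne'
      _ ≤ _ := by linarith [Real.log_le_sub_one_of_pos h2]
  have hlog2 : Real.log (1 + s) ≤ 4 * τ ^ 2 := by
    linarith [Real.log_le_sub_one_of_pos (show 0 < 1 + s by linarith)]
  linarith

/-- If the Gram matrix `g` of `z₁, z₂, z₃` is `τ`-close to the identity matrix, then for the
Markov chain `A = a z₁ + a' z₂`, `B = z₁`, `C = c z₁ + c' z₃` the empirical gap between the mutual
informations of `A, B` and of `A, C` is at least a constant fraction of the true gap, up to an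
error of order `τ²`. -/
lemma log_gap_le {τ a a' c c' g11 g22 g33 g12 g13 g23 : ℝ} (hτ : τ ≤ 1 / 20)
    (ha : a ^ 2 + a' ^ 2 = 1) (hc : c ^ 2 + c' ^ 2 = 1) (ha' : 0 < a') (hc' : 0 < c')
    (h11 : |g11 - 1| ≤ τ) (h22 : |g22 - 1| ≤ τ) (h33 : |g33 - 1| ≤ τ)
    (h12 : |g12| ≤ τ) (h13 : |g13| ≤ τ) (h23 : |g23| ≤ τ) {GAA GCC GAB GAC : ℝ}
    (eAA : GAA = a ^ 2 * g11 + 2 * a * a' * g12 + a' ^ 2 * g22)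
    (eCC : GCC = c ^ 2 * g11 + 2 * c * c' * g13 + c' ^ 2 * g33)
    (eAB : GAB = a * g11 + a' * g12)
    (eAC : GAC = a * c * g11 + a * c' * g13 + a' * c * g12 + a' * c' * g23) :
    Real.log (1 - (a * c) ^ 2) - Real.log (1 - a ^ 2) ≤
      8 * (Real.log (1 - GAC ^ 2 / (GAA * GCC)) - Real.log (1 - GAB ^ 2 / (GAA * g11))) +
        112 * τ ^ 2 := by
  have hτ0 : 0 ≤ τ := (abs_nonneg _).trans h12
  obtain ⟨l11, u11⟩ := abs_le.1 h11
  obtain ⟨hPl, hPu⟩ := minor_bounds hτ h11 h33 h13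
  obtain ⟨h12l, -⟩ := minor_bounds hτ h11 h22 h12
  obtain ⟨hΔl, hΔu⟩ := gramDet_bounds hτ h11 h22 h33 h12 h13 h23 rfl
  obtain ⟨lA, uA⟩ := abs_le.1 (eAA ▸ abs_quadratic_sub_one_le ha h11 h12 h22)
  obtain ⟨lC, uC⟩ := abs_le.1 (eCC ▸ abs_quadratic_sub_one_le hc h11 h13 h33)
  rw [log_sub_log_gram ha' hc' eAA eCC eAB rfl eAC (by linarith) (by linarith) (by linarith)
    (by linarith) (by linarith) rfl (by linarith)]
  have hca : |c| ≤ 1 := by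
    rw [← sq_le_one_iff_abs_le_one]; linarith [sq_nonneg c']
  have hca' : |c'| ≤ 1 := by
    rw [← sq_le_one_iff_abs_le_one]; linarith [sq_nonneg c]
  have hQ : |g12 * g13 - g23 * g11| ≤ 6 / 5 * τ := by
    rw [← abs_neg, neg_sub, mul_comm g23]; exact abs_minor_le hτ h11 h23 h12 h13
  have hR : |g12 * g33 - g23 * g13| ≤ 6 / 5 * τ := by
    rw [mul_comm g12]; exact abs_minor_le hτ h33 h12 h23 h13
  have hs := abs_minor_le hτ h11 h23 h12 h13
  have he : |c * (g12 * g13 - g23 * g11) + c' * (g12 * g33 - g23 * g13)| ≤ 12 / 5 * τ := by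
    refine (abs_add_le _ _).trans ?_
    rw [abs_mul, abs_mul]
    have e1 := mul_le_mul hca hQ (abs_nonneg _) zero_le_one
    have e2 := mul_le_mul hca' hR (abs_nonneg _) zero_le_one
    linarith
  set e := c * (g12 * g13 - g23 * g11) + c' * (g12 * g33 - g23 * g13)
  set P := g11 * g33 - g13 ^ 2
  set Δ := g11 * g22 * g33 + 2 * g12 * g13 * g23 - g11 * g23 ^ 2 - g22 * g13 ^ 2 - g33 * g12 ^ 2
  set h := g11 * g23 - g12 * g13
  set q := a * c' / a' with hq
  have htrue : Real.log (1 - (a * c) ^ 2) - Real.log (1 - a ^ 2) = Real.log (1 + q ^ 2) := by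
    have h1 : 1 - a ^ 2 = a' ^ 2 := by linarith
    have h2 : 1 - (a * c) ^ 2 = a' ^ 2 * (1 + q ^ 2) := by
      rw [hq]
      field_simp
      linear_combination -ha - a ^ 2 * hc
    rw [h1, h2, Real.log_mul (by positivity) (by positivity)]
    ring
  rw [htrue]
  clear_value e P Δ h q
  have hDu : Δ * GCC ≤ 13 / 10 * (11 / 10) :=
    mul_le_mul hΔu (by linarith) (by linarith) (by norm_num)
  have hDl : 7 / 10 * (9 / 10) ≤ Δ * GCC :=
    mul_le_mul hΔl (by linarith) (by norm_num) (by linarith)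
  have hgl : 7 / 10 * (9 / 10) ≤ Δ * g11 :=
    mul_le_mul hΔl (by linarith) (by norm_num) (by linarith)
  refine log_odds_le (div_nonneg (sq_nonneg _) (by linarith))
    (div_nonneg (sq_nonneg _) (by linarith)) ?_ ?_
  · have he2 : e ^ 2 ≤ (12 / 5 * τ) ^ 2 := by
      rw [← sq_abs]; exact pow_le_pow_left₀ (abs_nonneg _) he 2
    have h1 : q ^ 2 * P ^ 2 / 2 - e ^ 2 ≤ (q * P + e) ^ 2 := by
      linarith [sq_nonneg (q * P + 2 * e)]
    have h2 : q ^ 2 * (4 / 5) ^ 2 ≤ q ^ 2 * P ^ 2 :=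
      mul_le_mul_of_nonneg_left (pow_le_pow_left₀ (by norm_num) hPl 2) (sq_nonneg q)
    have h3 : (q ^ 2 / 8 - 10 * τ ^ 2) * (Δ * GCC) ≤ (q * P + e) ^ 2 := by
      have h4 := mul_le_mul_of_nonneg_left hDu (show 0 ≤ q ^ 2 / 8 by positivity)
      have h5 := mul_le_mul_of_nonneg_left hDl (show 0 ≤ 10 * τ ^ 2 by positivity)
      linarith [sq_nonneg q, sq_nonneg τ]
    have := (le_div_iff₀ (by linarith)).2 h3
    linarith
  · rw [div_le_iff₀ (by linarith)]
    have h1 : h ^ 2 ≤ (6 / 5 * τ) ^ 2 := by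
      rw [← sq_abs]; exact pow_le_pow_left₀ (abs_nonneg _) hs 2
    have h2 := mul_le_mul_of_nonneg_left hgl (show 0 ≤ 4 * τ ^ 2 by positivity)
    linarith [sq_nonneg τ]

/-! ### Test functionals for Markov triples -/

/-- The coordinate functional `i`, scaled to variance one. -/
noncomputable def unitCoord (S : Matrix (Fin n) (Fin n) ℝ) (i : Fin n) : Fin n → ℝ :=
  Pi.single i (√(S i i))⁻¹

/-- The correlation coefficient of two coordinates. -/
noncomputable def correlation (S : Matrix (Fin n) (Fin n) ℝ) (i j : Fin n) : ℝ :=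
  S i j / (√(S i i) * √(S j j))

/-- The functionals `z₀, z₁, z₂` obtained by orthonormalising the coordinates `b`, `a`, `c` of a
Markov chain `a - b - c`, starting from `b`. -/
noncomputable def chainBasis (S : Matrix (Fin n) (Fin n) ℝ) (a b c : Fin n) :
    Fin 3 → Fin n → ℝ :=
  ![unitCoord S b,
    (√(1 - correlation S a b ^ 2))⁻¹ • (unitCoord S a - correlation S a b • unitCoord S b),
    (√(1 - correlation S c b ^ 2))⁻¹ • (unitCoord S c - correlation S c b • unitCoord S b)]

/-- The functionals `z p` and `(z p ± z q) / √2` of variance one, whose empirical variances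
determine the empirical Gram matrix of `z`. -/
noncomputable def probe (z : Fin 3 → Fin n → ℝ) (p q : Fin 3) : Fin n → ℝ :=
  if p = q then z p else if p < q then (√2)⁻¹ • (z p + z q) else (√2)⁻¹ • (z p - z q)

/-- The empirical second moment of two functionals, normalised for differences of pairs of
points, whose variance is doubled. -/
noncomputable def empiricalForm {k : ℕ} (w : Fin k → EuclideanSpace ℝ (Fin n))
    (x y : Fin n → ℝ) : ℝ :=
  (∑ t, (x ⬝ᵥ (w t).ofLp) * (y ⬝ᵥ (w t).ofLp)) / (2 * k)

section empiricalForm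

variable {k : ℕ} (w : Fin k → EuclideanSpace ℝ (Fin n)) (x y z : Fin n → ℝ)

lemma empiricalForm_comm : empiricalForm w x y = empiricalForm w y x := by
  simp only [empiricalForm, mul_comm]

lemma empiricalForm_add_left : empiricalForm w (x + y) z =
    empiricalForm w x z + empiricalForm w y z := by
  simp only [empiricalForm, add_dotProduct, add_mul, Finset.sum_add_distrib, add_div]

lemma empiricalForm_smul_left (r : ℝ) : empiricalForm w (r • x) z = r * empiricalForm w x z := by
  simp only [empiricalForm, smul_dotProduct, smul_eq_mul, mul_assoc, ← Finset.mul_sum,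
    mul_div_assoc]

lemma empiricalForm_add_right : empiricalForm w z (x + y) =
    empiricalForm w z x + empiricalForm w z y := by
  rw [empiricalForm_comm, empiricalForm_add_left, empiricalForm_comm w x, empiricalForm_comm w y]

lemma empiricalForm_smul_right (r : ℝ) : empiricalForm w z (r • x) = r * empiricalForm w z x := by
  rw [empiricalForm_comm, empiricalForm_smul_left, empiricalForm_comm]

lemma inv_sqrt_two_sq : (√2)⁻¹ * (√2)⁻¹ = (1 / 2 : ℝ) := by
  rw [← mul_inv, Real.mul_self_sqrt (by norm_num)]
  norm_num

/-- Polarisation. -/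
lemma abs_empiricalForm_le {z : Fin 3 → Fin n → ℝ} {τ : ℝ}
    (h : ∀ p q, |empiricalForm w (probe z p q) (probe z p q) - 1| ≤ τ) {p q : Fin 3}
    (hpq : p < q) : |empiricalForm w (z p) (z q)| ≤ τ := by
  have h1 := h p q
  have h2 := h q p
  rw [probe, if_neg hpq.ne, if_pos hpq] at h1
  rw [probe, if_neg hpq.ne', if_neg hpq.not_gt] at h2
  have e1 : empiricalForm w (z p) (z q) =
      1 / 2 * (empiricalForm w ((√2)⁻¹ • (z p + z q)) ((√2)⁻¹ • (z p + z q)) - 1) -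
      1 / 2 * (empiricalForm w ((√2)⁻¹ • (z q - z p)) ((√2)⁻¹ • (z q - z p)) - 1) := by
    rw [show z q - z p = z q + (-1 : ℝ) • z p by rw [neg_one_smul, sub_eq_add_neg]]
    simp only [empiricalForm_smul_left, empiricalForm_smul_right, empiricalForm_add_left,
      empiricalForm_add_right]
    rw [empiricalForm_comm w (z q) (z p)]
    linear_combination (-2 * empiricalForm w (z p) (z q)) * inv_sqrt_two_sq
  obtain ⟨a1, a2⟩ := abs_le.1 h1
  obtain ⟨b1, b2⟩ := abs_le.1 h2
  rw [e1]
  refine abs_le.2 ⟨?_, ?_⟩ <;> linarith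

end empiricalForm

section chain

variable {S : Matrix (Fin n) (Fin n) ℝ}

lemma correlation_sq (hpos : ∀ i, 0 < S i i) (i j : Fin n) :
    correlation S i j ^ 2 = S i j ^ 2 / (S i i * S j j) := by
  rw [correlation, div_pow, mul_pow, Real.sq_sqrt (hpos i).le, Real.sq_sqrt (hpos j).le]

lemma unitCoord_form (i j : Fin n) :
    unitCoord S i ⬝ᵥ S *ᵥ unitCoord S j = correlation S i j := by
  simp only [unitCoord, Matrix.mulVec_single, single_dotProduct, Matrix.col_apply,
    Pi.smul_apply, correlation]
  simp [div_eq_mul_inv]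
  ring

lemma correlation_self (hpos : ∀ i, 0 < S i i) (i : Fin n) : correlation S i i = 1 := by
  rw [correlation, Real.mul_self_sqrt (hpos i).le, div_self (hpos i).ne']

lemma correlation_comm (hS : ∀ i j, S i j = S j i) (i j : Fin n) :
    correlation S i j = correlation S j i := by
  rw [correlation, correlation, hS i j, mul_comm √(S i i)]

/-- Correlations multiply along a Markov chain. -/
lemma MarkovTriple.correlation_eq {a b c : Fin n} (h : MarkovTriple S a b c)
    (hpos : ∀ i, 0 < S i i) : correlation S a c = correlation S a b * correlation S b c := by
  have h1 : √(S b b) * √(S b b) = S b b := Real.mul_self_sqrt (hpos b).le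
  have ha := (Real.sqrt_pos.2 (hpos a)).ne'
  have hb := (Real.sqrt_pos.2 (hpos b)).ne'
  have hc := (Real.sqrt_pos.2 (hpos c)).ne'
  unfold MarkovTriple at h
  rw [correlation, correlation, correlation, div_mul_div_comm, div_eq_div_iff (by positivity)
    (by positivity)]
  linear_combination (√(S a a) * √(S c c)) * h + S a c * (√(S a a) * √(S c c)) * h1

/-- For a Markov chain the functionals of `chainBasis` are uncorrelated, with variance one. -/
lemma chainBasis_form (hS : ∀ i j, S i j = S j i) (hpos : ∀ i, 0 < S i i) {a b c : Fin n}
    (h : MarkovTriple S a b c) (hab : S a b ^ 2 < S a a * S b b)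
    (hcb : S c b ^ 2 < S c c * S b b) (p q : Fin 3) :
    chainBasis S a b c p ⬝ᵥ S *ᵥ chainBasis S a b c q = if p = q then 1 else 0 := by
  have ha : 0 < 1 - correlation S a b ^ 2 := by
    rw [correlation_sq hpos]; exact one_sub_sq_pos hpos hab
  have hc : 0 < 1 - correlation S c b ^ 2 := by
    rw [correlation_sq hpos]; exact one_sub_sq_pos hpos hcb
  have ha2 := Real.mul_self_sqrt ha.le
  have hc2 := Real.mul_self_sqrt hc.le
  have ha3 := (Real.sqrt_pos.2 ha).ne'
  have hc3 := (Real.sqrt_pos.2 hc).ne'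
  have hac := h.correlation_eq hpos
  rw [correlation_comm hS b c] at hac
  have e1 := correlation_comm hS b a
  have e2 := correlation_comm hS b c
  have e3 := correlation_comm hS c a
  have e4 := correlation_self hpos (S := S)
  fin_cases p <;> fin_cases q <;>
    simp [chainBasis, Matrix.mulVec_smul, Matrix.mulVec_sub, smul_dotProduct, dotProduct_smul,
      sub_dotProduct, dotProduct_sub, unitCoord_form, e1, e2, e3, e4, hac] <;>
    field_simp <;> first | linarith | simp

lemma probe_form {z : Fin 3 → Fin n → ℝ}
    (hz : ∀ p q, z p ⬝ᵥ S *ᵥ z q = if p = q then 1 else 0) (p q : Fin 3) :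
    probe z p q ⬝ᵥ S *ᵥ probe z p q = 1 := by
  unfold probe
  split_ifs with h1 h2
  · rw [hz, if_pos rfl]
  · simp only [Matrix.mulVec_smul, Matrix.mulVec_add, smul_dotProduct, dotProduct_smul,
      add_dotProduct, dotProduct_add, hz, if_neg h1, if_neg (Ne.symm h1), if_true, smul_eq_mul]
    linear_combination 2 * inv_sqrt_two_sq
  · simp only [Matrix.mulVec_smul, Matrix.mulVec_sub, smul_dotProduct, dotProduct_smul,
      sub_dotProduct, dotProduct_sub, hz, if_neg h1, if_neg (Ne.symm h1), if_true, smul_eq_mul]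
    linear_combination 2 * inv_sqrt_two_sq

/-- Empirical mutual informations do not depend on the scale of the coordinates. -/
lemma empiricalMutualInfo_eq {k : ℕ} (hk : 0 < k) (w : Fin k → EuclideanSpace ℝ (Fin n))
    (hpos : ∀ i, 0 < S i i) (i j : Fin n) :
    empiricalMutualInfo w i j = -(1 / 2) * Real.log (1 -
      empiricalForm w (unitCoord S i) (unitCoord S j) ^ 2 /
        (empiricalForm w (unitCoord S i) (unitCoord S i) *
          empiricalForm w (unitCoord S j) (unitCoord S j))) := by
  have hf : ∀ i j, empiricalForm w (unitCoord S i) (unitCoord S j) =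
      (√(S i i))⁻¹ * (√(S j j))⁻¹ / (2 * k) * ∑ t, w t i * w t j := by
    intro i j
    rw [empiricalForm, Finset.mul_sum, Finset.sum_div]
    refine Finset.sum_congr rfl fun t _ => ?_
    simp only [unitCoord, single_dotProduct]
    ring
  have hi := (Real.sqrt_pos.2 (hpos i)).ne'
  have hj := (Real.sqrt_pos.2 (hpos j)).ne'
  have hk' : (k : ℝ) ≠ 0 := by positivity
  have hnn : 0 ≤ (∑ t, w t i * w t i) * ∑ t, w t j * w t j :=
    mul_nonneg (Finset.sum_nonneg fun t _ => mul_self_nonneg _)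
      (Finset.sum_nonneg fun t _ => mul_self_nonneg _)
  rw [empiricalMutualInfo, empiricalCorrelation, div_pow, Real.sq_sqrt hnn, hf, hf, hf]
  congr 3
  generalize (∑ t, w t i * w t i) = A
  generalize (∑ t, w t j * w t j) = B
  generalize (∑ t, w t i * w t j) = C
  set α := (√(S i i))⁻¹ with hα
  set β := (√(S j j))⁻¹ with hβ
  have hα0 : α ≠ 0 := inv_ne_zero hi
  have hβ0 : β ≠ 0 := inv_ne_zero hj
  rw [show (α * β / (2 * ↑k) * C) ^ 2 = (α * β / (2 * ↑k)) ^ 2 * C ^ 2 by ring,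
    show α * α / (2 * ↑k) * A * (β * β / (2 * ↑k) * B) = (α * β / (2 * ↑k)) ^ 2 * (A * B) by ring,
    mul_div_mul_left _ _ (by positivity)]

/-- On data for which the empirical variances of all probes of the Markov triple `a - b - c` are
`τ`-close to one, the empirical gap between the mutual informations of `a, b` and `a, c` controls
the true gap. -/
lemma gaussianMutualInfo_gap_le {k : ℕ} (hk : 0 < k) (w : Fin k → EuclideanSpace ℝ (Fin n))
    (hS : ∀ i j, S i j = S j i) (hpos : ∀ i, 0 < S i i) {a b c : Fin n}
    (h : MarkovTriple S a b c) (hab : S a b ^ 2 < S a a * S b b)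
    (hcb : S c b ^ 2 < S c c * S b b) {τ : ℝ} (hτ : τ ≤ 1 / 20)
    (hw : ∀ p q, |empiricalForm w (probe (chainBasis S a b c) p q)
      (probe (chainBasis S a b c) p q) - 1| ≤ τ) :
    gaussianMutualInfo S a b - gaussianMutualInfo S a c ≤
      8 * (empiricalMutualInfo w a b - empiricalMutualInfo w a c) + 56 * τ ^ 2 := by
  have ha : 0 < 1 - correlation S a b ^ 2 := by
    rw [correlation_sq hpos]; exact one_sub_sq_pos hpos hab
  have hc : 0 < 1 - correlation S c b ^ 2 := by
    rw [correlation_sq hpos]; exact one_sub_sq_pos hpos hcb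
  set ρ := correlation S a b with hρ
  set κ := correlation S c b with hκ
  have hρ' := Real.sqrt_pos.2 ha
  have hκ' := Real.sqrt_pos.2 hc
  set z := chainBasis S a b c with hz
  have hub : unitCoord S b = z 0 := by simp [hz, chainBasis]
  have hua : unitCoord S a = ρ • z 0 + √(1 - ρ ^ 2) • z 1 := by
    simp [hz, chainBasis, smul_smul, ← hρ, mul_inv_cancel₀ hρ'.ne']
  have huc : unitCoord S c = κ • z 0 + √(1 - κ ^ 2) • z 2 := by
    simp [hz, chainBasis, smul_smul, ← hκ, mul_inv_cancel₀ hκ'.ne']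
  have hd : ∀ p, |empiricalForm w (z p) (z p) - 1| ≤ τ := fun p => by
    simpa [probe] using hw p p
  have key := log_gap_le hτ (a := ρ) (c := κ) (by rw [Real.sq_sqrt ha.le]; ring)
    (by rw [Real.sq_sqrt hc.le]; ring) hρ' hκ' (hd 0) (hd 1) (hd 2)
    (abs_empiricalForm_le w hw (p := 0) (q := 1) (by decide))
    (abs_empiricalForm_le w hw (p := 0) (q := 2) (by decide))
    (abs_empiricalForm_le w hw (p := 1) (q := 2) (by decide))
    (GAA := empiricalForm w (unitCoord S a) (unitCoord S a))
    (GCC := empiricalForm w (unitCoord S c) (unitCoord S c))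
    (GAB := empiricalForm w (unitCoord S a) (unitCoord S b))
    (GAC := empiricalForm w (unitCoord S a) (unitCoord S c))
    (by
      rw [hua]
      simp only [empiricalForm_smul_left, empiricalForm_smul_right, empiricalForm_add_left,
        empiricalForm_add_right, empiricalForm_comm w (z 1) (z 0)]
      ring)
    (by
      rw [huc]
      simp only [empiricalForm_smul_left, empiricalForm_smul_right, empiricalForm_add_left,
        empiricalForm_add_right, empiricalForm_comm w (z 2) (z 0)]
      ring)
    (by
      rw [hua, hub]
      simp only [empiricalForm_smul_left, empiricalForm_add_left, empiricalForm_comm w (z 1) (z 0)])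
    (by
      rw [hua, huc]
      simp only [empiricalForm_smul_left, empiricalForm_smul_right, empiricalForm_add_left,
        empiricalForm_add_right, empiricalForm_comm w (z 1) (z 0)]
      ring)
  rw [empiricalMutualInfo_eq hk w hpos, empiricalMutualInfo_eq hk w hpos, gaussianMutualInfo,
    gaussianMutualInfo, ← correlation_sq hpos, ← correlation_sq hpos, h.correlation_eq hpos,
    correlation_comm hS b c]
  rw [hub] at key ⊢
  linarith

end chain

/-! ### Concentration of empirical second moments -/

/-- The moment generating function of the chi-squared distribution. -/
lemma gaussianReal_exp_mul_sq {s : ℝ} (hs : s < 1 / 2) :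
    Integrable (fun x => Real.exp (s * x ^ 2)) (gaussianReal 0 1) ∧
      ∫ x, Real.exp (s * x ^ 2) ∂(gaussianReal 0 1) = √((1 - 2 * s)⁻¹) := by
  have hb : 0 < 1 / 2 - s := by linarith
  have hf : ∀ x, gaussianPDFReal 0 1 x * Real.exp (s * x ^ 2) =
      (√(2 * Real.pi))⁻¹ * Real.exp (-(1 / 2 - s) * x ^ 2) := by
    intro x
    rw [gaussianPDFReal, mul_assoc, ← Real.exp_add]
    simp only [NNReal.coe_one, mul_one, sub_zero]
    congr 2
    ring
  constructor
  · rw [gaussianReal_of_var_ne_zero _ one_ne_zero, gaussianPDF_def,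
      integrable_withDensity_iff_integrable_smul₀' (by fun_prop) (by simp)]
    simp only [ENNReal.toReal_ofReal (gaussianPDFReal_nonneg _ _ _), smul_eq_mul, hf]
    exact (integrable_exp_neg_mul_sq hb).const_mul _
  · rw [integral_gaussianReal_eq_integral_smul one_ne_zero]
    simp only [smul_eq_mul, hf]
    rw [integral_const_mul, integral_gaussian, ← Real.sqrt_inv, ← Real.sqrt_mul (by positivity)]
    congr 1
    field_simp

lemma sqrt_inv_le_exp {s : ℝ} (hs : |s| ≤ 1 / 4) :
    √((1 - 2 * s)⁻¹) ≤ Real.exp (s + 4 * s ^ 2) := by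
  obtain ⟨h1, h2⟩ := abs_le.1 hs
  have hpos : 0 < 1 - 2 * s := by linarith
  have h3 := Real.abs_log_sub_add_sum_range_le (x := 2 * s) (by
    rw [abs_mul, abs_two]; linarith) 1
  have h4 : |2 * s| ^ (1 + 1) / (1 - |2 * s|) ≤ 8 * s ^ 2 := by
    rw [sq_abs, abs_mul, abs_two, div_le_iff₀ (by linarith)]
    nlinarith [sq_nonneg s]
  have h5 : -(Real.log (1 - 2 * s)) ≤ 2 * s + 8 * s ^ 2 := by
    have := (abs_le.1 (h3.trans h4)).1
    simp at this
    linarith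
  rw [Real.sqrt_le_left (Real.exp_pos _).le, ← Real.exp_nat_mul,
    ← Real.log_le_iff_le_exp (inv_pos.2 hpos), Real.log_inv]
  push_cast
  linarith

/-- Two-sided Chernoff bound for the chi-squared distribution. -/
lemma measure_abs_avg_sq_sub_one_le {Ω : Type*} [MeasurableSpace Ω] {P : Measure Ω}
    {N : ℕ} (hN : 0 < N) {Y : Fin N → Ω → ℝ} (hY : ∀ t, Measurable (Y t)) (hind : iIndepFun Y P)
    (hlaw : ∀ t, P.map (Y t) = gaussianReal 0 1) {τ : ℝ} (hτ : 0 ≤ τ) (hτ1 : τ ≤ 1) :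
    P.real {ω | τ < |(∑ t, Y t ω ^ 2) / N - 1|} ≤ 2 * Real.exp (-(N * τ ^ 2 / 16)) := by
  have := hind.isProbabilityMeasure
  have hN' : (0 : ℝ) < N := by exact_mod_cast hN
  set Z : Fin N → Ω → ℝ := fun t ω => Y t ω ^ 2 with hZ
  have hZm : ∀ t, Measurable (Z t) := fun t => (hY t).pow_const 2
  have hZi : iIndepFun Z P := hind.comp (fun _ x => x ^ 2) fun _ => by fun_prop
  have hint : ∀ s : ℝ, |s| ≤ 1 / 4 → ∀ t, Integrable (fun ω => Real.exp (s * Z t ω)) P := by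
    intro s hs t
    have h := (gaussianReal_exp_mul_sq (s := s) (by linarith [(abs_le.1 hs).2])).1
    rw [← hlaw t, integrable_map_measure (by fun_prop) (hY t).aemeasurable] at h
    exact h
  have hmgf : ∀ s : ℝ, |s| ≤ 1 / 4 → mgf (∑ t, Z t) P s ≤ Real.exp (N * (s + 4 * s ^ 2)) := by
    intro s hs
    rw [hZi.mgf_sum hZm, Real.exp_nat_mul]
    refine (Finset.prod_le_prod (g := fun _ => Real.exp (s + 4 * s ^ 2)) (fun t _ => mgf_nonneg)
      fun t _ => ?_).trans_eq (by simp)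
    have h : mgf (Z t) P s = ∫ x, Real.exp (s * x ^ 2) ∂(gaussianReal 0 1) := by
      rw [← hlaw t, integral_map (hY t).aemeasurable (by fun_prop)]
      rfl
    rw [h, (gaussianReal_exp_mul_sq (by linarith [(abs_le.1 hs).2])).2]
    exact sqrt_inv_le_exp hs
  have hs : |τ / 8| ≤ 1 / 4 := by rw [abs_of_nonneg (by positivity)]; linarith
  have hs' : |-(τ / 8)| ≤ 1 / 4 := by rwa [abs_neg]
  have up := measure_ge_le_exp_mul_mgf (μ := P) (X := ∑ t, Z t) (N * (1 + τ))
    (show 0 ≤ τ / 8 by positivity) (hZi.integrable_exp_mul_sum hZm fun t _ => hint _ hs t)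
  have dn := measure_le_le_exp_mul_mgf (μ := P) (X := ∑ t, Z t) (N * (1 - τ))
    (show -(τ / 8) ≤ 0 by linarith) (hZi.integrable_exp_mul_sum hZm fun t _ => hint _ hs' t)
  have up' : P.real {ω | N * (1 + τ) ≤ (∑ t, Z t) ω} ≤ Real.exp (-(N * τ ^ 2 / 16)) := by
    refine (up.trans (mul_le_mul_of_nonneg_left (hmgf _ hs) (Real.exp_pos _).le)).trans_eq ?_
    rw [← Real.exp_add]
    congr 1
    ring
  have dn' : P.real {ω | (∑ t, Z t) ω ≤ N * (1 - τ)} ≤ Real.exp (-(N * τ ^ 2 / 16)) := by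
    refine (dn.trans (mul_le_mul_of_nonneg_left (hmgf _ hs') (Real.exp_pos _).le)).trans_eq ?_
    rw [← Real.exp_add]
    congr 1
    ring
  have hsub : {ω | τ < |(∑ t, Y t ω ^ 2) / N - 1|} ⊆
      {ω | N * (1 + τ) ≤ (∑ t, Z t) ω} ∪ {ω | (∑ t, Z t) ω ≤ N * (1 - τ)} := by
    intro ω hω
    have hsum : (∑ t, Z t) ω = ∑ t, Y t ω ^ 2 := by simp [hZ]
    rcases lt_abs.1 (show τ < |(∑ t, Y t ω ^ 2) / N - 1| from hω) with h | h
    · refine Or.inl ?_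
      show N * (1 + τ) ≤ (∑ t, Z t) ω
      rw [hsum]
      have : 1 + τ ≤ (∑ t, Y t ω ^ 2) / N := by linarith
      rw [le_div_iff₀ hN'] at this
      linarith
    · refine Or.inr ?_
      show (∑ t, Z t) ω ≤ N * (1 - τ)
      rw [hsum]
      have : (∑ t, Y t ω ^ 2) / N ≤ 1 - τ := by linarith
      rw [div_le_iff₀ hN'] at this
      linarith
  have h1 := measureReal_mono (μ := P) hsub
  have h2 := measureReal_union_le (μ := P) {ω | N * (1 + τ) ≤ (∑ t, Z t) ω}
    {ω | (∑ t, Z t) ω ≤ N * (1 - τ)}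
  linarith

section pairDifferences

variable {m : ℕ} {μ : EuclideanSpace ℝ (Fin n)} {S : Matrix (Fin n) (Fin n) ℝ}

lemma hasGaussianLaw_dotProduct (μ : EuclideanSpace ℝ (Fin n)) (S : Matrix (Fin n) (Fin n) ℝ)
    (x : Fin n → ℝ) :
    HasGaussianLaw (fun v : EuclideanSpace ℝ (Fin n) => x ⬝ᵥ v.ofLp)
      (multivariateGaussian μ S) := by
  have h : HasGaussianLaw (id : EuclideanSpace ℝ (Fin n) → _) (multivariateGaussian μ S) :=
    ⟨by rw [Measure.map_id]; infer_instance⟩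
  have := h.map_fun (innerSL ℝ (WithLp.toLp 2 x))
  refine this.congr ?_
  filter_upwards with v
  simp [PiLp.inner_apply, dotProduct, mul_comm]

lemma covariance_dotProduct (hS : S.PosSemidef) (x y : Fin n → ℝ) :
    cov[fun v => x ⬝ᵥ v.ofLp, fun v => y ⬝ᵥ v.ofLp; multivariateGaussian μ S] = x ⬝ᵥ S *ᵥ y := by
  have h := covarianceBilin_multivariateGaussian (μ := μ) hS (WithLp.toLp 2 x) (WithLp.toLp 2 y)
  rw [covarianceBilin_apply_eq_cov IsGaussian.memLp_two_id] at h
  rw [← h]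
  congr 1 <;> · ext v; simp [PiLp.inner_apply, dotProduct, mul_comm]

/-- The empirical variance of a functional of variance one is concentrated: the normalised
differences of pairs of sample points are independent standard normal variables. -/
lemma measure_abs_empiricalForm_sub_one_le (hm : 0 < m / 2) (hS : S.PosSemidef)
    {ℓ : Fin n → ℝ} (hℓ : ℓ ⬝ᵥ S *ᵥ ℓ = 1) {τ : ℝ} (hτ : 0 ≤ τ) (hτ1 : τ ≤ 1) :
    (Measure.pi (fun _ : Fin m => multivariateGaussian μ S)).real
      {x | τ < |empiricalForm (pairDifferences x) ℓ ℓ - 1|} ≤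
        2 * Real.exp (-((m / 2 : ℕ) * τ ^ 2 / 16)) := by
  set P := Measure.pi (fun _ : Fin m => multivariateGaussian μ S) with hP
  set X : Fin m → (Fin m → EuclideanSpace ℝ (Fin n)) → ℝ := fun s x => ℓ ⬝ᵥ (x s).ofLp with hX
  have hmeas : Measurable fun v : EuclideanSpace ℝ (Fin n) => ℓ ⬝ᵥ v.ofLp := by
    simp only [dotProduct]; fun_prop
  have hXm : ∀ s, Measurable (X s) := fun s => hmeas.comp (measurable_pi_apply s)
  have hXi : iIndepFun X P := iIndepFun_pi
    (X := fun _ (v : EuclideanSpace ℝ (Fin n)) => ℓ ⬝ᵥ v.ofLp) fun _ => hmeas.aemeasurable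
  have hXg : ∀ s, HasGaussianLaw (X s) P := fun s => by
    have h := hasGaussianLaw_dotProduct μ S ℓ
    have e := (measurePreserving_eval (fun _ : Fin m => multivariateGaussian μ S) s).map_eq
    constructor
    have := h.isGaussian_map
    rw [← e, Measure.map_map hmeas (measurable_pi_apply s)] at this
    exact this
  have hXv : ∀ s, cov[X s, X s; P] = 1 := fun s => by
    have e := (measurePreserving_eval (fun _ : Fin m => multivariateGaussian μ S) s).map_eq
    have h := covariance_dotProduct (μ := μ) hS ℓ ℓ
    rw [hℓ, ← e, covariance_map hmeas.aestronglyMeasurable hmeas.aestronglyMeasurable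
      (measurable_pi_apply s).aemeasurable] at h
    exact h
  have hXc : ∀ s s', s ≠ s' → cov[X s, X s'; P] = 0 := fun s s' h =>
    (hXi.indepFun h).covariance_eq_zero (hXg s).memLp_two (hXg s').memLp_two
  have hXint : ∀ s s', P[X s] = P[X s'] := fun s s' => by
    have e : ∀ s, P[X s] = ∫ v, ℓ ⬝ᵥ v.ofLp ∂(multivariateGaussian μ S) := fun s => by
      rw [← (measurePreserving_eval (fun _ : Fin m => multivariateGaussian μ S) s).map_eq,
        integral_map (measurable_pi_apply s).aemeasurable hmeas.aestronglyMeasurable]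
    rw [e, e]
  have hjoint : HasGaussianLaw (fun x s => X s x) P := hXi.hasGaussianLaw hXg
  let i₀ : Fin (m / 2) → Fin m := fun t => ⟨2 * t, by omega⟩
  let i₁ : Fin (m / 2) → Fin m := fun t => ⟨2 * t + 1, by omega⟩
  have h01 : ∀ t t', i₀ t ≠ i₁ t' := fun t t' h => by
    have : 2 * (t : ℕ) = 2 * t' + 1 := congrArg Fin.val h
    omega
  have h00 : ∀ t t', t ≠ t' → i₀ t ≠ i₀ t' := fun t t' h h' => h (Fin.ext (by
    have : 2 * (t : ℕ) = 2 * t' := congrArg Fin.val h'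
    omega))
  have h11 : ∀ t t', t ≠ t' → i₁ t ≠ i₁ t' := fun t t' h h' => h (Fin.ext (by
    have : 2 * (t : ℕ) + 1 = 2 * t' + 1 := congrArg Fin.val h'
    omega))
  let L : (Fin m → ℝ) →L[ℝ] (Fin (m / 2) → ℝ) :=
    ContinuousLinearMap.pi fun t => (√2)⁻¹ •
      (ContinuousLinearMap.proj (R := ℝ) (φ := fun _ : Fin m => ℝ) (i₀ t) -
        ContinuousLinearMap.proj (R := ℝ) (φ := fun _ : Fin m => ℝ) (i₁ t))
  set Y : Fin (m / 2) → (Fin m → EuclideanSpace ℝ (Fin n)) → ℝ :=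
    fun t x => (√2)⁻¹ * (X (i₀ t) x - X (i₁ t) x) with hY
  have hYg : HasGaussianLaw (fun x t => Y t x) P := hjoint.map_fun L
  have hcov : ∀ t t', cov[Y t, Y t'; P] = 1 / 2 *
      (cov[X (i₀ t), X (i₀ t'); P] - cov[X (i₀ t), X (i₁ t'); P] -
        (cov[X (i₁ t), X (i₀ t'); P] - cov[X (i₁ t), X (i₁ t'); P])) := by
    intro t t'
    have hsub : MemLp (fun x => X (i₀ t') x - X (i₁ t') x) 2 P :=
      (hXg _).memLp_two.sub (hXg _).memLp_two
    simp only [hY]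
    rw [covariance_const_mul_left, covariance_const_mul_right,
      covariance_fun_sub_left (hXg _).memLp_two (hXg _).memLp_two hsub,
      covariance_fun_sub_right (hXg _).memLp_two (hXg _).memLp_two (hXg _).memLp_two,
      covariance_fun_sub_right (hXg _).memLp_two (hXg _).memLp_two (hXg _).memLp_two,
      ← mul_assoc, inv_sqrt_two_sq]
  have hYi : iIndepFun Y P := by
    refine hYg.iIndepFun_of_covariance_eq_zero fun t t' h => ?_
    rw [hcov, hXc _ _ (h00 t t' h), hXc _ _ (h01 t t'), hXc _ _ (h01 t' t).symm,
      hXc _ _ (h11 t t' h)]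
    simp
  have hYm : ∀ t, Measurable (Y t) := fun t => by
    have h0 := hXm (i₀ t)
    have h1 := hXm (i₁ t)
    simp only [hY]
    fun_prop
  have hYl : ∀ t, P.map (Y t) = gaussianReal 0 1 := fun t => by
    have hg := (hYg.eval t)
    rw [hg.map_eq_gaussianReal]
    congr 1
    · simp only [hY]
      rw [integral_const_mul, integral_sub (hXg _).integrable (hXg _).integrable,
        hXint (i₀ t) (i₁ t), sub_self, mul_zero]
    · rw [← covariance_self (hYm t).aemeasurable, hcov, hXv, hXv, hXc _ _ (h01 t t),
        hXc _ _ (h01 t t).symm]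
      norm_num
  have hmain := measure_abs_avg_sq_sub_one_le hm hYm hYi hYl hτ hτ1
  have hset : ∀ x, empiricalForm (pairDifferences x) ℓ ℓ =
      (∑ t, Y t x ^ 2) / (m / 2 : ℕ) := by
    intro x
    have h1 : ∀ t, Y t x ^ 2 = (ℓ ⬝ᵥ (pairDifferences x t).ofLp) *
        (ℓ ⬝ᵥ (pairDifferences x t).ofLp) / 2 := by
      intro t
      have h2 : ℓ ⬝ᵥ (pairDifferences x t).ofLp = X (i₀ t) x - X (i₁ t) x := by
        simp only [pairDifferences, WithLp.ofLp_sub, dotProduct_sub, hX, i₀, i₁]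
      rw [h2, hY]
      linear_combination (X (i₀ t) x - X (i₁ t) x) ^ 2 * inv_sqrt_two_sq
    simp only [h1]
    rw [empiricalForm, ← Finset.sum_div, div_div]
  simp only [hset]
  exact hmain

end pairDifferences

/-! ### Densities and relative entropies of Gaussian distributions -/

section GaussianDensity

lemma lintegral_pi_prod {k : ℕ} {α : Fin k → Type*} [∀ i, MeasurableSpace (α i)]
    (ν : ∀ i, Measure (α i)) [∀ i, SigmaFinite (ν i)] {f : ∀ i, α i → ℝ≥0∞}
    (hf : ∀ i, Measurable (f i)) :
    ∫⁻ x, ∏ i, f i (x i) ∂Measure.pi ν = ∏ i, ∫⁻ x, f i x ∂ν i := by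
  induction k with
  | zero => simp
  | succ k ih =>
    have e := (measurePreserving_piFinSuccAbove ν 0).symm
    have hm : Measurable fun x : (i : Fin (k + 1)) → α i => ∏ i, f i (x i) :=
      Finset.measurable_prod _ fun i _ => (hf i).comp (measurable_pi_apply i)
    rw [← e.lintegral_comp hm, Fin.prod_univ_succ]
    simp only [MeasurableEquiv.piFinSuccAbove_symm_apply, Fin.prod_univ_succ,
      Fin.insertNthEquiv_apply, Fin.insertNth_zero, Fin.cons_zero, Fin.cons_succ]
    have h := ih (fun i => ν i.succ) (f := fun i => f i.succ) fun i => hf _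
    rw [← h]
    have hm' : Measurable fun y : (i : Fin k) → α i.succ => ∏ i, f i.succ (y i) :=
      Finset.measurable_prod _ fun i _ => (hf i.succ).comp (measurable_pi_apply i)
    exact lintegral_prod_mul (μ := ν 0) (ν := Measure.pi fun i : Fin k => ν i.succ)
      (hf 0).aemeasurable hm'.aemeasurable

lemma Measure.pi_withDensity {k : ℕ} {α : Fin k → Type*} [∀ i, MeasurableSpace (α i)]
    (ν : ∀ i, Measure (α i)) [∀ i, SigmaFinite (ν i)] {f : ∀ i, α i → ℝ≥0∞}
    (hf : ∀ i, Measurable (f i)) [∀ i, SigmaFinite ((ν i).withDensity (f i))] :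
    Measure.pi (fun i => (ν i).withDensity (f i)) =
      (Measure.pi ν).withDensity fun x => ∏ i, f i (x i) := by
  refine (Measure.pi_eq fun s hs => ?_)
  rw [withDensity_apply _ (MeasurableSet.univ_pi hs), Measure.restrict_pi_pi,
    lintegral_pi_prod _ hf]
  exact Finset.prod_congr rfl fun i _ => (withDensity_apply _ (hs i)).symm

lemma Measure.map_withDensity_comp {α β : Type*} [MeasurableSpace α] [MeasurableSpace β]
    (ν : Measure α) {φ : α → β} (hφ : Measurable φ) {g : β → ℝ≥0∞} (hg : Measurable g) :
    (ν.withDensity (g ∘ φ)).map φ = (ν.map φ).withDensity g := by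
  ext s hs
  rw [Measure.map_apply hφ hs, withDensity_apply _ (hφ hs), withDensity_apply _ hs,
    setLIntegral_map hs hg hφ]
  rfl

/-- The density of `N(μ, S)` with respect to Lebesgue measure, for positive definite `S`. -/
noncomputable def multivariateGaussianPDFReal (μ : EuclideanSpace ℝ (Fin n))
    (S : Matrix (Fin n) (Fin n) ℝ) (x : EuclideanSpace ℝ (Fin n)) : ℝ :=
  (√(2 * Real.pi))⁻¹ ^ n * (√S.det)⁻¹ *
    Real.exp (-((x - μ).ofLp ⬝ᵥ S⁻¹ *ᵥ (x - μ).ofLp) / 2)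

lemma continuous_multivariateGaussianPDFReal (μ : EuclideanSpace ℝ (Fin n))
    (S : Matrix (Fin n) (Fin n) ℝ) : Continuous (multivariateGaussianPDFReal μ S) := by
  unfold multivariateGaussianPDFReal
  simp only [dotProduct, mulVec]
  fun_prop

lemma multivariateGaussianPDFReal_pos (μ : EuclideanSpace ℝ (Fin n))
    {S : Matrix (Fin n) (Fin n) ℝ} (hS : S.PosDef) (x : EuclideanSpace ℝ (Fin n)) :
    0 < multivariateGaussianPDFReal μ S x := by
  have := Real.sqrt_pos.2 hS.det_pos
  have := Real.sqrt_pos.2 Real.two_pi_pos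
  unfold multivariateGaussianPDFReal
  positivity

lemma stdGaussian_eq_withDensity :
    stdGaussian (EuclideanSpace ℝ (Fin n)) = volume.withDensity
      fun x => ENNReal.ofReal ((√(2 * Real.pi))⁻¹ ^ n * Real.exp (-(x.ofLp ⬝ᵥ x.ofLp) / 2)) := by
  have h1 := map_pi_eq_stdGaussian (ι := Fin n)
  simp only [gaussianReal_of_var_ne_zero 0 one_ne_zero] at h1
  have : SigmaFinite ((volume : Measure ℝ).withDensity (gaussianPDF 0 1)) := by
    rw [← gaussianReal_of_var_ne_zero 0 one_ne_zero]; infer_instance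
  rw [Measure.pi_withDensity (fun _ : Fin n => (volume : Measure ℝ))
    (f := fun _ => gaussianPDF 0 1) (fun _ => measurable_gaussianPDF 0 1)] at h1
  rw [← h1, ← (PiLp.volume_preserving_toLp (Fin n)).map_eq,
    ← Measure.map_withDensity_comp _ (by fun_prop) (by simp only [dotProduct]; fun_prop)]
  congr 2
  funext x
  simp only [gaussianPDF, Function.comp, gaussianPDFReal]
  rw [← ENNReal.ofReal_prod_of_nonneg fun i _ => by positivity]
  congr 1
  rw [Finset.prod_mul_distrib, ← Real.exp_sum]
  simp [dotProduct, Finset.sum_neg_distrib, Finset.sum_div, neg_div, sq]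

open scoped MatrixOrder in
/-- The density arises from that of the standard Gaussian by the affine substitution
`x ↦ μ + √S x`, whose Jacobian is `√(det S)`. -/
lemma multivariateGaussian_eq_withDensity (μ : EuclideanSpace ℝ (Fin n))
    {S : Matrix (Fin n) (Fin n) ℝ} (hS : S.PosDef) :
    multivariateGaussian μ S = volume.withDensity
      fun x => ENNReal.ofReal (multivariateGaussianPDFReal μ S x) := by
  set A := CFC.sqrt S with hA
  have hAA : A * A = S := CFC.sqrt_mul_sqrt_self _ hS.posSemidef.nonneg
  have hdet : A.det * A.det = S.det := by rw [← det_mul, hAA]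
  have hA0 : A.det ≠ 0 := fun h => hS.det_pos.ne' (by rw [← hdet, h, zero_mul])
  have hAu : IsUnit A.det := isUnit_iff_ne_zero.2 hA0
  have hAs : Aᵀ = A := by
    have : A.PosSemidef := Matrix.nonneg_iff_posSemidef.1 (CFC.sqrt_nonneg S)
    simpa using this.isHermitian.eq
  have habs : |A.det| = √S.det := by
    rw [← hdet, Real.sqrt_mul_self_eq_abs]
  set f : EuclideanSpace ℝ (Fin n) →L[ℝ] EuclideanSpace ℝ (Fin n) := toEuclideanCLM (𝕜 := ℝ) A
  have hfapp : ∀ x, (f x).ofLp = A *ᵥ x.ofLp := fun x => by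
    simp [f]
  have hf :
      LinearMap.det (f : EuclideanSpace ℝ (Fin n) →ₗ[ℝ] EuclideanSpace ℝ (Fin n)) = A.det := by
    have : (f : EuclideanSpace ℝ (Fin n) →ₗ[ℝ] EuclideanSpace ℝ (Fin n)) =
        Matrix.toLin (EuclideanSpace.basisFun (Fin n) ℝ).toBasis
          (EuclideanSpace.basisFun (Fin n) ℝ).toBasis A := by
      rw [coe_toEuclideanCLM_eq_toEuclideanLin, toEuclideanLin_eq_toLin_orthonormal]
    rw [this, LinearMap.det_toLin]
  have hvol : (volume : Measure (EuclideanSpace ℝ (Fin n))).map (fun x => μ + f x) =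
      ENNReal.ofReal (√S.det)⁻¹ • volume := by
    have h1 := Measure.map_linearMap_addHaar_eq_smul_addHaar
      (volume : Measure (EuclideanSpace ℝ (Fin n))) (f := f.toLinearMap) (by rw [hf]; exact hA0)
    rw [hf, abs_inv, habs] at h1
    have h2 : (fun x => μ + f x) = (fun x => μ + x) ∘ f := rfl
    rw [h2, ← Measure.map_map (by fun_prop) (by fun_prop)]
    erw [h1]
    rw [Measure.map_smul, map_add_left_eq_self]
  have hq : ∀ x, x.ofLp ⬝ᵥ x.ofLp = ((μ + f x) - μ).ofLp ⬝ᵥ S⁻¹ *ᵥ ((μ + f x) - μ).ofLp := by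
    intro x
    rw [add_sub_cancel_left, hfapp, ← hAA, Matrix.mul_inv_rev, mulVec_mulVec, dotProduct_mulVec,
      ← mulVec_transpose, mulVec_mulVec, transpose_mul, transpose_mul, transpose_nonsing_inv, hAs]
    rw [Matrix.mul_assoc, Matrix.mul_assoc, Matrix.nonsing_inv_mul _ hAu, Matrix.mul_one,
       Matrix.mul_nonsing_inv _ hAu, Matrix.one_mulVec]
  set g : EuclideanSpace ℝ (Fin n) → ℝ≥0∞ := fun y => ENNReal.ofReal ((√(2 * Real.pi))⁻¹ ^ n *
    Real.exp (-((y - μ).ofLp ⬝ᵥ S⁻¹ *ᵥ (y - μ).ofLp) / 2)) with hg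
  have hgm : Measurable g := by
    simp only [hg, dotProduct, mulVec]
    fun_prop
  rw [multivariateGaussian, stdGaussian_eq_withDensity]
  simp only [hq]
  change (volume.withDensity (g ∘ fun x => μ + f x)).map (fun x => μ + f x) = _
  rw [Measure.map_withDensity_comp _ (by fun_prop) hgm, hvol, withDensity_smul_measure,
    ← withDensity_smul _ hgm]
  congr 1
  funext y
  simp only [hg, Pi.smul_apply, smul_eq_mul, multivariateGaussianPDFReal]
  rw [← ENNReal.ofReal_mul (by positivity)]
  congr 1
  ring

lemma integral_eval_multivariateGaussian (μ : EuclideanSpace ℝ (Fin n))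
    (S : Matrix (Fin n) (Fin n) ℝ) (i : Fin n) : ∫ x, x i ∂(multivariateGaussian μ S) = μ i := by
  rw [← EuclideanSpace.coe_proj, ContinuousLinearMap.integral_comp_id_comm
    IsGaussian.integrable_id, integral_id_multivariateGaussian]
  rfl

lemma memLp_two_eval_multivariateGaussian (μ : EuclideanSpace ℝ (Fin n))
    (S : Matrix (Fin n) (Fin n) ℝ) (i : Fin n) :
    MemLp (fun x : EuclideanSpace ℝ (Fin n) => x i) 2 (multivariateGaussian μ S) := by
  have h : HasGaussianLaw (id : EuclideanSpace ℝ (Fin n) → _) (multivariateGaussian μ S) :=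
    ⟨by rw [Measure.map_id]; infer_instance⟩
  exact (h.map_fun (EuclideanSpace.proj i : EuclideanSpace ℝ (Fin n) →L[ℝ] ℝ)).memLp_two

/-- The expectation of a quadratic form in the centred Gaussian vector. -/
lemma multivariateGaussian_quadraticForm (μ : EuclideanSpace ℝ (Fin n))
    {S : Matrix (Fin n) (Fin n) ℝ} (hS : S.PosSemidef) (A : Matrix (Fin n) (Fin n) ℝ) :
    Integrable (fun x : EuclideanSpace ℝ (Fin n) => (x - μ).ofLp ⬝ᵥ A *ᵥ (x - μ).ofLp)
        (multivariateGaussian μ S) ∧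
      ∫ x, (x - μ).ofLp ⬝ᵥ A *ᵥ (x - μ).ofLp ∂(multivariateGaussian μ S) = (A * S).trace := by
  have hc : ∀ i, MemLp (fun x : EuclideanSpace ℝ (Fin n) => x i - μ i) 2
      (multivariateGaussian μ S) := fun i =>
    (memLp_two_eval_multivariateGaussian μ S i).sub (memLp_const _)
  have hi : ∀ i j, Integrable (fun x : EuclideanSpace ℝ (Fin n) =>
      A i j * ((x i - μ i) * (x j - μ j))) (multivariateGaussian μ S) := fun i j =>
    ((hc i).integrable_mul (hc j)).const_mul _
  have e : ∀ x : EuclideanSpace ℝ (Fin n), (x - μ).ofLp ⬝ᵥ A *ᵥ (x - μ).ofLp =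
      ∑ i, ∑ j, A i j * ((x i - μ i) * (x j - μ j)) := fun x => by
    simp only [dotProduct, mulVec, Finset.mul_sum, WithLp.ofLp_sub, Pi.sub_apply]
    exact Finset.sum_congr rfl fun i _ => Finset.sum_congr rfl fun j _ => by ring
  simp only [e]
  refine ⟨integrable_finsetSum _ fun i _ => integrable_finsetSum _ fun j _ => hi i j, ?_⟩
  rw [integral_finsetSum _ fun i _ => integrable_finsetSum _ fun j _ => hi i j]
  simp only [trace, diag, mul_apply]
  refine Finset.sum_congr rfl fun i _ => ?_
  rw [integral_finsetSum _ fun j _ => hi i j]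
  refine Finset.sum_congr rfl fun j _ => ?_
  rw [integral_const_mul]
  have h := covariance_eval_multivariateGaussian (μ := μ) hS j i
  rw [covariance, integral_eval_multivariateGaussian, integral_eval_multivariateGaussian] at h
  rw [← h]
  simp only [mul_comm]

/-- Relative entropy of two Gaussian distributions with the same mean. -/
lemma klDiv_multivariateGaussian (μ : EuclideanSpace ℝ (Fin n))
    {S S' : Matrix (Fin n) (Fin n) ℝ} (hS : S.PosDef) (hS' : S'.PosDef) :
    klDiv (multivariateGaussian μ S) (multivariateGaussian μ S') =
      ENNReal.ofReal (((S'⁻¹ * S).trace - n + Real.log S'.det - Real.log S.det) / 2) := by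
  set P := multivariateGaussian μ S
  set Q := multivariateGaussian μ S'
  set p := multivariateGaussianPDFReal μ S
  set q := multivariateGaussianPDFReal μ S'
  have hpos := multivariateGaussianPDFReal_pos μ hS
  have hqos := multivariateGaussianPDFReal_pos μ hS'
  have hpm : Measurable p := (continuous_multivariateGaussianPDFReal μ S).measurable
  have hqm : Measurable q := (continuous_multivariateGaussianPDFReal μ S').measurable
  have hPQ : P = Q.withDensity fun x => ENNReal.ofReal (p x / q x) := by
    simp only [P, Q]
    rw [multivariateGaussian_eq_withDensity μ hS, multivariateGaussian_eq_withDensity μ hS',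
      ← withDensity_mul (f := fun x => ENNReal.ofReal (q x))
        (g := fun x => ENNReal.ofReal (p x / q x)) _ (by fun_prop) (by fun_prop)]
    congr 1
    funext x
    simp only [Pi.mul_apply]
    rw [← ENNReal.ofReal_mul (hqos x).le, mul_div_cancel₀ _ (hqos x).ne']
  have hac : P ≪ Q := hPQ ▸ withDensity_absolutelyContinuous _ _
  have hrn : ∀ᵐ x ∂P, P.rnDeriv Q x = ENNReal.ofReal (p x / q x) := by
    refine hac.ae_le ?_
    have := Measure.rnDeriv_withDensity Q (f := fun x => ENNReal.ofReal (p x / q x)) (by fun_prop)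
    rwa [← hPQ] at this
  set A := S'⁻¹ - S⁻¹ with hA
  have hllr : llr P Q =ᵐ[P] fun x => (Real.log S'.det - Real.log S.det) / 2 +
      ((x - μ).ofLp ⬝ᵥ A *ᵥ (x - μ).ofLp) / 2 := by
    filter_upwards [hrn] with x hx
    have h2 := Real.sqrt_pos.2 Real.two_pi_pos
    have h3 : ∀ {R : Matrix (Fin n) (Fin n) ℝ}, R.PosDef →
        Real.log (multivariateGaussianPDFReal μ R x) =
          Real.log ((√(2 * Real.pi))⁻¹ ^ n) - Real.log R.det / 2 -
            ((x - μ).ofLp ⬝ᵥ R⁻¹ *ᵥ (x - μ).ofLp) / 2 := by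
      intro R hR
      have h4 := Real.sqrt_pos.2 hR.det_pos
      rw [multivariateGaussianPDFReal, Real.log_mul (by positivity) (by positivity),
        Real.log_mul (by positivity) (by positivity), Real.log_exp, Real.log_inv,
        Real.log_sqrt hR.det_pos.le]
      ring
    rw [llr, hx, ENNReal.toReal_ofReal (div_pos (hpos x) (hqos x)).le,
      Real.log_div (hpos x).ne' (hqos x).ne', h3 hS, h3 hS', hA, sub_mulVec,
      dotProduct_sub]
    ring
  obtain ⟨hint, hval⟩ := multivariateGaussian_quadraticForm μ hS.posSemidef A
  have hI : Integrable (llr P Q) P :=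
    ((integrable_const _).add (hint.div_const 2)).congr hllr.symm
  rw [klDiv_of_ac_of_integrable hac hI]
  congr 1
  rw [integral_congr_ae hllr, integral_add (integrable_const _) (hint.div_const 2),
    integral_const, integral_div, hval, hA, sub_mul, trace_sub,
    Matrix.nonsing_inv_mul _ (isUnit_iff_ne_zero.2 hS.det_pos.ne'), trace_one]
  simp
  ring

end GaussianDensity

/-! ### Conditional independence of Gaussian coordinates -/

section CondIndep

/-- If `Z` is a function of `Y` and `R` is independent of `Y`, then `(R, Z)` and `Y` are
conditionally independent given `Z`. -/
lemma condIndepFun_prodMk_of_indepFun {Ω β γ δ : Type*} [MeasurableSpace Ω] [StandardBorelSpace Ω]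
    [mβ : MeasurableSpace β] [mγ : MeasurableSpace γ] [mδ : MeasurableSpace δ] {P : Measure Ω}
    [IsProbabilityMeasure P] {R : Ω → β} {Y : Ω → γ} {Z : Ω → δ} (hR : Measurable R)
    (hY : Measurable Y) (hZ : Measurable Z)
    (hZY : MeasurableSpace.comap Z mδ ≤ MeasurableSpace.comap Y mγ) (h : IndepFun R Y P) :
    CondIndepFun (MeasurableSpace.comap Z mδ) hZ.comap_le (fun ω => (R ω, Z ω)) Y P := by
  set m' := MeasurableSpace.comap Z mδ with hm'
  have hle : m' ≤ _ := hZ.comap_le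
  -- conditioning on `Z` does not see events of `R`
  have key : ∀ s D, MeasurableSet s → MeasurableSet[mγ.comap Y] D →
      (P⟦(R ⁻¹' s) ∩ D | m'⟧) =ᵐ[P] fun ω => P.real (R ⁻¹' s) * (P⟦D | m'⟧) ω := by
    intro s D hs hD
    have hD' := hY.comap_le _ hD
    refine (ae_eq_condExp_of_forall_setIntegral_eq hle
      ((integrable_const (1 : ℝ)).indicator ((hR hs).inter hD'))
      (fun t _ _ => (integrable_condExp.const_mul _).integrableOn) (fun t ht _ => ?_)
      (stronglyMeasurable_condExp.const_mul _).aestronglyMeasurable).symm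
    have ht' := hle _ ht
    rw [integral_const_mul, setIntegral_condExp hle
      ((integrable_const (1 : ℝ)).indicator hD') ht, setIntegral_indicator hD',
      setIntegral_indicator ((hR hs).inter hD')]
    simp only [integral_const, smul_eq_mul, mul_one, measureReal_restrict_apply MeasurableSet.univ,
      Set.univ_inter]
    obtain ⟨u, hu, hu'⟩ := MeasurableSet.inter (hZY _ ht) hD
    have hi := h.measure_inter_preimage_eq_mul s u hs hu
    have e : t ∩ (R ⁻¹' s ∩ D) = R ⁻¹' s ∩ Y ⁻¹' u := by rw [hu']; ext; simp; tauto
    rw [e, ← hu', measureReal_def, measureReal_def, measureReal_def, hi, ENNReal.toReal_mul]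
  have hbase : CondIndepSets m' hle
      {t | ∃ q ∈ Set.image2 (· ×ˢ ·) {s : Set β | MeasurableSet s} {t : Set δ | MeasurableSet t},
        (fun ω => (R ω, Z ω)) ⁻¹' q = t}
      {t | MeasurableSet[mγ.comap Y] t} P := by
    rw [condIndepSets_iff]
    · rintro _ B ⟨_, ⟨s, hs, c, hc, rfl⟩, rfl⟩ hB
      simp only [Set.mem_ofPred_eq] at hs hc hB
      have hC : MeasurableSet[m'] (Z ⁻¹' c) := ⟨c, hc, rfl⟩
      have e1 : (fun ω => (R ω, Z ω)) ⁻¹' (s ×ˢ c) = R ⁻¹' s ∩ Z ⁻¹' c := rfl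
      rw [e1, Set.inter_assoc]
      have h1 := key s (Z ⁻¹' c ∩ B) hs ((hZY _ hC).inter hB)
      have h2 := key s (Z ⁻¹' c) hs (hZY _ hC)
      have h3 : (P⟦Z ⁻¹' c ∩ B | m'⟧) =ᵐ[P] (Z ⁻¹' c).indicator (P⟦B | m'⟧) := by
        rw [← Set.indicator_indicator]
        exact condExp_indicator ((integrable_const _).indicator (hY.comap_le _ hB)) hC
      have h4 : (P⟦Z ⁻¹' c | m'⟧) = (Z ⁻¹' c).indicator fun _ => (1 : ℝ) :=
        condExp_of_stronglyMeasurable hle (stronglyMeasurable_const.indicator hC)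
          ((integrable_const _).indicator (hle _ hC))
      filter_upwards [h1, h2, h3] with ω h1 h2 h3
      rw [h1, Pi.mul_apply, h2, h3, h4]
      by_cases hω : ω ∈ Z ⁻¹' c <;> simp [hω]
    · rintro _ ⟨_, ⟨s, hs, c, hc, rfl⟩, rfl⟩
      exact (hR.prodMk hZ) (MeasurableSet.prod hs hc)
    · exact fun s hs => hY.comap_le _ hs
  rw [condIndepFun_iff_condIndep]
  refine hbase.condIndep (hR.prodMk hZ).comap_le hY.comap_le (isPiSystem_prod.comap _)
    (@MeasurableSpace.isPiSystem_measurableSet _ (mγ.comap Y)) ?_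
    (@MeasurableSpace.generateFrom_measurableSet _ (mγ.comap Y)).symm
  rw [← generateFrom_prod, MeasurableSpace.comap_generateFrom]
  rfl

variable {μ : EuclideanSpace ℝ (Fin n)} {S : Matrix (Fin n) (Fin n) ℝ}

lemma hasGaussianLaw_id_multivariateGaussian (μ : EuclideanSpace ℝ (Fin n))
    (S : Matrix (Fin n) (Fin n) ℝ) :
    HasGaussianLaw (id : EuclideanSpace ℝ (Fin n) → _) (multivariateGaussian μ S) :=
  ⟨by rw [Measure.map_id]; infer_instance⟩

lemma integrable_eval_multivariateGaussian (μ : EuclideanSpace ℝ (Fin n))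
    (S : Matrix (Fin n) (Fin n) ℝ) (i : Fin n) :
    Integrable (fun x : EuclideanSpace ℝ (Fin n) => x i) (multivariateGaussian μ S) :=
  (memLp_two_eval_multivariateGaussian μ S i).integrable one_le_two

/-- The covariance of the coordinate `j` with the residual of the coordinate `i`. -/
lemma covariance_residual (hS : S.PosSemidef) (b : ℝ) (i p j : Fin n) :
    cov[fun x : EuclideanSpace ℝ (Fin n) => x i - b * x p, fun x => x j; multivariateGaussian μ S] =
      S i j - b * S p j := by
  have h := memLp_two_eval_multivariateGaussian μ S
  rw [covariance_fun_sub_left (h i) ((h p).const_mul b) (h j), covariance_const_mul_left,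
    covariance_eval_multivariateGaussian hS, covariance_eval_multivariateGaussian hS]

/-- The residual of a coordinate `i` is independent of all coordinates with which it is
uncorrelated. -/
lemma indepFun_residual (hS : S.PosSemidef) (b : ℝ) (i p : Fin n) (N : Set (Fin n))
    (h : ∀ j ∈ N, S i j = b * S p j) :
    IndepFun (fun x : EuclideanSpace ℝ (Fin n) => x i - b * x p)
      (fun (x : EuclideanSpace ℝ (Fin n)) (j : N) => x j) (multivariateGaussian μ S) := by
  let := Fintype.ofFinite N
  have hg : HasGaussianLaw (fun x : EuclideanSpace ℝ (Fin n) =>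
      ((fun _ : Unit => x i - b * x p), (fun j : N => x j))) (multivariateGaussian μ S) := by
    let L : EuclideanSpace ℝ (Fin n) →L[ℝ] (Unit → ℝ) × (N → ℝ) :=
      (ContinuousLinearMap.pi fun _ => EuclideanSpace.proj i - b • EuclideanSpace.proj p).prod
        (ContinuousLinearMap.pi fun j => EuclideanSpace.proj j.1)
    exact (hasGaussianLaw_id_multivariateGaussian μ S).map_fun L
  have := hg.indepFun_of_covariance_eval
    (X := fun (_ : Unit) (x : EuclideanSpace ℝ (Fin n)) => x i - b * x p)
    (Y := fun (j : N) (x : EuclideanSpace ℝ (Fin n)) => x j) (fun _ j => by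
      rw [covariance_residual hS, h j j.2, sub_self])
  exact this.comp (φ := fun f : Unit → ℝ => f ()) (ψ := id) (by fun_prop) measurable_id

/-- The conditional expectation of one coordinate given another one is the linear regression. -/
lemma condExp_eval_multivariateGaussian (hS : S.PosSemidef) {p : Fin n} (hp : 0 < S p p)
    (i : Fin n) :
    (multivariateGaussian μ S)[fun x : EuclideanSpace ℝ (Fin n) => x i |
        MeasurableSpace.comap (fun x : EuclideanSpace ℝ (Fin n) => x p) inferInstance]
      =ᵐ[multivariateGaussian μ S]
      fun x => (μ i - S i p / S p p * μ p) + S i p / S p p * x p := by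
  set P := multivariateGaussian μ S
  set b := S i p / S p p with hb
  have hZ : Measurable fun x : EuclideanSpace ℝ (Fin n) => x p := by fun_prop
  have hR : Measurable fun x : EuclideanSpace ℝ (Fin n) => x i - b * x p := by fun_prop
  have hint := integrable_eval_multivariateGaussian μ S
  have hind : IndepFun (fun x : EuclideanSpace ℝ (Fin n) => x i - b * x p)
      (fun x : EuclideanSpace ℝ (Fin n) => x p) P := by
    have := indepFun_residual (μ := μ) hS b i p {p} (by
      rintro j rfl
      rw [hb, div_mul_cancel₀ _ hp.ne'])
    exact this.comp (φ := id) (ψ := fun f : ({p} : Set (Fin n)) → ℝ => f ⟨p, rfl⟩) measurable_id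
      (by fun_prop)
  have e : (fun x : EuclideanSpace ℝ (Fin n) => x i) =
      (fun x => x i - b * x p) + fun x => b * x p := by
    funext x; simp
  have hR2 : StronglyMeasurable[MeasurableSpace.comap
      (fun x : EuclideanSpace ℝ (Fin n) => x i - b * x p) inferInstance]
      fun x : EuclideanSpace ℝ (Fin n) => x i - b * x p :=
    (comap_measurable _).stronglyMeasurable
  have hZ2 : StronglyMeasurable[MeasurableSpace.comap
      (fun x : EuclideanSpace ℝ (Fin n) => x p) inferInstance]
      fun x : EuclideanSpace ℝ (Fin n) => b * x p :=
    ((comap_measurable _).stronglyMeasurable).const_mul b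
  have h1 := condExp_indep_eq hR.comap_le hZ.comap_le hR2 hind
  have h2 := condExp_of_stronglyMeasurable hZ.comap_le hZ2 ((hint p).const_mul b)
  have h3 := condExp_add ((hint i).sub ((hint p).const_mul b)) ((hint p).const_mul b)
    (MeasurableSpace.comap (fun x : EuclideanSpace ℝ (Fin n) => x p) inferInstance)
  rw [e]
  refine h3.trans ?_
  filter_upwards [h1] with x h1
  have h4 : ∫ x, (x i - b * x p) ∂P = μ i - b * μ p := by
    rw [integral_sub (hint i) ((hint p).const_mul b), integral_const_mul,
      integral_eval_multivariateGaussian, integral_eval_multivariateGaussian]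
  rw [Pi.add_apply, h2]
  erw [h1]
  rw [h4]

/-- The covariance of conditionally independent variables is that of their conditional
expectations. -/
lemma covariance_eq_of_condIndepFun {Ω : Type*} {m' mΩ : MeasurableSpace Ω} [StandardBorelSpace Ω]
    {hm' : m' ≤ mΩ} {P : Measure Ω} [IsProbabilityMeasure P] {X Y A B : Ω → ℝ} (hX : Measurable X)
    (hY : Measurable Y) (hX2 : MemLp X 2 P) (hY2 : MemLp Y 2 P) (h : CondIndepFun m' hm' X Y P)
    (hA2 : MemLp A 2 P) (hB2 : MemLp B 2 P) (hA : P[X | m'] =ᵐ[P] A) (hB : P[Y | m'] =ᵐ[P] B) :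
    cov[X, Y; P] = cov[A, B; P] := by
  have hprod : P[X * Y | m'] =ᵐ[P] A * B := by
    rw [condIndepFun_iff_map_prod_eq_prod_map_map hX hY] at h
    filter_upwards [ae_of_ae_trim hm' h,
      condExp_ae_eq_integral_condExpKernel hm' (hX2.integrable_mul hY2),
      condExp_ae_eq_integral_condExpKernel hm' (hX2.integrable one_le_two),
      condExp_ae_eq_integral_condExpKernel hm' (hY2.integrable one_le_two), hA, hB]
      with x h h1 h2 h3 hA hB
    rw [h1, Pi.mul_apply, ← hA, ← hB, h2, h3]
    rw [Kernel.map_apply _ (hX.prodMk hY), Kernel.prod_apply, Kernel.map_apply _ hX,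
      Kernel.map_apply _ hY] at h
    have h4 := integral_map (μ := condExpKernel P m' x) (φ := fun y => (X y, Y y))
      (hX.prodMk hY).aemeasurable (f := fun z : ℝ × ℝ => z.1 * z.2)
      (Measurable.aestronglyMeasurable (by fun_prop))
    rw [h, integral_prod_mul (fun z : ℝ => z) (fun z : ℝ => z),
      integral_map hX.aemeasurable (Measurable.aestronglyMeasurable (by fun_prop)),
      integral_map hY.aemeasurable (Measurable.aestronglyMeasurable (by fun_prop))] at h4
    exact h4.symm
  rw [covariance_eq_sub hX2 hY2, covariance_eq_sub hA2 hB2, ← integral_condExp hm',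
    ← integral_condExp hm' (f := X), ← integral_condExp hm' (f := Y), integral_congr_ae hA,
    integral_congr_ae hB, integral_congr_ae hprod]

/-- Conditional independence of two coordinates of a Gaussian vector given a third one makes the
partial covariance vanish. -/
lemma markovTriple_of_condIndepFun (hS : S.PosSemidef) {i p j : Fin n} (hp : 0 < S p p)
    (h : CondIndepFun
        (MeasurableSpace.comap (fun x : EuclideanSpace ℝ (Fin n) => x p) inferInstance)
        (Measurable.comap_le (by fun_prop))
        (fun x : EuclideanSpace ℝ (Fin n) => x i)
        (fun x : EuclideanSpace ℝ (Fin n) => x j) (multivariateGaussian μ S)) :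
    MarkovTriple S i p j := by
  have hmem := memLp_two_eval_multivariateGaussian μ S
  have hint := integrable_eval_multivariateGaussian μ S
  have hA : ∀ k, MemLp (fun x : EuclideanSpace ℝ (Fin n) =>
      (μ k - S k p / S p p * μ p) + S k p / S p p * x p) 2 (multivariateGaussian μ S) := fun k =>
    (memLp_const (μ k - S k p / S p p * μ p)).add ((hmem p).const_mul (S k p / S p p))
  have hm : ∀ k, Measurable fun x : EuclideanSpace ℝ (Fin n) => x k := fun k => by fun_prop
  have e1 := covariance_eq_of_condIndepFun (hm i) (hm j) (hmem i) (hmem j) h (hA i) (hA j)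
    (condExp_eval_multivariateGaussian hS hp i) (condExp_eval_multivariateGaussian hS hp j)
  rw [covariance_const_add_left ((hint p).const_mul _),
    covariance_const_add_right ((hint p).const_mul _), covariance_const_mul_left,
    covariance_const_mul_right, covariance_eval_multivariateGaussian hS,
    covariance_eval_multivariateGaussian hS] at e1
  have hs : S j p = S p j := by
    simpa using hS.isHermitian.apply p j
  rw [hs] at e1
  rw [MarkovTriple, e1]
  field_simp

/-- Conditional independence of a coordinate from all its non-descendants is used only for one
non-descendant at a time: for Gaussian vectors this loses nothing. -/
lemma localMarkov_of_condIndepFun (hS : S.PosSemidef) (hpos : ∀ i, 0 < S i i)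
    {T : SimpleGraph (Fin n)} {r : Fin n}
    (h : ∀ p i : Fin n, T.Adj p i → T.dist r i = T.dist r p + 1 →
      CondIndepFun
        (MeasurableSpace.comap (fun x : EuclideanSpace ℝ (Fin n) => x p) inferInstance)
        (Measurable.comap_le (by fun_prop))
        (fun x : EuclideanSpace ℝ (Fin n) => x i)
        (fun (x : EuclideanSpace ℝ (Fin n)) (j : nonDescendants T r i) => x j)
        (multivariateGaussian μ S)) : LocalMarkov T r S := fun p i hpi hd j hj =>
  markovTriple_of_condIndepFun hS (hpos p) ((h p i hpi hd).comp (φ := id)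
    (ψ := fun f : nonDescendants T r i → ℝ => f ⟨j, hj⟩) measurable_id (by fun_prop))

/-- A Gaussian distribution whose covariance matrix has the local Markov property along `T` is
`T`-structured: the residual of each coordinate is independent of the non-descendants. -/
lemma isStructured_multivariateGaussian {T : SimpleGraph (Fin n)} (hT : T.IsTree) (hS : S.PosDef)
    {r : Fin n} (h : LocalMarkov T r S) : IsStructured T (multivariateGaussian μ S) := by
  refine ⟨hT, ?_, r, fun p i hpi hd => ?_⟩
  · rw [multivariateGaussian_eq_withDensity μ hS]
    exact withDensity_absolutelyContinuous _ _
  have hp : p ∈ nonDescendants T r i := mem_nonDescendants_of_dist_lt (by omega)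
  have hpp : S p p ≠ 0 := (hS.diag_pos (i := p)).ne'
  set b := S i p / S p p with hb
  have hind := indepFun_residual (μ := μ) hS.posSemidef b i p (nonDescendants T r i) (by
    intro j hj
    have := h p i hpi hd j hj
    rw [hb]
    field_simp
    exact this)
  have hle : MeasurableSpace.comap (fun x : EuclideanSpace ℝ (Fin n) => x p) inferInstance ≤
      MeasurableSpace.comap
        (fun (x : EuclideanSpace ℝ (Fin n)) (j : nonDescendants T r i) => x j) inferInstance := by
    rintro _ ⟨s, hs, rfl⟩
    exact ⟨(fun f : nonDescendants T r i → ℝ => f ⟨p, hp⟩) ⁻¹' s,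
      (measurable_pi_apply _) hs, rfl⟩
  have := (condIndepFun_prodMk_of_indepFun (by fun_prop) (by fun_prop) (by fun_prop) hle hind).comp
    (φ := fun q : ℝ × ℝ => q.1 + b * q.2) (ψ := id) (by fun_prop) measurable_id
  have e : (fun q : ℝ × ℝ => q.1 + b * q.2) ∘ (fun x : EuclideanSpace ℝ (Fin n) =>
      (x i - b * x p, x p)) = fun x => x i := by
    funext x; simp
  rw [e] at this
  exact this

end CondIndep

/-! ### The best tree-structured approximation of a Gaussian distribution -/

section treeCovariance

/-- The covariance matrix of the Gaussian distribution that has, along the rooted tree `T`, the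
same regressions on parents and the same residual variances as the covariance matrix `S`, but
independent residuals. -/
noncomputable def treeCovariance (T : SimpleGraph (Fin n)) (r : Fin n)
    (S : Matrix (Fin n) (Fin n) ℝ) : Matrix (Fin n) (Fin n) ℝ :=
  (residualMatrix T r S)⁻¹ * diagonal (residualVar T r S) * ((residualMatrix T r S)⁻¹)ᵀ

variable {T : SimpleGraph (Fin n)} {r : Fin n} {S : Matrix (Fin n) (Fin n) ℝ}

lemma Matrix.PosDef.sq_lt (hS : S.PosDef) (i j : Fin n) (h : i ≠ j) :
    S i j ^ 2 < S i i * S j j := by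
  have hinj : Function.Injective ![i, j] := by
    intro a b
    fin_cases a <;> fin_cases b <;> simp [h, h.symm]
  have h1 := (hS.submatrix hinj).det_pos
  rw [det_fin_two] at h1
  have h2 : S j i = S i j := by simpa using hS.isHermitian.apply i j
  simp [h2] at h1
  nlinarith

lemma Matrix.PosDef.apply_comm (hS : S.PosDef) (i j : Fin n) : S i j = S j i := by
  simpa using hS.isHermitian.apply j i

lemma isUnit_det_residualMatrix (hT : T.Connected) : IsUnit (residualMatrix T r S).det := by
  rw [det_residualMatrix hT]; exact isUnit_one

lemma posDef_treeCovariance (hT : T.Connected) (hS : S.PosDef) :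
    (treeCovariance T r S).PosDef := by
  have hD : (diagonal (residualVar T r S)).PosDef := PosDef.diagonal fun i =>
    residualVar_pos hT (fun i => hS.diag_pos) hS.sq_lt i
  have h := hD.mul_mul_conjTranspose_same (B := (residualMatrix T r S)⁻¹) (by
    rw [vecMul_injective_iff_isUnit, isUnit_nonsing_inv_iff, isUnit_iff_isUnit_det]
    exact isUnit_det_residualMatrix hT)
  simpa [treeCovariance] using h

lemma residualMatrix_mul_treeCovariance (hT : T.Connected) :
    residualMatrix T r S * treeCovariance T r S =
      diagonal (residualVar T r S) * ((residualMatrix T r S)⁻¹)ᵀ := by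
  rw [treeCovariance, Matrix.mul_assoc (residualMatrix T r S)⁻¹,
    mul_nonsing_inv_cancel_left _ _ (isUnit_det_residualMatrix hT)]

/-- The residual of `i` is uncorrelated with the non-descendants of `i`, since
`residualMatrix_inv_apply` expresses these without the residual of `i`. -/
lemma localMarkov_treeCovariance (hT : T.IsTree) :
    LocalMarkov T r (treeCovariance T r S) := by
  intro p i hpi hd j hj
  have hpar : T.parent r i = p := hT.parent_eq hpi hd
  have key : ∀ k ∈ nonDescendants T r i, treeCovariance T r S i k =
      regressionCoeff T r S i * treeCovariance T r S p k := by
    intro k hk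
    have h1 := congrFun (congrFun (residualMatrix_mul_treeCovariance (r := r) (S := S)
      hT.connected) i) k
    rw [residualMatrix_mul_apply, diagonal_mul, transpose_apply,
      residualMatrix_inv_apply hT.connected hk, mul_zero, hpar] at h1
    linarith
  rw [key j hj, key p (mem_nonDescendants_of_dist_lt (by omega))]
  ring

lemma det_treeCovariance (hT : T.Connected) :
    (treeCovariance T r S).det = ∏ i, residualVar T r S i := by
  rw [treeCovariance, det_mul, det_mul, det_transpose, det_nonsing_inv, det_residualMatrix hT,
    det_diagonal]
  simp

/-- The tree covariance has the same residual variances as `S`, hence the trace is that of the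
identity matrix. -/
lemma trace_treeCovariance_inv_mul (hT : T.Connected) (hS : S.PosDef) :
    ((treeCovariance T r S)⁻¹ * S).trace = n := by
  set M := residualMatrix T r S with hM
  set D := diagonal (residualVar T r S) with hD
  have hu : IsUnit M.det := isUnit_det_residualMatrix hT
  have hpos : ∀ i, 0 < S i i := fun i => hS.diag_pos
  have hv := residualVar_pos (r := r) hT hpos hS.sq_lt
  have hinv : (treeCovariance T r S)⁻¹ = Mᵀ * (D⁻¹ * M) := by
    rw [treeCovariance, Matrix.mul_inv_rev, Matrix.mul_inv_rev, ← transpose_nonsing_inv,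
      nonsing_inv_nonsing_inv _ hu]
  have hDi : D⁻¹ = diagonal fun i => (residualVar T r S i)⁻¹ := by
    refine inv_eq_left_inv ?_
    rw [hD, diagonal_mul_diagonal, ← diagonal_one]
    congr 1
    funext i
    exact inv_mul_cancel₀ (hv i).ne'
  rw [hinv, Matrix.mul_assoc, trace_mul_comm, Matrix.mul_assoc, Matrix.mul_assoc, hDi]
  simp only [trace, diag, diagonal_mul]
  rw [← Matrix.mul_assoc]
  simp only [hM, residual_diag hS.apply_comm hpos]
  simp [(hv _).ne']

/-- For a covariance matrix with the local Markov property along a tree `R`, the relative entropy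
to the Gaussian fitted along a tree `T` is the difference of the mutual information weights of the
two trees. -/
lemma klDiv_treeCovariance {μ : EuclideanSpace ℝ (Fin n)} (hT : T.IsTree) (hS : S.PosDef)
    {R : SimpleGraph (Fin n)} (hR : R.IsTree) {r' : Fin n} (hRS : LocalMarkov R r' S) :
    klDiv (multivariateGaussian μ S) (multivariateGaussian μ (treeCovariance T r S)) =
      ENNReal.ofReal (graphWeight (gaussianMutualInfo S) R -
        graphWeight (gaussianMutualInfo S) T) := by
  have hpos : ∀ i, 0 < S i i := fun i => hS.diag_pos
  have hdet : S.det = ∏ i, residualVar R r' S i := by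
    have h := congrArg det (hRS.residual_eq_diagonal hR.connected hS.apply_comm hpos)
    rw [det_mul, det_mul, det_transpose, det_residualMatrix hR.connected, det_diagonal] at h
    simpa using h
  rw [klDiv_multivariateGaussian μ hS (posDef_treeCovariance hT.connected hS),
    trace_treeCovariance_inv_mul hT.connected hS, det_treeCovariance hT.connected, hdet,
    Real.log_prod fun i _ => (residualVar_pos hT.connected hpos hS.sq_lt i).ne',
    Real.log_prod fun i _ => (residualVar_pos hR.connected hpos hS.sq_lt i).ne',
    sum_log_residualVar hT r hS.apply_comm hpos hS.sq_lt,
    sum_log_residualVar hR r' hS.apply_comm hpos hS.sq_lt]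
  congr 1
  ring

/-- Since relative entropies are nonnegative, a tree is approximate for a tree-structured Gaussian
as soon as its mutual information weight is close to that of the true tree. -/
lemma isApproximateTree_of_graphWeight_le {μ : EuclideanSpace ℝ (Fin n)} (hT : T.IsTree)
    (hS : S.PosDef) {R : SimpleGraph (Fin n)} (hR : R.IsTree) {r' : Fin n}
    (hRS : LocalMarkov R r' S) {ε : ℝ}
    (h : graphWeight (gaussianMutualInfo S) R ≤ graphWeight (gaussianMutualInfo S) T + ε) :
    IsApproximateTree ε (multivariateGaussian μ S) T := by
  refine ⟨⟨multivariateGaussian μ (treeCovariance T r' S), inferInstance⟩, ?_, ?_⟩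
  · exact isStructured_multivariateGaussian hT (posDef_treeCovariance hT.connected hS)
      (localMarkov_treeCovariance hT)
  · refine le_trans ?_ le_self_add
    rw [ProbabilityMeasure.coe_mk, klDiv_treeCovariance hT hS hR hRS]
    exact ENNReal.ofReal_le_ofReal (by linarith)

end treeCovariance

/-! ### Sample complexity -/

section sampleComplexity

variable {S : Matrix (Fin n) (Fin n) ℝ}

lemma empiricalMutualInfo_comm {k : ℕ} (w : Fin k → EuclideanSpace ℝ (Fin n)) (i j : Fin n) :
    empiricalMutualInfo w i j = empiricalMutualInfo w j i := by
  simp only [empiricalMutualInfo, empiricalCorrelation, mul_comm]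

/-- The event that all variances which control the mutual informations along Markov chains
`a - b - c` are estimated up to the relative error `τ`. -/
def IsAccurate (S : Matrix (Fin n) (Fin n) ℝ) (τ : ℝ) {k : ℕ}
    (w : Fin k → EuclideanSpace ℝ (Fin n)) : Prop :=
  ∀ a b c, MarkovTriple S a b c → a ≠ b → c ≠ b → ∀ p q,
    |empiricalForm w (probe (chainBasis S a b c) p q) (probe (chainBasis S a b c) p q) - 1| ≤ τ

lemma IsAccurate.gap_le (hS : S.PosDef) {τ : ℝ} (hτ : τ ≤ 1 / 20) {k : ℕ} (hk : 0 < k)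
    {w : Fin k → EuclideanSpace ℝ (Fin n)} (hw : IsAccurate S τ w) {a b c : Fin n}
    (h : MarkovTriple S a b c) (hab : a ≠ b) :
    gaussianMutualInfo S a b - gaussianMutualInfo S a c ≤
      8 * (empiricalMutualInfo w a b - empiricalMutualInfo w a c) + 56 * τ ^ 2 := by
  by_cases hcb : c = b
  · subst hcb
    simp only [sub_self, mul_zero, zero_add]
    positivity
  · exact gaussianMutualInfo_gap_le hk w hS.apply_comm (fun i => hS.diag_pos) h
      (hS.sq_lt a b hab) (hS.sq_lt c b hcb) hτ (hw a b c h hab hcb)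

/-- On accurate data, the true weight of every Chow–Liu tree is close to that of the true tree.
An edge `uv` of the true tree is compared with a heavier edge `xy` in two steps along the Markov
chain `x - u - v - y`. -/
lemma IsAccurate.graphWeight_le (hS : S.PosDef) {τ : ℝ} (hτ : τ ≤ 1 / 20) {k : ℕ} (hk : 0 < k)
    {w : Fin k → EuclideanSpace ℝ (Fin n)} (hw : IsAccurate S τ w)
    {R T : SimpleGraph (Fin n)} (hR : R.IsTree) {r : Fin n} (hRS : LocalMarkov R r S)
    (hT : IsMaxSpanningTree (empiricalMutualInfo w) T) :
    graphWeight (gaussianMutualInfo S) R ≤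
      graphWeight (gaussianMutualInfo S) T + n * (112 * τ ^ 2) := by
  have hcomm := gaussianMutualInfo_comm hS.apply_comm
  have hcomm' := empiricalMutualInfo_comm w
  refine IsMaxSpanningTree.graphWeight_le
    (ω := Sym2.lift ⟨empiricalMutualInfo w, hcomm'⟩)
    (I := Sym2.lift ⟨gaussianMutualInfo S, hcomm⟩) hT hR (by positivity) ?_
  intro x y u v huv hxy hsep hle
  simp only [Sym2.lift_mk] at hle ⊢
  have hcase : ∀ {x y}, x ≠ y → empiricalMutualInfo w u v ≤ empiricalMutualInfo w x y →
      MarkovTriple S v u x → MarkovTriple S x v y →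
      gaussianMutualInfo S u v - gaussianMutualInfo S x y ≤ 112 * τ ^ 2 := by
    intro x y hxy hle h1 h2
    have hxv : x ≠ v := by
      rintro rfl
      have h3 := hS.sq_lt x u huv.ne'
      rw [MarkovTriple, hS.apply_comm u x] at h1
      nlinarith
    have e1 := hw.gap_le hS hτ hk h1 huv.ne'
    have e2 := hw.gap_le hS hτ hk h2 hxv
    rw [hcomm v u, hcomm v x, hcomm' v u, hcomm' v x] at e1
    linarith
  rcases hRS.markovTriple_of_separates hR hS.apply_comm (fun i => hS.diag_pos) huv hsep with
    ⟨h1, h2⟩ | ⟨h1, h2⟩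
  · exact hcase hxy hle h1 h2
  · rw [hcomm x y]
    exact hcase hxy.symm (hle.trans (hcomm' x y).le) h1 h2

/-- A union bound over the `n³` triples, with `9` probes each and two tails. -/
lemma measure_not_isAccurate_le (μ : EuclideanSpace ℝ (Fin n)) (hS : S.PosDef) {m : ℕ}
    (hm : 0 < m / 2) {τ : ℝ} (hτ : 0 ≤ τ) (hτ1 : τ ≤ 1) :
    Measure.pi (fun _ : Fin m => multivariateGaussian μ S)
        {x | ¬ IsAccurate S τ (pairDifferences x)} ≤
      ENNReal.ofReal (18 * n ^ 3 * Real.exp (-((m / 2 : ℕ) * τ ^ 2 / 16))) := by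
  set P := Measure.pi (fun _ : Fin m => multivariateGaussian μ S)
  let B : (Fin n × Fin n × Fin n) × Fin 3 × Fin 3 → Set (Fin m → EuclideanSpace ℝ (Fin n)) :=
    fun i => {x | MarkovTriple S i.1.1 i.1.2.1 i.1.2.2 ∧ i.1.1 ≠ i.1.2.1 ∧ i.1.2.2 ≠ i.1.2.1 ∧
      τ < |empiricalForm (pairDifferences x)
        (probe (chainBasis S i.1.1 i.1.2.1 i.1.2.2) i.2.1 i.2.2)
        (probe (chainBasis S i.1.1 i.1.2.1 i.1.2.2) i.2.1 i.2.2) - 1|}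
  have hsub : {x | ¬ IsAccurate S τ (pairDifferences x)} ⊆ ⋃ i, B i := by
    intro x hx
    simp only [IsAccurate, Set.mem_ofPred_eq, not_forall, not_le] at hx
    obtain ⟨a, b, c, h1, h2, h3, p, q, h4⟩ := hx
    exact Set.mem_iUnion.2 ⟨((a, b, c), p, q), h1, h2, h3, h4⟩
  have hB : ∀ i, P (B i) ≤ ENNReal.ofReal (2 * Real.exp (-((m / 2 : ℕ) * τ ^ 2 / 16))) := by
    rintro ⟨⟨a, b, c⟩, p, q⟩
    by_cases h : MarkovTriple S a b c ∧ a ≠ b ∧ c ≠ b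
    · obtain ⟨h1, h2, h3⟩ := h
      have hℓ := probe_form (chainBasis_form hS.apply_comm (fun i => hS.diag_pos) h1
        (hS.sq_lt a b h2) (hS.sq_lt c b h3)) p q
      have := measure_abs_empiricalForm_sub_one_le (μ := μ) hm hS.posSemidef hℓ hτ hτ1
      rw [← ENNReal.ofReal_toReal (measure_ne_top P (B _))]
      refine ENNReal.ofReal_le_ofReal (le_trans ?_ this)
      exact measureReal_mono fun x hx => hx.2.2.2
    · have : B ((a, b, c), p, q) = ∅ := by
        ext x
        simp only [Set.mem_empty_iff_false, iff_false]
        exact fun hx => h ⟨hx.1, hx.2.1, hx.2.2.1⟩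
      rw [this, measure_empty]
      exact zero_le
  refine (measure_mono hsub).trans ((measure_iUnion_fintype_le P B).trans
    ((Finset.sum_le_sum fun i _ => hB i).trans ?_))
  rw [Finset.sum_const, ← ENNReal.ofReal_nsmul]
  refine ENNReal.ofReal_le_ofReal (le_of_eq ?_)
  simp
  ring

/-- The constant `76800 = 8 * 16 * 3 * 200` makes the failure probability at most `(δ / n) ^ 8`
per event when `τ ^ 2 = ε / (200 * n)` and `m / 2` is estimated by `m / 3`. -/
lemma failure_probability_le {m : ℕ} (hn : 2 ≤ n) {ε δ : ℝ} (hε : 0 < ε) (hε1 : ε < 1)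
    (hδ : 0 < δ) (hδ1 : δ < 1)
    (h : 76800 * ((n : ℝ) / ε) * Real.log ((n : ℝ) / δ) ≤ (m : ℝ)) :
    0 < m / 2 ∧ 18 * n ^ 3 * Real.exp (-((m / 2 : ℕ) * (ε / (200 * n)) / 16)) ≤ δ := by
  have hn' : (2 : ℝ) ≤ n := by exact_mod_cast hn
  have hn0 : (0 : ℝ) < n := by linarith
  have h1 : (2 : ℝ) ≤ n / δ := by
    rw [le_div_iff₀ hδ]; nlinarith
  have hlog : Real.log 2 ≤ Real.log (n / δ) := Real.log_le_log (by norm_num) h1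
  have hlog2 := Real.log_two_gt_d9
  have h2 : (2 : ℝ) ≤ n / ε := by
    rw [le_div_iff₀ hε]; nlinarith
  have hm3 : (3 : ℝ) ≤ m := by nlinarith
  have hm3' : 3 ≤ m := by exact_mod_cast hm3
  refine ⟨by omega, ?_⟩
  have hN : (m : ℝ) ≤ 3 * (m / 2 : ℕ) := by
    have : m ≤ 3 * (m / 2) := by omega
    exact_mod_cast this
  have hexp : 8 * Real.log (n / δ) ≤ (m / 2 : ℕ) * (ε / (200 * n)) / 16 := by
    have h3 : 76800 * ((n : ℝ) / ε) * Real.log (n / δ) ≤ 3 * (m / 2 : ℕ) := h.trans hN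
    have h4 : 0 < ε / (9600 * n) := by positivity
    have h5 := mul_le_mul_of_nonneg_right h3 h4.le
    have e1 : 76800 * ((n : ℝ) / ε) * Real.log (n / δ) * (ε / (9600 * n)) =
        8 * Real.log (n / δ) := by
      field_simp
      ring
    have e2 : 3 * ((m / 2 : ℕ) : ℝ) * (ε / (9600 * n)) =
        (m / 2 : ℕ) * (ε / (200 * n)) / 16 := by
      field_simp
      ring
    rwa [e1, e2] at h5
  have hb : Real.exp (-((m / 2 : ℕ) * (ε / (200 * n)) / 16)) ≤ (δ / n) ^ 8 := by
    calc _ ≤ Real.exp (-(8 * Real.log (n / δ))) := Real.exp_le_exp.2 (by linarith)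
      _ = (δ / n) ^ 8 := by
        rw [← mul_neg, ← Real.log_inv, inv_div, mul_comm, Real.exp_mul,
          Real.exp_log (by positivity)]
        norm_cast
  calc _ ≤ 18 * n ^ 3 * (δ / n) ^ 8 := by gcongr
    _ = δ * (18 / n ^ 5) * δ ^ 7 := by field_simp
    _ ≤ δ * 1 * 1 := by
      have h6 : (18 : ℝ) / n ^ 5 ≤ 1 := by
        rw [div_le_one (by positivity)]
        calc (18 : ℝ) ≤ 2 ^ 5 := by norm_num
          _ ≤ (n : ℝ) ^ 5 := by gcongr
      have h7 : δ ^ 7 ≤ 1 := pow_le_one₀ hδ.le hδ1.le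
      gcongr
    _ = δ := by ring

/-- The choice `τ² = ε / (200 n)` bounds the loss of a Chow–Liu tree on accurate data by
`112 / 200 * ε`. For `n = 1` there is only one tree, and no assumption on the sample is needed. -/
lemma measure_not_isApproximateTree_le (μ : EuclideanSpace ℝ (Fin n)) (hS : S.PosDef)
    (hP : IsTreeStructured (multivariateGaussian μ S)) {m : ℕ} {ε δ : ℝ} (hε : 0 < ε) (hε1 : ε < 1)
    (hδ : 0 < δ) (hδ1 : δ < 1)
    (h : 76800 * ((n : ℝ) / ε) * Real.log ((n : ℝ) / δ) ≤ (m : ℝ)) :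
    Measure.pi (fun _ : Fin m => multivariateGaussian μ S)
        {x | ¬ ∀ T, IsChowLiuTree x T → IsApproximateTree ε (multivariateGaussian μ S) T} ≤
      ENNReal.ofReal δ := by
  obtain ⟨R, hR, -, r, hr⟩ := hP
  have hRS := localMarkov_of_condIndepFun hS.posSemidef (fun i => hS.diag_pos) hr
  rcases Nat.lt_or_ge n 2 with hn | hn
  · have hsub : Subsingleton (Fin n) := by
      rw [← Fintype.card_le_one_iff_subsingleton, Fintype.card_fin]; omega
    have : {x : Fin m → EuclideanSpace ℝ (Fin n) | ¬ ∀ T, IsChowLiuTree x T →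
        IsApproximateTree ε (multivariateGaussian μ S) T} = ∅ := by
      ext x
      simp only [Set.mem_ofPred_eq, Set.mem_empty_iff_false, iff_false, not_not]
      intro T hT
      have hTR : T = R := Subsingleton.elim _ _
      exact isApproximateTree_of_graphWeight_le hT.1 hS hR hRS (by rw [hTR]; linarith)
    rw [this, measure_empty]
    exact zero_le
  obtain ⟨hm, hle⟩ := failure_probability_le hn hε hε1 hδ hδ1 h
  have hn' : (2 : ℝ) ≤ n := by exact_mod_cast hn
  have hn0 : (0 : ℝ) < n := by linarith
  set τ := √(ε / (200 * n)) with hτ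
  have hτ2 : τ ^ 2 = ε / (200 * n) := Real.sq_sqrt (by positivity)
  have hτ20 : τ ≤ 1 / 20 := by
    refine Real.sqrt_le_iff.2 ⟨by norm_num, ?_⟩
    rw [div_le_iff₀ (by positivity)]
    nlinarith
  rw [← hτ2] at hle
  refine le_trans (measure_mono ?_) ((measure_not_isAccurate_le μ hS hm (Real.sqrt_nonneg _)
    (by linarith)).trans (ENNReal.ofReal_le_ofReal hle))
  intro x hx hw
  refine hx fun T hT => isApproximateTree_of_graphWeight_le hT.1 hS hR hRS ?_
  have := hw.graphWeight_le hS hτ20 hm hR hRS hT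
  have e : n * (112 * τ ^ 2) = 112 / 200 * ε := by
    rw [hτ2]; field_simp
  linarith

end sampleComplexity

/-! ### Growing a maximum spanning tree -/

section Prim

lemma exists_isMaxSpanningTree [Nonempty (Fin n)] (w : Fin n → Fin n → ℝ) :
    ∃ T, IsMaxSpanningTree w T := by
  classical
  obtain ⟨T₀, -, hT₀⟩ := (connected_top (V := Fin n)).exists_isTree_le
  obtain ⟨T, hT, hmax⟩ := Set.exists_max_image {T : SimpleGraph (Fin n) | T.IsTree} (graphWeight w)
    (Set.toFinite _) ⟨T₀, hT₀⟩
  exact ⟨T, hT, hmax⟩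

/-- The cut property: a subgraph `F` of a maximum spanning tree that lives on `A` may be extended
by a heaviest edge which leaves `A`. -/
lemma IsMaxSpanningTree.exists_sup_edge_le {ω : Sym2 (Fin n) → ℝ} {T F : SimpleGraph (Fin n)}
    (hT : IsMaxSpanningTree (fun i j => ω s(i, j)) T) (hF : F ≤ T) {A : Set (Fin n)}
    (hFA : ∀ x y, F.Adj x y → y ∈ A) {a b : Fin n} (ha : a ∈ A) (hb : b ∉ A)
    (hmax : ∀ x ∈ A, ∀ y ∉ A, ω s(x, y) ≤ ω s(a, b)) :
    ∃ T', IsMaxSpanningTree (fun i j => ω s(i, j)) T' ∧ F ⊔ edge a b ≤ T' := by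
  obtain ⟨p⟩ := hT.1.reachable_separating a b
  obtain ⟨d, -, hx, hy⟩ := p.exists_boundary_dart A ha hb
  have hd := d.adj
  rw [fromEdgeSet_adj] at hd
  obtain ⟨⟨hxy, hsep⟩, -⟩ := hd
  refine ⟨_, ⟨hT.1.exchange hsep, fun R hR => ?_⟩, sup_le_sup_right (fun u v huv => ?_) _⟩
  · rw [graphWeight_exchange ω hxy hsep]
    linarith [hT.2 R hR, hmax _ hx _ hy]
  · rw [deleteEdges_adj]
    refine ⟨hF huv, fun h => ?_⟩
    rcases Sym2.eq_iff.1 h with ⟨-, rfl⟩ | ⟨rfl, -⟩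
    · exact hy (hFA _ _ huv)
    · exact hy (hFA _ _ huv.symm)

lemma SimpleGraph.IsTree.eq_of_le {V : Type*} {T F : SimpleGraph V} (hT : T.IsTree) (hF : F ≤ T)
    (hc : F.Connected) : F = T := by
  refine le_antisymm hF fun u v huv => ?_
  by_contra h
  refine isBridge_iff.1 (isAcyclic_iff_forall_adj_isBridge.1 hT.isAcyclic huv)
    ((hc.preconnected u v).mono fun x y hxy => ?_)
  rw [deleteEdges_adj]
  refine ⟨hF hxy, fun h' => ?_⟩
  rcases Sym2.eq_iff.1 h' with ⟨rfl, rfl⟩ | ⟨rfl, rfl⟩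
  · exact h hxy
  · exact h hxy.symm

end Prim

/-! ### Programs -/

namespace RealRAM

/-- The natural number array `a` is not changed by the program. -/
def Program.KeepsNat (a : ℕ) : Program → Prop
  | skip => True
  | assignNat b _ _ => a ≠ b
  | assignReal _ _ _ _ => True
  | seq p q => p.KeepsNat a ∧ q.KeepsNat a
  | ifNatLe _ _ p q => p.KeepsNat a ∧ q.KeepsNat a
  | ifRealLe _ _ p q => p.KeepsNat a ∧ q.KeepsNat a
  | loop b _ p => a ≠ b ∧ p.KeepsNat a

/-- The real array `a` is not changed by the program. -/
def Program.KeepsReal (a : ℕ) : Program → Prop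
  | skip => True
  | assignNat _ _ _ => True
  | assignReal b _ _ _ => a ≠ b
  | seq p q => p.KeepsReal a ∧ q.KeepsReal a
  | ifNatLe _ _ p q => p.KeepsReal a ∧ q.KeepsReal a
  | ifRealLe _ _ p q => p.KeepsReal a ∧ q.KeepsReal a
  | loop _ _ p => p.KeepsReal a

/-- The rule for loop invariants. -/
lemma Program.run_loop {a : ℕ} {e : NatExpr} {p : Program} {s : State} (I : ℕ → State → Prop)
    (h0 : I 0 s) (h : ∀ k < e.eval s, ∀ s', I k s' → I (k + 1) (p.run (s'.setNat a 0 k)).1) :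
    I (e.eval s) ((loop a e p).run s).1 := by
  rw [Program.run]
  generalize e.eval s = N at h ⊢
  induction N with
  | zero => exact h0
  | succ N ih => exact h N N.lt_succ_self _ (ih fun k hk => h k (hk.trans N.lt_succ_self))

lemma State.setNat_nat_of_ne {s : State} {a b i v : ℕ} (h : b ≠ a) :
    (s.setNat a i v).nat b = s.nat b := by
  funext j; simp [State.setNat, h]

lemma State.setReal_real_of_ne {s : State} {a b i j : ℕ} {v : ℝ} (h : b ≠ a) :
    (s.setReal a i j v).real b = s.real b := by
  funext i j; simp [State.setReal, h]

lemma Program.KeepsNat.run {a : ℕ} {p : Program} (h : p.KeepsNat a) (s : State) :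
    (p.run s).1.nat a = s.nat a := by
  induction p generalizing s with
  | skip => rfl
  | assignNat b i e => exact State.setNat_nat_of_ne h
  | assignReal b i j e => rfl
  | seq p q ihp ihq => exact (ihq h.2 _).trans (ihp h.1 s)
  | ifNatLe e f p q ihp ihq =>
    simp only [Program.run]
    split_ifs
    exacts [ihp h.1 s, ihq h.2 s]
  | ifRealLe e f p q ihp ihq =>
    simp only [Program.run]
    split_ifs
    exacts [ihp h.1 s, ihq h.2 s]
  | loop b e p ih =>
    refine Program.run_loop (fun _ s' => s'.nat a = s.nat a) rfl fun k _ s' hs' => ?_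
    rw [ih h.2, State.setNat_nat_of_ne h.1, hs']

lemma Program.KeepsReal.run {a : ℕ} {p : Program} (h : p.KeepsReal a) (s : State) :
    (p.run s).1.real a = s.real a := by
  induction p generalizing s with
  | skip => rfl
  | assignNat b i e => rfl
  | assignReal b i j e => exact State.setReal_real_of_ne h
  | seq p q ihp ihq => exact (ihq h.2 _).trans (ihp h.1 s)
  | ifNatLe e f p q ihp ihq =>
    simp only [Program.run]
    split_ifs
    exacts [ihp h.1 s, ihq h.2 s]
  | ifRealLe e f p q ihp ihq =>
    simp only [Program.run]
    split_ifs
    exacts [ihp h.1 s, ihq h.2 s]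
  | loop b e p ih =>
    refine Program.run_loop (fun _ s' => s'.real a = s.real a) rfl fun k _ s' hs' => ?_
    rw [ih h, State.setNat, hs']

/-- The numbers of iterations of all loops depend on the array `0` only. -/
def Program.LoopsOverInput : Program → Prop
  | seq p q => p.LoopsOverInput ∧ q.LoopsOverInput
  | ifNatLe _ _ p q => p.LoopsOverInput ∧ q.LoopsOverInput
  | ifRealLe _ _ p q => p.LoopsOverInput ∧ q.LoopsOverInput
  | loop _ e p => (∀ s s' : State, s.nat 0 = s'.nat 0 → e.eval s = e.eval s') ∧ p.LoopsOverInput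
  | _ => True

/-- An upper bound for the number of steps of a program whose loops range over the input size; both
branches of a conditional are charged. -/
def Program.timeBound (s : State) : Program → ℕ
  | skip => 1
  | assignNat _ i e => i.cost + e.cost + 1
  | assignReal _ i j e => i.cost + j.cost + e.cost + 1
  | seq p q => p.timeBound s + q.timeBound s
  | ifNatLe e f p q => e.cost + f.cost + 1 + (p.timeBound s + q.timeBound s)
  | ifRealLe e f p q => e.cost + f.cost + 1 + (p.timeBound s + q.timeBound s)
  | loop _ e p => e.cost + 1 + e.eval s * (1 + p.timeBound s)

lemma Program.run_le_timeBound {p : Program} (hk : p.KeepsNat 0) (hl : p.LoopsOverInput)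
    {s s₀ : State} (hs : s.nat 0 = s₀.nat 0) : (p.run s).2 ≤ p.timeBound s₀ := by
  induction p generalizing s with
  | skip => exact le_rfl
  | assignNat b i e => exact le_rfl
  | assignReal b i j e => exact le_rfl
  | seq p q ihp ihq =>
    exact Nat.add_le_add (ihp hk.1 hl.1 hs) (ihq hk.2 hl.2 ((hk.1.run s).trans hs))
  | ifNatLe e f p q ihp ihq =>
    have h1 := ihp hk.1 hl.1 hs
    have h2 := ihq hk.2 hl.2 hs
    simp only [Program.run, Program.timeBound]
    split_ifs <;> omega
  | ifRealLe e f p q ihp ihq =>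
    have h1 := ihp hk.1 hl.1 hs
    have h2 := ihq hk.2 hl.2 hs
    simp only [Program.run, Program.timeBound]
    split_ifs <;> omega
  | loop b e p ih =>
    rw [Program.run, Program.timeBound, hl.1 s s₀ hs]
    generalize e.eval s₀ = N
    have key : ∀ N : ℕ, ∀ c : State × ℕ, c = Nat.rec (s, e.cost + 1)
        (fun k (c : State × ℕ) =>
          ((p.run (c.1.setNat b 0 k)).1, c.2 + 1 + (p.run (c.1.setNat b 0 k)).2)) N →
        c.1.nat 0 = s₀.nat 0 ∧ c.2 ≤ e.cost + 1 + N * (1 + p.timeBound s₀) := by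
      intro N
      induction N with
      | zero => rintro _ rfl; exact ⟨hs, by simp⟩
      | succ N ihN =>
        rintro _ rfl
        obtain ⟨h1, h2⟩ := ihN _ rfl
        have h3 := (State.setNat_nat_of_ne (i := 0) (v := N) hk.1).trans h1
        refine ⟨(hk.2.run _).trans h3, ?_⟩
        have h4 := ih hk.2 hl.2 h3
        rw [Nat.succ_mul]
        simp only
        omega
    exact (key N _ rfl).2

end RealRAM

/-! ### Prim's algorithm on arrays -/

section PrimArrays

/-- The graph with the edges `{u l, v l}` for `l < k`. -/
def edgeGraph (n : ℕ) (u v : ℕ → ℕ) (k : ℕ) : SimpleGraph (Fin n) :=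
  SimpleGraph.fromRel fun i j => ∃ l < k, u l = i ∧ v l = j

lemma edgeGraph_succ {u v u' v' : ℕ → ℕ} {k : ℕ} {a b : Fin n}
    (hu : ∀ l, u' l = if l = k then (a : ℕ) else u l)
    (hv : ∀ l, v' l = if l = k then (b : ℕ) else v l) :
    edgeGraph n u' v' (k + 1) = edgeGraph n u v k ⊔ edge a b := by
  have key : ∀ x y : Fin n, (∃ l < k + 1, u' l = x ∧ v' l = y) ↔
      (∃ l < k, u l = x ∧ v l = y) ∨ (a = x ∧ b = y) := by
    intro x y
    constructor
    · rintro ⟨l, hl, h1, h2⟩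
      rw [hu] at h1
      rw [hv] at h2
      by_cases hlk : l = k
      · rw [if_pos hlk] at h1 h2
        exact Or.inr ⟨Fin.ext h1, Fin.ext h2⟩
      · rw [if_neg hlk] at h1 h2
        exact Or.inl ⟨l, by omega, h1, h2⟩
    · rintro (⟨l, hl, h1, h2⟩ | ⟨rfl, rfl⟩)
      · exact ⟨l, by omega, by rw [hu, if_neg hl.ne, h1], by rw [hv, if_neg hl.ne, h2]⟩
      · exact ⟨k, by omega, by rw [hu, if_pos rfl], by rw [hv, if_pos rfl]⟩
  ext x y
  simp only [edgeGraph, fromRel_adj, sup_adj, edge_adj, key, @eq_comm _ x, @eq_comm _ y]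
  grind

/-- The invariant of Prim's algorithm after `k` rounds: `c` is the indicator of the set of visited
vertices, `par i` is the visited vertex with the heaviest edge to the unvisited vertex `i`, and the
recorded edges `{u l, v l}` join the visited vertices and belong to a maximum spanning tree. -/
structure PrimInvariant (ω : Sym2 (Fin n) → ℝ) (W : ℕ → ℕ → ℝ) (c par u v : ℕ → ℕ) (k : ℕ) :
    Prop where
  card : (Finset.univ.filter fun i : Fin n => c i ≠ 0).card = k + 1
  par_lt : ∀ i < n, par i < n
  par_mem : ∀ i < n, c i = 0 → c (par i) ≠ 0
  par_max : ∀ i < n, c i = 0 → ∀ j < n, c j ≠ 0 → W j i ≤ W (par i) i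
  forest : ∃ T, IsMaxSpanningTree (fun i j => ω s(i, j)) T ∧ edgeGraph n u v k ≤ T
  mem : ∀ x y, (edgeGraph n u v k).Adj x y → c y ≠ 0
  reach : ∀ x y : Fin n, c x ≠ 0 → c y ≠ 0 → (edgeGraph n u v k).Reachable x y

variable {ω : Sym2 (Fin n) → ℝ} {W : ℕ → ℕ → ℝ} {c par u v c' par' u' v' : ℕ → ℕ} {k : ℕ}

lemma PrimInvariant.init (hn : 0 < n) (hc : ∀ i, c i = if i = 0 then 1 else 0)
    (hpar : ∀ i, par i = 0) : PrimInvariant ω W c par u v 0 := by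
  have : Nonempty (Fin n) := ⟨⟨0, hn⟩⟩
  obtain ⟨T, hT⟩ := exists_isMaxSpanningTree (fun i j : Fin n => ω s(i, j))
  have hbot : edgeGraph n u v 0 = ⊥ := by
    ext x y
    simp [edgeGraph]
  have hc' : ∀ i : ℕ, c i ≠ 0 ↔ i = 0 := fun i => by rw [hc]; split_ifs <;> simp_all
  refine ⟨?_, fun i _ => by rw [hpar]; exact hn, fun i _ _ => by rw [hpar, hc]; simp,
    fun i _ _ j _ hj => ?_, ⟨T, hT, by rw [hbot]; exact bot_le⟩, fun x y h => ?_,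
    fun x y hx hy => ?_⟩
  · have : (Finset.univ.filter fun i : Fin n => c i ≠ 0) = {⟨0, hn⟩} := by
      ext i
      simp [hc', Fin.ext_iff]
    rw [this]
    rfl
  · rw [(hc' j).1 hj, hpar]
  · rw [hbot] at h
    exact h.elim
  · rw [Fin.ext (((hc' _).1 hx).trans ((hc' _).1 hy).symm)]

lemma PrimInvariant.exists_unvisited (h : PrimInvariant ω W c par u v k) (hk : k + 1 < n) :
    ∃ i < n, c i = 0 := by
  by_contra! hne
  have h1 := h.card
  rw [Finset.filter_true_of_mem fun (i : Fin n) _ => hne i i.2, Finset.card_univ,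
    Fintype.card_fin] at h1
  omega

/-- One round of Prim's algorithm, which visits the vertex `b`. -/
lemma PrimInvariant.step (hW : ∀ i j : Fin n, W i j = ω s(i, j))
    (h : PrimInvariant ω W c par u v k) {b : ℕ} (hb : b < n) (hcb : c b = 0)
    (hmax : ∀ i < n, c i = 0 → W (par i) i ≤ W (par b) b)
    (hc' : ∀ i, c' i = if i = b then 1 else c i)
    (hu' : ∀ l, u' l = if l = k then par b else u l)
    (hv' : ∀ l, v' l = if l = k then b else v l)
    (hpar' : ∀ i < n, par' i = if W b i ≤ W (par i) i then par i else b) :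
    PrimInvariant ω W c' par' u' v' (k + 1) := by
  have ha := h.par_lt b hb
  have hca := h.par_mem b hb hcb
  set bf : Fin n := ⟨b, hb⟩
  set af : Fin n := ⟨par b, ha⟩
  have hE : edgeGraph n u' v' (k + 1) = edgeGraph n u v k ⊔ edge af bf := edgeGraph_succ hu' hv'
  have hne : af ≠ bf := fun e => hca (by rw [show par b = b from congrArg Fin.val e]; exact hcb)
  have hmono : ∀ i, c i ≠ 0 → c' i ≠ 0 := fun i hi => by rw [hc']; split_ifs <;> simp [hi]
  have hc'b : c' b ≠ 0 := by rw [hc', if_pos rfl]; simp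
  have hback : ∀ i, c' i ≠ 0 → i = b ∨ c i ≠ 0 := fun i hi => by
    rw [hc'] at hi
    split_ifs at hi with h
    · exact Or.inl h
    · exact Or.inr hi
  have hzero : ∀ i, c' i = 0 → i ≠ b ∧ c i = 0 := fun i hi => by
    rw [hc'] at hi
    split_ifs at hi with h
    exact ⟨h, hi⟩
  refine ⟨?_, fun i hi => ?_, fun i hi hci => ?_, fun i hi hci j hj hcj => ?_, ?_,
    fun x y hxy => ?_, ?_⟩
  · have : (Finset.univ.filter fun i : Fin n => c' i ≠ 0) =
        insert bf (Finset.univ.filter fun i : Fin n => c i ≠ 0) := by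
      ext i
      simp only [Finset.mem_filter, Finset.mem_univ, true_and, Finset.mem_insert]
      constructor
      · intro hi
        exact (hback i hi).imp (fun h => Fin.ext h) id
      · rintro (rfl | hi)
        · exact hc'b
        · exact hmono _ hi
    rw [this, Finset.card_insert_of_notMem (by simpa [bf] using hcb), h.card]
  · rw [hpar' i hi]
    split_ifs
    exacts [h.par_lt i hi, hb]
  · rw [hpar' i hi]
    split_ifs
    exacts [hmono _ (h.par_mem i hi (hzero i hci).2), hc'b]
  · have hi' := h.par_max i hi (hzero i hci).2
    rw [hpar' i hi]
    rcases hback j hcj with rfl | hcj'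
    · split_ifs with hle
      exacts [hle, le_rfl]
    · split_ifs with hle
      · exact hi' j hj hcj'
      · exact (hi' j hj hcj').trans (not_le.1 hle).le
  -- the new edge is a heaviest one which leaves the set of visited vertices
  · obtain ⟨T, hT, hle⟩ := h.forest
    rw [hE]
    refine hT.exists_sup_edge_le hle (A := {i : Fin n | c i ≠ 0}) h.mem (a := af) (b := bf) hca
      (by simpa [bf] using hcb) fun x hx y hy => ?_
    have hy' : c y = 0 := by simpa using hy
    rw [← hW, ← hW]
    exact (h.par_max y y.2 hy' x x.2 hx).trans (hmax y y.2 hy')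
  · rw [hE, sup_adj, edge_adj] at hxy
    rcases hxy with hxy | ⟨⟨-, rfl⟩ | ⟨-, rfl⟩, -⟩
    · exact hmono _ (h.mem x y hxy)
    · exact hc'b
    · exact hmono _ hca
  · have hto : ∀ x : Fin n, c' x ≠ 0 → (edgeGraph n u' v' (k + 1)).Reachable x af := by
      intro x hx
      rw [hE]
      rcases hback x hx with hxb | hx
      · have hxb' : x = bf := Fin.ext hxb
        refine Adj.reachable ?_
        rw [hxb', sup_adj, edge_adj]
        exact Or.inr ⟨Or.inr ⟨rfl, rfl⟩, hne.symm⟩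
      · exact (h.reach x af hx hca).mono le_sup_left
    exact fun x y hx hy => (hto x hx).trans (hto y hy).symm

/-- After `n - 1` rounds the chosen edges connect all vertices, so that they exhaust the maximum
spanning tree which contains them. -/
lemma PrimInvariant.isMaxSpanningTree (h : PrimInvariant ω W c par u v k) (hk : k + 1 = n) :
    IsMaxSpanningTree (fun i j => ω s(i, j)) (edgeGraph n u v k) := by
  obtain ⟨T, hT, hle⟩ := h.forest
  have hall : ∀ i : Fin n, c i ≠ 0 := by
    have h1 := h.card
    rw [hk] at h1
    have h2 := (Finset.card_eq_iff_eq_univ _).1 (h1.trans (Fintype.card_fin n).symm)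
    intro i
    have h3 := Finset.mem_univ i
    rw [← h2] at h3
    exact (Finset.mem_filter.1 h3).2
  have : Nonempty (Fin n) := hT.1.connected.nonempty
  have hconn : (edgeGraph n u v k).Connected := ⟨fun x y => h.reach x y (hall x) (hall y)⟩
  rw [hT.1.eq_of_le hle hconn]
  exact hT

end PrimArrays

/-! ### The Chow–Liu program -/

namespace RealRAM

/-- The entry `0` of a natural number array, used as a variable. -/
def var (a : ℕ) : NatExpr := .read a (.const 0)

/-- The weight of the edge `{i, j}` computed from the Gram matrix in the real array `1`. -/
def weightExpr (i j : NatExpr) : RealExpr :=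
  .mul (.const (-1 / 2)) (.log (.sub (.const 1) (.mul
    (.div (.read 1 i j) (.sqrt (.mul (.read 1 i i) (.read 1 j j))))
    (.div (.read 1 i j) (.sqrt (.mul (.read 1 i i) (.read 1 j j)))))))

/-- Add the contribution of the pair of points `2t, 2t + 1` to the entry `(i, j)` of the Gram
matrix; the variables `i, j, t` are the arrays `3, 4, 5`. -/
def gramUpdate : Program :=
  .ifNatLe (.add (.add (var 5) (var 5)) (.const 2)) (.read 0 (.const 1))
    (.assignReal 1 (var 3) (var 4) (.add (.read 1 (var 3) (var 4)) (.mul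
      (.sub (.read 0 (.add (var 5) (var 5)) (var 3))
        (.read 0 (.add (.add (var 5) (var 5)) (.const 1)) (var 3)))
      (.sub (.read 0 (.add (var 5) (var 5)) (var 4))
        (.read 0 (.add (.add (var 5) (var 5)) (.const 1)) (var 4))))))
    .skip

/-- Compute the Gram matrix of the differences of consecutive points. -/
def gramProgram : Program :=
  .loop 3 (var 0) (.loop 4 (var 0) (.loop 5 (.read 0 (.const 1)) gramUpdate))

/-- Find the unvisited vertex that has the heaviest edge to a visited one. The array `6` is the
indicator of the visited vertices, the array `7` holds the best visited neighbours, and the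
variable `10` starts with a visited vertex and ends with the vertex sought. -/
def selectProgram : Program :=
  .loop 9 (var 0) (.ifNatLe (.read 6 (var 9)) (.const 0)
    (.ifNatLe (.const 1) (.read 6 (var 10)) (.assignNat 10 (.const 0) (var 9))
      (.ifRealLe (weightExpr (.read 7 (var 9)) (var 9)) (weightExpr (.read 7 (var 10)) (var 10))
        .skip (.assignNat 10 (.const 0) (var 9))))
    .skip)

/-- Record the edge from the selected vertex to its best neighbour as edge number `k`, where `k` is
the variable `8`, and mark the vertex as visited. -/
def recordProgram : Program :=
  .seq (.assignNat 1 (var 8) (.read 7 (var 10)))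
    (.seq (.assignNat 2 (var 8) (var 10)) (.assignNat 6 (var 10) (.const 1)))

/-- Update the best visited neighbours after a visit of the vertex stored in the variable `10`. -/
def updateProgram : Program :=
  .loop 9 (var 0) (.ifRealLe (weightExpr (var 10) (var 9)) (weightExpr (.read 7 (var 9)) (var 9))
    .skip (.assignNat 7 (var 9) (var 10)))

/-- The Chow–Liu algorithm: the Gram matrix, followed by `n - 1` rounds of Prim's algorithm. -/
def chowLiuProgram : Program :=
  .seq gramProgram (.seq (.assignNat 6 (.const 0) (.const 1))
    (.loop 8 (.sub (var 0) (.const 1)) (.seq selectProgram (.seq recordProgram updateProgram))))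

/-- The value of `weightExpr` for a Gram matrix `G`. -/
noncomputable def gramWeight (G : ℕ → ℕ → ℝ) (i j : ℕ) : ℝ :=
  -(1 / 2) * Real.log (1 - (G i j / √(G i i * G j j)) ^ 2)

lemma eval_weightExpr (s : State) (i j : NatExpr) :
    (weightExpr i j).eval s = gramWeight (s.real 1) (i.eval s) (j.eval s) := by
  simp only [weightExpr, RealExpr.eval, gramWeight, sq]
  push_cast
  ring_nf

@[simp]
lemma eval_var (s : State) (a : ℕ) : (var a).eval s = s.nat a 0 := rfl

/-- The partial sums of the entries of the Gram matrix of the differences of data points. -/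
noncomputable def partialGram (d : ℕ → ℕ → ℝ) (m i j k : ℕ) : ℝ :=
  ∑ t ∈ Finset.range k, if t + t + 2 ≤ m then
    (d (t + t) i - d (t + t + 1) i) * (d (t + t) j - d (t + t + 1) j) else 0

lemma real_one_gramProgram {s : State} (h : ∀ i j, s.real 1 i j = 0) {i j : ℕ}
    (hi : i < s.nat 0 0) (hj : j < s.nat 0 0) :
    (gramProgram.run s).1.real 1 i j = partialGram (s.real 0) (s.nat 0 1) i j (s.nat 0 1) := by
  set n := s.nat 0 0 with hn
  set m := s.nat 0 1 with hm
  set D := partialGram (s.real 0) m with hD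
  -- all entries before `(i, j)` in the lexicographic order are complete
  let Q : ℕ → ℕ → ℕ → State → Prop := fun i j k s' =>
    s'.nat 0 = s.nat 0 ∧ s'.real 0 = s.real 0 ∧ ∀ a < n, ∀ b < n, s'.real 1 a b =
      if a < i ∨ (a = i ∧ b < j) then D a b m else if a = i ∧ b = j then D a b k else 0
  have h3 := Program.run_loop (a := 3) (e := var 0)
    (p := .loop 4 (var 0) (.loop 5 (.read 0 (.const 1)) gramUpdate)) (s := s)
    (fun i s' => Q i 0 0 s') ?_ ?_
  · have := h3.2.2 i hi j hj
    rw [gramProgram, this, eval_var, if_pos (Or.inl hi)]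
  · refine ⟨rfl, rfl, fun a _ b _ => ?_⟩
    simp [h, hD, partialGram]
  intro i hi s₁ h1
  rw [eval_var] at hi
  have h4 := Program.run_loop (a := 4) (e := var 0)
    (p := .loop 5 (.read 0 (.const 1)) gramUpdate) (s := s₁.setNat 3 0 i)
    (fun j s' => Q i j 0 s' ∧ s'.nat 3 0 = i) ?_ ?_
  · have he : (var 0).eval (s₁.setNat 3 0 i) = n := by
      simp [State.setNat, h1.1, hn]
    rw [he] at h4
    obtain ⟨⟨q1, q2, q3⟩, -⟩ := h4
    refine ⟨q1, q2, fun a ha b hb => ?_⟩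
    rw [q3 a ha b hb]
    by_cases h5 : a < i ∨ a = i
    · rw [if_pos (by omega), if_pos (by omega)]
    · rw [if_neg (by omega), if_neg (by omega), if_neg (by omega)]
      split_ifs
      · simp [hD, partialGram]
      · rfl
  · refine ⟨⟨?_, h1.2.1, h1.2.2⟩, by simp [State.setNat]⟩
    rw [State.setNat_nat_of_ne (by decide), h1.1]
  rintro j hj s₂ ⟨h2, h2i⟩
  have h5 := Program.run_loop (a := 5) (e := .read 0 (.const 1))
    (p := gramUpdate) (s := s₂.setNat 4 0 j)
    (fun k s' => Q i j k s' ∧ s'.nat 3 0 = i ∧ s'.nat 4 0 = j) ?_ ?_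
  · have he : (NatExpr.read 0 (.const 1)).eval (s₂.setNat 4 0 j) = m := by
      simp [NatExpr.eval, State.setNat, h2.1, hm]
    rw [he] at h5
    obtain ⟨⟨q1, q2, q3⟩, q4, -⟩ := h5
    refine ⟨⟨q1, q2, fun a ha b hb => ?_⟩, q4⟩
    rw [q3 a ha b hb]
    by_cases h5 : a < i ∨ (a = i ∧ b < j)
    · rw [if_pos h5, if_pos (by omega)]
    · rw [if_neg h5]
      by_cases h6 : a = i ∧ b = j
      · rw [if_pos h6, if_pos (by omega)]
      · rw [if_neg h6, if_neg (by omega)]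
        split_ifs
        · simp [hD, partialGram]
        · rfl
  · refine ⟨⟨?_, h2.2.1, h2.2.2⟩, ?_, by simp [State.setNat]⟩
    · rw [State.setNat_nat_of_ne (by decide), h2.1]
    · rw [State.setNat_nat_of_ne (by decide), h2i]
  rintro t ht s₃ ⟨⟨q1, q2, q3⟩, q4, q5⟩
  have hDs : ∀ a b, D a b (t + 1) = D a b t + if t + t + 2 ≤ m then
      (s.real 0 (t + t) a - s.real 0 (t + t + 1) a) *
        (s.real 0 (t + t) b - s.real 0 (t + t + 1) b) else 0 := fun a b => by
    simp only [hD, partialGram, Finset.sum_range_succ]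
  have hj' : j < n := by
    rw [eval_var, State.setNat_nat_of_ne (by decide), h1.1] at hj
    exact hj
  have e0 : ∀ l, (s₃.setNat 5 0 t).nat 0 l = s.nat 0 l := fun l => by
    rw [State.setNat_nat_of_ne (by decide), q1]
  have e3 : (s₃.setNat 5 0 t).nat 3 0 = i := by rw [State.setNat_nat_of_ne (by decide), q4]
  have e4 : (s₃.setNat 5 0 t).nat 4 0 = j := by rw [State.setNat_nat_of_ne (by decide), q5]
  have e5 : (s₃.setNat 5 0 t).nat 5 0 = t := by simp [State.setNat]
  have er : (s₃.setNat 5 0 t).real = s₃.real := rfl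
  simp only [gramUpdate, Program.run, NatExpr.eval, RealExpr.eval, eval_var, e0, e3, e4, e5, er,
    ← hm, q2]
  split_ifs with hle
  · refine ⟨⟨funext e0, ?_, fun a ha b hb => ?_⟩, e3, e4⟩
    · rw [State.setReal_real_of_ne (by decide), er, q2]
    · simp only [State.setReal, er, true_and]
      rw [q3 a ha b hb, q3 i hi j hj', hDs, if_pos hle]
      by_cases h6 : a = i ∧ b = j
      · obtain ⟨rfl, rfl⟩ := h6
        simp
      · simp [h6]
  · refine ⟨⟨funext e0, q2, fun a ha b hb => ?_⟩, e3, e4⟩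
    rw [er, q3 a ha b hb, hDs, if_neg hle, add_zero]

/-! ### Correctness and running time of the program -/

/-- The selected vertex is unvisited and has the heaviest edge to a visited vertex. -/
lemma selectProgram_spec {s : State} (hvis : s.nat 6 (s.nat 10 0) ≠ 0)
    (hex : ∃ i < s.nat 0 0, s.nat 6 i = 0) :
    (selectProgram.run s).1.nat 10 0 < s.nat 0 0 ∧
      s.nat 6 ((selectProgram.run s).1.nat 10 0) = 0 ∧
      ∀ i < s.nat 0 0, s.nat 6 i = 0 → gramWeight (s.real 1) (s.nat 7 i) i ≤
        gramWeight (s.real 1) (s.nat 7 ((selectProgram.run s).1.nat 10 0))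
          ((selectProgram.run s).1.nat 10 0) := by
  -- the variable `10` holds a visited vertex until the first unvisited one is met, and afterwards
  -- the best unvisited vertex met so far
  have key := Program.run_loop (a := 9) (e := var 0) (s := s)
    (p := .ifNatLe (.read 6 (var 9)) (.const 0)
      (.ifNatLe (.const 1) (.read 6 (var 10)) (.assignNat 10 (.const 0) (var 9))
        (.ifRealLe (weightExpr (.read 7 (var 9)) (var 9)) (weightExpr (.read 7 (var 10)) (var 10))
          .skip (.assignNat 10 (.const 0) (var 9))))
      .skip)
    (fun k s' => s'.nat 6 = s.nat 6 ∧ s'.nat 7 = s.nat 7 ∧ s'.real 1 = s.real 1 ∧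
      (s.nat 6 (s'.nat 10 0) ≠ 0 → ∀ i < k, s.nat 6 i ≠ 0) ∧
      (s.nat 6 (s'.nat 10 0) = 0 → s'.nat 10 0 < s.nat 0 0 ∧ ∀ i < k, s.nat 6 i = 0 →
        gramWeight (s.real 1) (s.nat 7 i) i ≤
          gramWeight (s.real 1) (s.nat 7 (s'.nat 10 0)) (s'.nat 10 0))) ?_ ?_
  · obtain ⟨-, -, -, h1, h2⟩ := key
    change ((selectProgram.run s).1.nat 10 0 < _ ∧ _)
    by_cases h : s.nat 6 ((selectProgram.run s).1.nat 10 0) = 0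
    · obtain ⟨h3, h4⟩ := h2 h
      exact ⟨h3, h, h4⟩
    · obtain ⟨i, hi, hi0⟩ := hex
      exact absurd hi0 (h1 h i hi)
  · exact ⟨rfl, rfl, rfl, fun _ i hi => absurd hi (Nat.not_lt_zero i), fun h => absurd h hvis⟩
  rintro k hk s₁ ⟨q1, q2, q3, q4, q5⟩
  rw [eval_var] at hk
  have e6 : (s₁.setNat 9 0 k).nat 6 = s.nat 6 := by rw [State.setNat_nat_of_ne (by decide), q1]
  have e7 : (s₁.setNat 9 0 k).nat 7 = s.nat 7 := by rw [State.setNat_nat_of_ne (by decide), q2]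
  have e9 : (s₁.setNat 9 0 k).nat 9 0 = k := by simp [State.setNat]
  have e10 : (s₁.setNat 9 0 k).nat 10 0 = s₁.nat 10 0 := by
    rw [State.setNat_nat_of_ne (by decide)]
  have er : (s₁.setNat 9 0 k).real 1 = s.real 1 := q3
  simp only [Program.run, NatExpr.eval, eval_var, eval_weightExpr, e6, e7, e9, e10, er]
  have hset : ((s₁.setNat 9 0 k).setNat 10 0 k).nat 10 0 = k := by simp [State.setNat]
  have hset6 : ((s₁.setNat 9 0 k).setNat 10 0 k).nat 6 = s.nat 6 := by
    rw [State.setNat_nat_of_ne (by decide), e6]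
  have hset7 : ((s₁.setNat 9 0 k).setNat 10 0 k).nat 7 = s.nat 7 := by
    rw [State.setNat_nat_of_ne (by decide), e7]
  split_ifs with h1 h2 h3
  · refine ⟨hset6, hset7, q3, fun h => ?_, fun _ => ?_⟩
    · rw [hset] at h
      omega
    · rw [hset]
      refine ⟨hk, fun i hi hi0 => ?_⟩
      rcases Nat.lt_succ_iff_lt_or_eq.1 hi with hi | rfl
      · exact absurd hi0 (q4 (by omega) i hi)
      · exact le_rfl
  · refine ⟨e6, e7, er, fun h => ?_, fun h => ?_⟩
    · rw [e10] at h
      omega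
    · rw [e10] at h ⊢
      obtain ⟨q6, q7⟩ := q5 h
      refine ⟨q6, fun i hi hi0 => ?_⟩
      rcases Nat.lt_succ_iff_lt_or_eq.1 hi with hi | rfl
      · exact q7 i hi hi0
      · exact h3
  · refine ⟨hset6, hset7, q3, fun h => ?_, fun _ => ?_⟩
    · rw [hset] at h
      omega
    · rw [hset]
      refine ⟨hk, fun i hi hi0 => ?_⟩
      rcases Nat.lt_succ_iff_lt_or_eq.1 hi with hi | rfl
      · exact ((q5 (by omega)).2 i hi hi0).trans (not_le.1 h3).le
      · exact le_rfl
  · refine ⟨e6, e7, er, fun h i hi => ?_, fun h => ?_⟩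
    · rw [e10] at h
      rcases Nat.lt_succ_iff_lt_or_eq.1 hi with hi | rfl
      · exact q4 h i hi
      · omega
    · rw [e10] at h ⊢
      obtain ⟨q6, q7⟩ := q5 h
      refine ⟨q6, fun i hi hi0 => ?_⟩
      rcases Nat.lt_succ_iff_lt_or_eq.1 hi with hi | rfl
      · exact q7 i hi hi0
      · omega

lemma updateProgram_spec (s : State) {i : ℕ} (hi : i < s.nat 0 0) :
    (updateProgram.run s).1.nat 7 i =
      if gramWeight (s.real 1) (s.nat 10 0) i ≤ gramWeight (s.real 1) (s.nat 7 i) i then s.nat 7 i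
      else s.nat 10 0 := by
  have key := Program.run_loop (a := 9) (e := var 0) (s := s)
    (p := .ifRealLe (weightExpr (var 10) (var 9)) (weightExpr (.read 7 (var 9)) (var 9))
      .skip (.assignNat 7 (var 9) (var 10)))
    (fun k s' => s'.nat 10 = s.nat 10 ∧ s'.real 1 = s.real 1 ∧ ∀ i, s'.nat 7 i =
      if k ≤ i ∨ gramWeight (s.real 1) (s.nat 10 0) i ≤ gramWeight (s.real 1) (s.nat 7 i) i then
        s.nat 7 i else s.nat 10 0) ?_ ?_
  · have h := key.2.2 i
    rw [eval_var] at h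
    rw [updateProgram, h]
    simp only [not_le.2 hi, false_or]
  · exact ⟨rfl, rfl, fun i => by simp⟩
  rintro k hk s₁ ⟨q1, q2, q3⟩
  have e7 : (s₁.setNat 9 0 k).nat 7 = s₁.nat 7 := State.setNat_nat_of_ne (by decide)
  have e9 : (s₁.setNat 9 0 k).nat 9 0 = k := by simp [State.setNat]
  have e10 : (s₁.setNat 9 0 k).nat 10 = s.nat 10 := by rw [State.setNat_nat_of_ne (by decide), q1]
  have er : (s₁.setNat 9 0 k).real 1 = s.real 1 := q2
  have hk7 : s₁.nat 7 k = s.nat 7 k := by rw [q3, if_pos (Or.inl le_rfl)]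
  simp only [Program.run, NatExpr.eval, eval_var, eval_weightExpr, e7, e9, e10, er, hk7]
  split_ifs with h1
  · refine ⟨e10, er, fun i => ?_⟩
    rw [e7, q3]
    by_cases hik : i = k
    · subst hik
      simp [h1]
    · have : k + 1 ≤ i ↔ k ≤ i := by omega
      simp only [this]
  · refine ⟨?_, er, fun i => ?_⟩
    · rw [State.setNat_nat_of_ne (by decide), e10]
    · by_cases hik : i = k
      · subst hik
        simp [State.setNat, h1]
      · have h2 : ((s₁.setNat 9 0 k).setNat 7 k (s.nat 10 0)).nat 7 i = s₁.nat 7 i := by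
          simp [State.setNat, hik]
        have : k + 1 ≤ i ↔ k ≤ i := by omega
        rw [h2, q3]
        simp only [this]

/-- One round of the program is one round of Prim's algorithm. -/
lemma primRound_spec {ω : Sym2 (Fin n) → ℝ} {s : State} {k : ℕ} (hn : s.nat 0 0 = n)
    (hW : ∀ i j : Fin n, gramWeight (s.real 1) i j = ω s(i, j)) (hk : k + 1 < n)
    (h8 : s.nat 8 0 = k) (hvis : s.nat 6 (s.nat 10 0) ≠ 0)
    (h : PrimInvariant ω (gramWeight (s.real 1)) (s.nat 6) (s.nat 7) (s.nat 1) (s.nat 2) k) :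
    let s' := ((Program.seq selectProgram (.seq recordProgram updateProgram)).run s).1
    s'.nat 6 (s'.nat 10 0) ≠ 0 ∧ s'.nat 0 = s.nat 0 ∧ s'.real 1 = s.real 1 ∧
      PrimInvariant ω (gramWeight (s.real 1)) (s'.nat 6) (s'.nat 7) (s'.nat 1) (s'.nat 2)
        (k + 1) := by
  intro s'
  set s₁ := (selectProgram.run s).1 with hs₁
  have k1 : ∀ a, selectProgram.KeepsNat a → s₁.nat a = s.nat a := fun a ha => ha.run s
  have r1 : s₁.real 1 = s.real 1 :=
    Program.KeepsReal.run (p := selectProgram) (by simp [selectProgram, Program.KeepsReal]) s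
  obtain ⟨hb, hb0, hbmax⟩ := selectProgram_spec hvis (hn ▸ h.exists_unvisited hk)
  rw [← hs₁] at hb hb0 hbmax
  rw [hn] at hb hbmax
  set b := s₁.nat 10 0 with hbdef
  have e0 : s₁.nat 0 = s.nat 0 := k1 0 (by simp [selectProgram, Program.KeepsNat])
  have e1 : s₁.nat 1 = s.nat 1 := k1 1 (by simp [selectProgram, Program.KeepsNat])
  have e2 : s₁.nat 2 = s.nat 2 := k1 2 (by simp [selectProgram, Program.KeepsNat])
  have e6 : s₁.nat 6 = s.nat 6 := k1 6 (by simp [selectProgram, Program.KeepsNat])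
  have e7 : s₁.nat 7 = s.nat 7 := k1 7 (by simp [selectProgram, Program.KeepsNat])
  have e8 : s₁.nat 8 = s.nat 8 := k1 8 (by simp [selectProgram, Program.KeepsNat])
  set s₂ := (recordProgram.run s₁).1 with hs₂
  have hs₂' : s₂ = ((s₁.setNat 1 k (s.nat 7 b)).setNat 2 k b).setNat 6 b 1 := by
    simp [hs₂, recordProgram, Program.run, NatExpr.eval, State.setNat, e8, h8, e7, ← hbdef]
  have hs' : s' = (updateProgram.run s₂).1 := rfl
  have k3 : ∀ a, updateProgram.KeepsNat a → s'.nat a = s₂.nat a := fun a ha => ha.run s₂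
  have r3 : s'.real 1 = s₂.real 1 :=
    Program.KeepsReal.run (p := updateProgram) (by simp [updateProgram, Program.KeepsReal]) s₂
  have f0 : s'.nat 0 = s₂.nat 0 := k3 0 (by simp [updateProgram, Program.KeepsNat])
  have f1 : s'.nat 1 = s₂.nat 1 := k3 1 (by simp [updateProgram, Program.KeepsNat])
  have f2 : s'.nat 2 = s₂.nat 2 := k3 2 (by simp [updateProgram, Program.KeepsNat])
  have f6 : s'.nat 6 = s₂.nat 6 := k3 6 (by simp [updateProgram, Program.KeepsNat])
  have f10 : s'.nat 10 = s₂.nat 10 := k3 10 (by simp [updateProgram, Program.KeepsNat])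
  have g0 : s₂.nat 0 = s.nat 0 := by rw [hs₂', ← e0]; simp [State.setNat]
  have g7 : s₂.nat 7 = s.nat 7 := by rw [hs₂', ← e7]; simp [State.setNat]
  have g10 : s₂.nat 10 0 = b := by rw [hs₂']; simp [State.setNat, hbdef]
  have gr : s₂.real 1 = s.real 1 := by rw [hs₂', ← r1]; rfl
  have h6 : ∀ i, s'.nat 6 i = if i = b then 1 else s.nat 6 i := fun i => by
    rw [f6, hs₂', ← e6]; simp [State.setNat]
  refine ⟨by rw [f10, g10, h6, if_pos rfl]; simp, f0.trans g0, r3.trans gr, ?_⟩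
  refine h.step hW hb hb0 hbmax h6 (fun l => ?_) (fun l => ?_) (fun i hi => ?_)
  · rw [f1, hs₂', ← e1]; simp [State.setNat]
  · rw [f2, hs₂', ← e2]; simp [State.setNat]
  · rw [hs', updateProgram_spec s₂ (by rw [g0, hn]; exact hi), gr, g10, g7]

/-- The Gram matrix computed by the program determines the empirical mutual informations. -/
lemma gramWeight_eq_empiricalMutualInfo {m : ℕ} (x : Fin m → EuclideanSpace ℝ (Fin n))
    {G : ℕ → ℕ → ℝ}
    (hG : ∀ i < n, ∀ j < n, G i j = partialGram ((initial x).real 0) m i j m) (i j : Fin n) :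
    gramWeight G i j = empiricalMutualInfo (pairDifferences x) i j := by
  have key : ∀ i j : Fin n, G i j = ∑ t, pairDifferences x t i * pairDifferences x t j := by
    intro i j
    rw [hG i i.2 j j.2, partialGram, ← Finset.sum_filter]
    have hf : (Finset.range m).filter (fun t => t + t + 2 ≤ m) = Finset.range (m / 2) := by
      ext t
      simp only [Finset.mem_filter, Finset.mem_range]
      omega
    rw [hf, Finset.sum_range]
    refine Finset.sum_congr rfl fun t _ => ?_
    have ht := t.2
    have hd : ∀ i : Fin n, pairDifferences x t i =
        (initial x).real 0 (t + t) i - (initial x).real 0 (t + t + 1) i := by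
      intro i
      have h1 : (t : ℕ) + t < m := by omega
      have h2 : (t : ℕ) + t + 1 < m := by omega
      simp only [initial, h1, h2, i.2, and_self, dite_true, pairDifferences, PiLp.sub_apply,
        two_mul, Fin.eta]
    rw [hd, hd]
  rw [gramWeight, empiricalMutualInfo, empiricalCorrelation, key, key, key]

/-- The `n - 1` rounds of the program preserve the invariant of Prim's algorithm, after which all
vertices have been visited. -/
lemma isChowLiuTree_outputGraph {m : ℕ} (hn : 0 < n) (x : Fin m → EuclideanSpace ℝ (Fin n)) :
    IsChowLiuTree x (chowLiuProgram.outputGraph x) := by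
  set s := initial x with hs
  have hs0 : s.nat 0 0 = n := by simp [hs, initial]
  have hs1 : s.nat 0 1 = m := by simp [hs, initial]
  have hsa : ∀ a i, a ≠ 0 → s.nat a i = 0 := fun a i ha => by simp [hs, initial, ha]
  have hsr : ∀ i j, s.real 1 i j = 0 := fun i j => by simp [hs, initial]
  set s₁ := (gramProgram.run s).1 with hs₁
  have hkeep : ∀ a, a ≠ 3 → a ≠ 4 → a ≠ 5 → s₁.nat a = s.nat a := fun a h3 h4 h5 =>
    Program.KeepsNat.run (p := gramProgram)
      (by simp [gramProgram, gramUpdate, Program.KeepsNat, h3, h4, h5]) s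
  set ω : Sym2 (Fin n) → ℝ := Sym2.lift ⟨empiricalMutualInfo (pairDifferences x),
    empiricalMutualInfo_comm (pairDifferences x)⟩ with hω
  have hW : ∀ i j : Fin n, gramWeight (s₁.real 1) i j = ω s(i, j) := by
    refine gramWeight_eq_empiricalMutualInfo x fun i hi j hj => ?_
    rw [hs₁, real_one_gramProgram hsr (by rw [hs0]; exact hi) (by rw [hs0]; exact hj), hs1]
  set s₂ := s₁.setNat 6 0 1 with hs₂
  have e0 : s₂.nat 0 = s.nat 0 := by
    rw [hs₂, State.setNat_nat_of_ne (by decide), hkeep 0 (by decide) (by decide) (by decide)]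
  have hinit : PrimInvariant ω (gramWeight (s₁.real 1)) (s₂.nat 6) (s₂.nat 7) (s₂.nat 1)
      (s₂.nat 2) 0 := by
    refine .init hn (fun i => ?_) fun i => ?_
    · have := hsa 6 i (by decide)
      rw [← hkeep 6 (by decide) (by decide) (by decide)] at this
      simp [hs₂, State.setNat, this]
    · rw [hs₂, State.setNat_nat_of_ne (by decide), hkeep 7 (by decide) (by decide) (by decide),
        hsa 7 i (by decide)]
  have hloop := Program.run_loop (a := 8) (e := .sub (var 0) (.const 1)) (s := s₂)
    (p := .seq selectProgram (.seq recordProgram updateProgram))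
    (fun k s' => s'.nat 6 (s'.nat 10 0) ≠ 0 ∧ s'.nat 0 = s.nat 0 ∧ s'.real 1 = s₁.real 1 ∧
      PrimInvariant ω (gramWeight (s₁.real 1)) (s'.nat 6) (s'.nat 7) (s'.nat 1) (s'.nat 2) k)
    ?_ ?_
  · have heval : (NatExpr.sub (var 0) (.const 1)).eval s₂ = n - 1 := by
      simp [NatExpr.eval, e0, hs0]
    rw [heval] at hloop
    exact hloop.2.2.2.isMaxSpanningTree (by omega)
  · refine ⟨?_, e0, rfl, hinit⟩
    have h10 : s₂.nat 10 0 = 0 := by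
      rw [hs₂, State.setNat_nat_of_ne (by decide), hkeep 10 (by decide) (by decide) (by decide),
        hsa 10 0 (by decide)]
    rw [h10, hs₂]
    simp [State.setNat]
  · rintro k hk s' ⟨q1, q2, q3, q4⟩
    have hk' : k + 1 < n := by
      simp only [NatExpr.eval, eval_var, e0, hs0] at hk
      omega
    have := primRound_spec (ω := ω) (s := s'.setNat 8 0 k) (k := k)
      (by rw [State.setNat_nat_of_ne (by decide), q2, hs0])
      (by rw [show (s'.setNat 8 0 k).real 1 = s₁.real 1 from q3]; exact hW) hk'
      (by simp [State.setNat]) (by simpa [State.setNat] using q1)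
      (by
        rw [show (s'.setNat 8 0 k).real 1 = s₁.real 1 from q3]
        simp only [State.setNat_nat_of_ne (s := s') (a := 8) (b := 6) (i := 0) (v := k) (by decide),
          State.setNat_nat_of_ne (s := s') (a := 8) (b := 7) (i := 0) (v := k) (by decide),
          State.setNat_nat_of_ne (s := s') (a := 8) (b := 1) (i := 0) (v := k) (by decide),
          State.setNat_nat_of_ne (s := s') (a := 8) (b := 2) (i := 0) (v := k) (by decide)]
        exact q4)
    obtain ⟨p1, p2, p3, p4⟩ := this
    rw [show (s'.setNat 8 0 k).real 1 = s₁.real 1 from q3] at p4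
    refine ⟨p1, ?_, p3.trans q3, p4⟩
    rw [p2, State.setNat_nat_of_ne (by decide), q2]

/-- The inner loop of the Gram matrix costs `62` per step; the loops over the vertices which select
the next edge and update the best neighbours cost `118` and `98`. -/
lemma timeBound_chowLiuProgram {m : ℕ} (x : Fin m → EuclideanSpace ℝ (Fin n)) :
    chowLiuProgram.timeBound (initial x) =
      3 + n * (1 + (3 + n * (1 + (3 + m * 62)))) +
        (3 + (5 + (n - 1) * (1 + (3 + n * 118 + (15 + (3 + n * 98)))))) := by
  simp [chowLiuProgram, gramProgram, gramUpdate, selectProgram, recordProgram, updateProgram,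
    Program.timeBound, NatExpr.eval, RealExpr.cost, NatExpr.cost, weightExpr, var, initial]

lemma time_chowLiuProgram_le {m : ℕ} (hn : 1 ≤ n) (hm : 1 ≤ m)
    (x : Fin m → EuclideanSpace ℝ (Fin n)) :
    chowLiuProgram.time x ≤ 400 * (m * n ^ 2) := by
  have h0 : ∀ s s' : State, s.nat 0 = s'.nat 0 → (var 0).eval s = (var 0).eval s' :=
    fun s s' h => by rw [eval_var, eval_var, h]
  have hkeep : chowLiuProgram.KeepsNat 0 := by
    simp [chowLiuProgram, gramProgram, gramUpdate, selectProgram, recordProgram, updateProgram,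
      Program.KeepsNat]
  have hloops : chowLiuProgram.LoopsOverInput := by
    simp only [chowLiuProgram, gramProgram, gramUpdate, selectProgram, recordProgram,
      updateProgram, Program.LoopsOverInput, NatExpr.eval, and_true]
    exact ⟨⟨h0, h0, fun s s' h => by rw [h]⟩, trivial, fun s s' h => by rw [h0 s s' h], h0, trivial,
      h0⟩
  refine (Program.run_le_timeBound hkeep hloops (s₀ := initial x) rfl).trans ?_
  rw [timeBound_chowLiuProgram]
  have h1 : n ≤ n * n := Nat.le_mul_self n
  have h2 : n * n ≤ n * n * m := Nat.le_mul_of_pos_right _ hm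
  have h3 : (n - 1) * (1 + (3 + n * 118 + (15 + (3 + n * 98)))) ≤
      n * (1 + (3 + n * 118 + (15 + (3 + n * 98)))) :=
    Nat.mul_le_mul_right _ (Nat.sub_le n 1)
  have e : m * n ^ 2 = n * n * m := by ring
  rw [e]
  nlinarith

end RealRAM

theorem mainTheorem1 :
    ∃ (A : RealRAM.Program) (C K : ℝ), 0 < C ∧ 0 < K ∧
      -- `A` runs the Chow–Liu algorithm, in time `O(m n ^ 2)`, on every data set
      (∀ (n m : ℕ), 1 ≤ n → 1 ≤ m → ∀ x : Fin m → EuclideanSpace ℝ (Fin n),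
        IsChowLiuTree x (A.outputGraph x) ∧
        (A.time x : ℝ) ≤ K * ((m : ℝ) * (n : ℝ) ^ 2)) ∧
      -- with `m` i.i.d. samples, `C (n / ε) log (n / δ) ≤ m`, the output is, with probability at
      -- least `1 - δ`, an `ε`-approximate tree, however ties between spanning trees are broken
      (∀ (n m : ℕ), 1 ≤ n → 1 ≤ m →
        ∀ (μ : EuclideanSpace ℝ (Fin n)) (S : Matrix (Fin n) (Fin n) ℝ), S.PosDef →
        IsTreeStructured (multivariateGaussian μ S) →
        ∀ ε δ : ℝ, 0 < ε → ε < 1 → 0 < δ → δ < 1 →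
        C * ((n : ℝ) / ε) * Real.log ((n : ℝ) / δ) ≤ (m : ℝ) →
        Measure.pi (fun _ : Fin m => multivariateGaussian μ S)
            {x | ¬ (IsApproximateTree ε (multivariateGaussian μ S) (A.outputGraph x) ∧
              ∀ T, IsChowLiuTree x T → IsApproximateTree ε (multivariateGaussian μ S) T)}
          ≤ ENNReal.ofReal δ) := by
  refine ⟨RealRAM.chowLiuProgram, 76800, 400, by norm_num, by norm_num,
    fun n m hn hm x => ⟨RealRAM.isChowLiuTree_outputGraph hn x, ?_⟩, ?_⟩
  · exact_mod_cast RealRAM.time_chowLiuProgram_le hn hm x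
  · intro n m hn _ μ S hS hP ε δ hε hε1 hδ hδ1 h
    refine le_trans (measure_mono fun x hx hall => hx ⟨?_, hall⟩)
      (measure_not_isApproximateTree_le μ hS hP hε hε1 hδ hδ1 h)
    exact hall _ (RealRAM.isChowLiuTree_outputGraph hn x)
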